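/- **Setting.** Fix $d$, a scaling $\mathfrak s\in[1,\infty)^d$ and degrees $|\Xi|_{\mathfrak s}<0<|\mathcal I|_{\mathfrak s}$. For $k\in\mathbb N^d$ put $|k|_{\mathfrak s}=\sum_i k_i\mathfrak s_i$, and $|(\mathfrak t,k)|_{\mathfrak s}=|\mathfrak t|_{\mathfrak s}-|k|_{\mathfrak s}$ for $(\mathfrak t,k)\in\mathcal E:=\{\Xi,\mathcal I\}\times\mathbb N^d$; for $x\in\mathbb R^d$ put $|x|_{\mathfrak s}=\sum_i|x_i|^{1/\mathfrak s_i}$. *Trees.* $\mathfrak T$ is the set of isomorphism classes of finite rooted trees $\tau=T^{\mathfrak n}_{\mathfrak e}$ with edge decorations $\mathfrak e$ in $\mathcal E$ and node decorations $\mathfrak n$ in $\mathbb N^d$, such that every noise edge (type $\Xi$) ends in a leaf $y$ with $\mathfrak n(y)=0$. It is a commutative monoid under the tree product (join the roots and add their decorations), generated by the one-node trees $X^k$, the trees $\Xi_l$ with a single noise edge, and the planted trees $\mathcal I_m[\tau]$; the unit is $\mathbf 1=X^0$, and $X_i=X^{e_i}$. The degree $|\tau|_{\mathfrak s}$ is the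 sum of $|\mathfrak e(e)|_{\mathfrak s}$ over the edges $e$ and of $|\mathfrak n(x)|_{\mathfrak s}$ over the nodes $x$. Write $\mathcal V=\mathrm{Span}_{\mathbb R}\mathfrak T$. *Rule.* Let $R$ be a set of finite multisets of elements of $\mathcal E$. Assume that $R$ is *normal* ($A\subset B\in R$ implies $A\in R$) and *subcritical*: there is $\mathrm{reg}:\{\Xi,\mathcal I\}\to\mathbb R$ with $\mathrm{reg}(\Xi)<|\Xi|_{\mathfrak s}$ and $\mathrm{reg}(\mathcal I)<|\mathcal I|_{\mathfrak s}+\inf_{N\in R}\sum_{(\mathfrak t,k)\in N}(\mathrm{reg}(\mathfrak t)-|k|_{\mathfrak s})$. Let $\mathfrak T_\circ$ be the set of trees for which at each node the multiset of decorations of the edges leaving it (away from the root) belongs to $R$; put $\mathcal T=\mathrm{Span}_{\mathbb R}\mathfrak T_\circ$ and $A=\{|\tau|_{\mathfrak s}:\tau\in\mathfrak T_\circ\}$. *Negative renormalisation.* $\mathfrak T_-$ is the set of $\tau\in\mathfrak T_\circ$ with $|\tau|_{\mathfrak s}<0$ and $\mathfrak n(\text{root})=0$ that are not of the form $\Xi_l$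 or $\mathcal I_m[\sigma]$. $\mathcal F_-$ is the free commutative algebra generated by $\mathfrak T_-$ (the span of forests of such trees), and $G_-$ is the set of its characters (unital multiplicative linear maps $\mathcal F_-\to\mathbb R$). Define $\Delta^-:\mathcal V\to\mathcal F_-\otimes\mathcal V$ by $$\Delta^-T^{\mathfrak n}_{\mathfrak e}=\sum_{A\subset T}\ \sum_{\mathfrak e_A,\mathfrak n_A}\frac1{\mathfrak e_A!}\binom{\mathfrak n}{\mathfrak n_A}\,\pi_-\big(A,\mathfrak n_A+\pi\mathfrak e_A,\mathfrak e{\restriction}E_A\big)\otimes\big(T/A,[\mathfrak n-\mathfrak n_A]_A,\mathfrak e+\mathfrak e_A\big),$$ where $A$ runs over the (possibly empty) subgraphs of $T$, viewed as forests of rooted trees; $\mathfrak n_A:N_A\to\mathbb N^d$ satisfies $\mathfrak n_A\le\mathfrak n$; $\mathfrak e_A:\partial(A,T)\to\mathbb N^d$, with $\partial(A,T)$ the set of edges not in $A$ whose node nearer to the root is in $A$; $(\pi\mathfrak e_A)(x)$ is the sum of $\mathfrak e_A$ over the boundary edges leaving $x$; $T/A$ contracts each connected component of $A$ to one node; $[\cdot]_A$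 sums node decorations over each component; and $\pi_-$ sends every forest not consisting of trees in $\mathfrak T_-$ to $0$. Assume that $R$ is *complete*: $\Delta^-$ maps $\mathcal T$ into $\mathcal F_-\otimes\mathcal T$. *Positive renormalisation.* $\Delta^+:\mathcal V\to\mathcal V\otimes\mathcal V$ is the multiplicative linear map with $\Delta^+X_i=X_i\otimes\mathbf 1+\mathbf 1\otimes X_i$, $\Delta^+\Xi_l=\Xi_l\otimes\mathbf 1$ and $$\Delta^+\mathcal I_m\tau=(\mathcal I_m\otimes\mathrm{id})\Delta^+\tau+\sum_{|k|_{\mathfrak s}<|\mathcal I_m\tau|_{\mathfrak s}}\frac{X^k}{k!}\otimes\mathcal I_{m+k}\tau .$$ On $\mathcal T$ its right factors lie in the span $\mathcal T_+$ of the products of some $X^k$ and trees $\mathcal I_m\tau$ with $\tau\in\mathfrak T_\circ$ and $|\mathcal I_m\tau|_{\mathfrak s}>0$, and its left factors in $\mathcal T$. Let $K:\mathbb R^d\to\mathbb R$ be integrable, smooth on $\mathbb R^d\setminus\{0\}$, and zero for $|z|\ge1$; for smooth $F$ let $D^mK*F=K*D^mF$. For linear $\mathbf\Pi:\mathcal T\to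 C^\infty(\mathbb R^d)$ and $x\in\mathbb R^d$ there is a unique character $f_x$ of $\mathcal T_+$ such that, with $F_x=(\mathrm{id}\otimes f_x)\Delta^+:\mathcal T\to\mathcal T$ and $\Pi_x=\mathbf\Pi F_x$, one has $f_x(X_i)=-x_i$ and $$f_x(\mathcal I_n\tau)=-\sum_{|\ell|_{\mathfrak s}<|\mathcal I_n\tau|_{\mathfrak s}}\frac{(-x)^\ell}{\ell!}\,(D^{n+\ell}K*\Pi_x\tau)(x)\qquad(\tau\in\mathfrak T_\circ,\ |\mathcal I_n\tau|_{\mathfrak s}>0).$$ The map $F_x$ is invertible; put $\Gamma_{xy}=F_x^{-1}F_y$. *Pre-models.* $\mathbf\Pi$ is *admissible* if there is $\xi\in C^\infty(\mathbb R^d)$ such that, whenever the trees involved are in $\mathfrak T_\circ$, $\mathbf\Pi(X^k\tau)=(\cdot)^k\,\mathbf\Pi\tau$, $\mathbf\Pi\mathbf 1=1$, $\mathbf\Pi\Xi_l=D^l\xi$ and $\mathbf\Pi\mathcal I_m[\tau]=D^mK*\mathbf\Pi\tau$. Fix an integer $r>1-\alpha$ for every $\alpha\in A$, and let $\mathcal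 B^r$ be the set of smooth $\phi$ supported in the open unit ball with $|D^k\phi|\le1$ for all $k$ with $\sum_ik_i\le r$. Put $\phi^\lambda_x(z)=\lambda^{-\mathfrak s_1-\dots-\mathfrak s_d}\phi\big(\lambda^{-\mathfrak s_1}(z_1-x_1),\dots,\lambda^{-\mathfrak s_d}(z_d-x_d)\big)$. An admissible $\mathbf\Pi$ is a *pre-model* if for every $\tau\in\mathfrak T_\circ$ and every compact $C\subset\mathbb R^d$ there is a constant $c$ with $$\Big|\int_{\mathbb R^d}(\Pi_x\tau)(z)\,\phi^\lambda_x(z)\,dz\Big|\le c\,\lambda^{|\tau|_{\mathfrak s}},\qquad |\Gamma_{xy}\tau|_\gamma\le c\,|x-y|_{\mathfrak s}^{|\tau|_{\mathfrak s}-\gamma}$$ for all $x,y\in C$, $\lambda\in(0,1]$, $\phi\in\mathcal B^r$ and $\gamma\in A$ with $\gamma\le|\tau|_{\mathfrak s}$, where $|v|_\gamma$ is the $\ell^1$-norm of the coefficients in $v$ of the trees of degree $\gamma$. **Theorem.** Let $g\in G_-$. If $\mathbf\Pi:\mathcal T\to C^\infty(\mathbb R^d)$ is a pre-model, then so is $$\mathbf\Pi^g:=(g\otimes\mathbf\Pi)\Delta^-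 .$$ -/

import Mathlib

open scoped TensorProduct ContDiff

noncomputable section

namespace RegStruct

/-! ### Combinatorial decorated rooted trees -/

/-- Multi-indices in `ℕ^d`. -/
abbrev MIdx (d : ℕ) := Fin d → ℕ

/-- Planar presentations of decorated rooted trees: `poly k` is the one-node tree `X^k`;
`noise l t` is `t` with a further noise edge of decoration `(Ξ, l)` (ending in a noise leaf)
attached at the root; `kernel m s t` is `t` with a further kernel edge of decoration `(𝓘, m)`
attached at the root, on the other end of which sits the root of `s`. -/
inductive PTree (d : ℕ) : Type
  | poly (k : MIdx d) : PTree d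
  | noise (l : MIdx d) (t : PTree d) : PTree d
  | kernel (m : MIdx d) (s t : PTree d) : PTree d

namespace PTree

variable {d : ℕ}

/-- Isomorphism of decorated rooted trees: the order in which edges are attached at a node is
irrelevant. -/
inductive Iso : PTree d → PTree d → Prop
  | refl (t : PTree d) : Iso t t
  | symm {t t' : PTree d} : Iso t t' → Iso t' t
  | trans {t t' t'' : PTree d} : Iso t t' → Iso t' t'' → Iso t t''
  | noise_congr (l : MIdx d) {t t' : PTree d} : Iso t t' → Iso (noise l t) (noise l t')
  | kernel_congr (m : MIdx d) {s s' t t' : PTree d} :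
      Iso s s' → Iso t t' → Iso (kernel m s t) (kernel m s' t')
  | noise_noise (l l' : MIdx d) (t : PTree d) :
      Iso (noise l (noise l' t)) (noise l' (noise l t))
  | noise_kernel (l m : MIdx d) (s t : PTree d) :
      Iso (noise l (kernel m s t)) (kernel m s (noise l t))
  | kernel_kernel (m m' : MIdx d) (s s' t : PTree d) :
      Iso (kernel m s (kernel m' s' t)) (kernel m' s' (kernel m s t))

instance setoid (d : ℕ) : Setoid (PTree d) := ⟨Iso, Iso.refl, Iso.symm, Iso.trans⟩

/-- Add `k` to the polynomial decoration of the root. -/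
def addPoly (k : MIdx d) : PTree d → PTree d
  | poly k' => poly (k + k')
  | noise l t => noise l (addPoly k t)
  | kernel m s t => kernel m s (addPoly k t)

/-- The tree product: join the roots and add their polynomial decorations. -/
def mul : PTree d → PTree d → PTree d
  | poly k, b => addPoly k b
  | noise l t, b => noise l (mul t b)
  | kernel m s t, b => kernel m s (mul t b)

theorem addPoly_congr (k : MIdx d) {t t' : PTree d} (h : Iso t t') :
    Iso (addPoly k t) (addPoly k t') := by
  induction h with
  | refl t => exact .refl _
  | symm _ ih => exact .symm ih
  | trans _ _ ih ih' => exact .trans ih ih'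
  | noise_congr l _ ih => exact .noise_congr l ih
  | kernel_congr m hs _ _ ih => exact .kernel_congr m hs ih
  | noise_noise l l' t => exact .noise_noise ..
  | noise_kernel l m s t => exact .noise_kernel ..
  | kernel_kernel m m' s s' t => exact .kernel_kernel ..

theorem mul_congr_left {a a' : PTree d} (h : Iso a a') (b : PTree d) :
    Iso (mul a b) (mul a' b) := by
  induction h with
  | refl t => exact .refl _
  | symm _ ih => exact .symm ih
  | trans _ _ ih ih' => exact .trans ih ih'
  | noise_congr l _ ih => exact .noise_congr l ih
  | kernel_congr m hs _ _ ih => exact .kernel_congr m hs ih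
  | noise_noise l l' t => exact .noise_noise ..
  | noise_kernel l m s t => exact .noise_kernel ..
  | kernel_kernel m m' s s' t => exact .kernel_kernel ..

theorem mul_congr_right (a : PTree d) {b b' : PTree d} (h : Iso b b') :
    Iso (mul a b) (mul a b') := by
  induction a with
  | poly k => exact addPoly_congr k h
  | noise l t ih => exact .noise_congr l ih
  | kernel m s t _ ih => exact .kernel_congr m (.refl _) ih

theorem addPoly_addPoly (k k' : MIdx d) (t : PTree d) :
    addPoly k (addPoly k' t) = addPoly (k + k') t := by
  induction t with
  | poly j => simp [addPoly, add_assoc]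
  | noise l t ih => simp [addPoly, ih]
  | kernel m s t _ ih => simp [addPoly, ih]

theorem addPoly_zero (t : PTree d) : addPoly 0 t = t := by
  induction t with
  | poly j => simp [addPoly]
  | noise l t ih => simp [addPoly, ih]
  | kernel m s t _ ih => simp [addPoly, ih]

theorem addPoly_mul (k : MIdx d) (b c : PTree d) :
    mul (addPoly k b) c = addPoly k (mul b c) := by
  induction b with
  | poly j => simp [addPoly, mul, addPoly_addPoly]
  | noise l t ih => simp [addPoly, mul, ih]
  | kernel m s t _ ih => simp [addPoly, mul, ih]

theorem mul_assoc' (a b c : PTree d) : mul (mul a b) c = mul a (mul b c) := by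
  induction a with
  | poly k => simp [mul, addPoly_mul]
  | noise l t ih => simp [mul, ih]
  | kernel m s t _ ih => simp [mul, ih]

theorem mul_poly (b : PTree d) (k : MIdx d) : mul b (poly k) = addPoly k b := by
  induction b with
  | poly j => simp [mul, addPoly, add_comm]
  | noise l t ih => simp [mul, addPoly, ih]
  | kernel m s t _ ih => simp [mul, addPoly, ih]

theorem mul_noise (b : PTree d) (l : MIdx d) (t : PTree d) :
    Iso (mul b (noise l t)) (noise l (mul b t)) := by
  induction b with
  | poly j => exact .refl _
  | noise l' b ih => exact .trans (.noise_congr l' ih) (.noise_noise ..)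
  | kernel m s b _ ih => exact .trans (.kernel_congr m (.refl _) ih) (.symm (.noise_kernel ..))

theorem mul_kernel (b : PTree d) (m : MIdx d) (s t : PTree d) :
    Iso (mul b (kernel m s t)) (kernel m s (mul b t)) := by
  induction b with
  | poly j => exact .refl _
  | noise l' b ih => exact .trans (.noise_congr l' ih) (.noise_kernel ..)
  | kernel m' s' b _ ih => exact .trans (.kernel_congr m' (.refl _) ih) (.kernel_kernel ..)

theorem mul_comm' (a b : PTree d) : Iso (mul a b) (mul b a) := by
  induction a with
  | poly k => rw [mul_poly]; exact .refl _
  | noise l t ih => exact .trans (.noise_congr l ih) (.symm (mul_noise b l t))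
  | kernel m s t _ ih =>
    exact .trans (.kernel_congr m (.refl _) ih) (.symm (mul_kernel b m s t))

end PTree

/-- The set `𝔗` of (combinatorial) decorated rooted trees. -/
def Tree (d : ℕ) : Type := Quotient (PTree.setoid d)

namespace Tree

variable {d : ℕ}

/-- The tree presented by `t`. -/
def mk (t : PTree d) : Tree d := Quotient.mk _ t

/-- The tree `X^k`. -/
def X (k : MIdx d) : Tree d := mk (PTree.poly k)

/-- The tree `Ξ_l` with a single noise edge. -/
def Xi (l : MIdx d) : Tree d := mk (PTree.noise l (PTree.poly 0))

/-- The planted tree `𝓘_m[τ]`. -/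
def I (m : MIdx d) : Tree d → Tree d :=
  Quotient.map (fun s => PTree.kernel m s (PTree.poly 0))
    (fun _ _ h => PTree.Iso.kernel_congr m h (PTree.Iso.refl _))

/-- `𝔗` is a commutative monoid under the tree product, with unit the one-node tree `X^0`. -/
instance : CommMonoid (Tree d) where
  mul := Quotient.map₂ PTree.mul
    (fun a _ h _ b' h' => (PTree.mul_congr_right a h').trans (PTree.mul_congr_left h b'))
  one := X 0
  mul_assoc a b c := by
    induction a, b, c using Quotient.inductionOn₃ with
    | h a b c => exact congrArg (Quotient.mk _) (PTree.mul_assoc' a b c)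
  one_mul a := by
    induction a using Quotient.inductionOn with
    | h a => exact congrArg (Quotient.mk _) (PTree.addPoly_zero a)
  mul_one a := by
    induction a using Quotient.inductionOn with
    | h a => exact congrArg (Quotient.mk _)
              ((PTree.mul_poly a 0).trans (PTree.addPoly_zero a))
  mul_comm a b := by
    induction a, b using Quotient.inductionOn₂ with
    | h a b => exact Quotient.sound (PTree.mul_comm' a b)

theorem mk_mul (a b : PTree d) : mk (PTree.mul a b) = mk a * mk b := rfl

theorem one_def : (1 : Tree d) = X 0 := rfl

theorem X_add (k k' : MIdx d) : X (k + k') = X k * X k' := rfl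

theorem I_mk (m : MIdx d) (s : PTree d) : I m (mk s) = mk (PTree.kernel m s (PTree.poly 0)) := rfl

theorem mk_noise (l : MIdx d) (t : PTree d) : mk (PTree.noise l t) = Xi l * mk t := by
  rw [Xi, ← mk_mul]; simp [PTree.mul, PTree.addPoly_zero]

theorem mk_kernel (m : MIdx d) (s t : PTree d) :
    mk (PTree.kernel m s t) = I m (mk s) * mk t := by
  rw [I_mk, ← mk_mul]; simp [PTree.mul, PTree.addPoly_zero]

/-- Induction on trees. -/
theorem induction {p : Tree d → Prop} (hX : ∀ k, p (X k))
    (hXi : ∀ l t, p t → p (Xi l * t)) (hI : ∀ m s t, p s → p t → p (I m s * t))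
    (t : Tree d) : p t := by
  induction t using Quotient.inductionOn with
  | h t =>
    change p (mk t)
    induction t with
    | poly k => exact hX k
    | noise l t ih => rw [mk_noise]; exact hXi l _ ih
    | kernel m s t ih ih' => rw [mk_kernel]; exact hI m _ _ ih ih'

theorem X_eq_prod (k : MIdx d) : X k = ∏ i, X (Pi.single i 1) ^ k i := by
  let φ : Multiplicative (MIdx d) →* Tree d :=
    { toFun := fun k => X (Multiplicative.toAdd k), map_one' := rfl, map_mul' := fun _ _ => rfl }
  have h : Multiplicative.ofAdd k =
      ∏ i, (Multiplicative.ofAdd (Pi.single i 1 : MIdx d)) ^ k i := by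
    apply Multiplicative.toAdd.injective
    rw [toAdd_prod]
    simp only [toAdd_ofAdd, toAdd_pow]
    funext j
    simp [Finset.sum_apply, Pi.single_apply]
  have h' := congrArg φ h
  rw [map_prod] at h'
  simp only [map_pow] at h'
  exact h'

/-- Two multiplicative maps agree if they agree on the `X_i` and the `Ξ_l`, and if agreement at `τ`
implies agreement at `𝓘_m[τ]`. -/
theorem hom_congr {A : Type*} [CommMonoid A] {φ ψ : Tree d →* A}
    (hX : ∀ i, φ (X (Pi.single i 1)) = ψ (X (Pi.single i 1))) (hXi : ∀ l, φ (Xi l) = ψ (Xi l))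
    (hI : ∀ m t, φ t = ψ t → φ (I m t) = ψ (I m t)) (t : Tree d) : φ t = ψ t := by
  induction t using Tree.induction with
  | hX k => rw [X_eq_prod]; simp [map_prod, map_pow, hX]
  | hXi l t ih => rw [map_mul, map_mul, ih, hXi]
  | hI m s t ih ih' => rw [map_mul, map_mul, ih', hI m s ih]

section Fold

variable {A : Type*} [CommMonoid A] (a : Fin d → A) (b : MIdx d → A)
  (c : MIdx d → Tree d → A → A)

/-- Auxiliary to `Tree.fold`. -/
def foldAux : PTree d → A
  | PTree.poly k => ∏ i, a i ^ k i
  | PTree.noise l t => b l * foldAux t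
  | PTree.kernel m s t => c m (mk s) (foldAux s) * foldAux t

theorem foldAux_congr {t t' : PTree d} (h : PTree.Iso t t') :
    foldAux a b c t = foldAux a b c t' := by
  induction h with
  | refl t => rfl
  | symm _ ih => exact ih.symm
  | trans _ _ ih ih' => exact ih.trans ih'
  | noise_congr l _ ih => simp [foldAux, ih]
  | @kernel_congr m s s' t t' hs _ ih ih' =>
    have : mk s = mk s' := Quotient.sound hs
    simp [foldAux, ih, ih', this]
  | noise_noise l l' t => simp [foldAux, mul_left_comm]
  | noise_kernel l m s t => simp [foldAux, mul_left_comm]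
  | kernel_kernel m m' s s' t => simp [foldAux, mul_left_comm]

theorem foldAux_addPoly (k : MIdx d) (t : PTree d) :
    foldAux a b c (PTree.addPoly k t) = (∏ i, a i ^ k i) * foldAux a b c t := by
  induction t with
  | poly j => simp [foldAux, PTree.addPoly, pow_add, Finset.prod_mul_distrib]
  | noise l t ih => simp [foldAux, PTree.addPoly, ih, mul_left_comm]
  | kernel m s t _ ih => simp [foldAux, PTree.addPoly, ih, mul_left_comm]

theorem foldAux_mul (t t' : PTree d) :
    foldAux a b c (PTree.mul t t') = foldAux a b c t * foldAux a b c t' := by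
  induction t with
  | poly j => simp [foldAux, PTree.mul, foldAux_addPoly]
  | noise l t ih => simp [foldAux, PTree.mul, ih, mul_assoc]
  | kernel m s t _ ih => simp [foldAux, PTree.mul, ih, mul_assoc]

/-- Recursive definition of multiplicative maps on trees: the unique monoid morphism `Φ` with
`Φ(X_i) = a i`, `Φ(Ξ_l) = b l` and `Φ(𝓘_m[τ]) = c m τ Φ(τ)`. -/
def fold : Tree d →* A where
  toFun := Quotient.lift (foldAux a b c) (fun _ _ h => foldAux_congr a b c h)
  map_one' := by
    change foldAux a b c (PTree.poly 0) = 1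
    simp [foldAux]
  map_mul' t t' := by
    induction t, t' using Quotient.inductionOn₂ with
    | h t t' => exact foldAux_mul a b c t t'

theorem fold_X (k : MIdx d) : fold a b c (X k) = ∏ i, a i ^ k i := rfl

theorem fold_X_single (i : Fin d) : fold a b c (X (Pi.single i 1)) = a i := by
  rw [fold_X, Finset.prod_eq_single i]
  · simp
  · intro j _ hj
    simp [Pi.single_eq_of_ne hj]
  · simp

theorem fold_Xi (l : MIdx d) : fold a b c (Xi l) = b l := by
  change b l * foldAux a b c (PTree.poly 0) = b l
  simp [foldAux]

theorem fold_I (m : MIdx d) (t : Tree d) : fold a b c (I m t) = c m t (fold a b c t) := by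
  induction t using Quotient.inductionOn with
  | h t =>
    change c m (mk t) (foldAux a b c t) * foldAux a b c (PTree.poly 0) = _
    simp only [foldAux, Pi.zero_apply, pow_zero, Finset.prod_const_one, mul_one]
    rfl

end Fold

end Tree

/-! ### Degrees and rules -/

/-- A scaling `𝔰 ∈ [1,∞)^d` and a degree map with `|Ξ|_𝔰 < 0` and `|𝓘|_𝔰 > 0`. -/
structure Scaling (d : ℕ) where
  s : Fin d → ℝ
  one_le : ∀ i, 1 ≤ s i
  degXi : ℝ
  degXi_neg : degXi < 0
  degI : ℝ
  degI_pos : 0 < degI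

/-- The two types. -/
inductive EType
  | Xi
  | I

/-- Edge types `(𝔱, p)`. -/
abbrev EdgeType (d : ℕ) := EType × MIdx d

namespace Scaling

variable {d : ℕ} (S : Scaling d)

/-- `|k|_𝔰 = ∑ k_i 𝔰_i`. -/
def midx (k : MIdx d) : ℝ := ∑ i, (k i : ℝ) * S.s i

/-- The degree `|𝔱|_𝔰` of a type. -/
def degType : EType → ℝ
  | EType.Xi => S.degXi
  | EType.I => S.degI

/-- The degree `|τ|_𝔰` of a tree. -/
def deg (τ : Tree d) : ℝ :=
  Multiplicative.toAdd (Tree.fold (A := Multiplicative ℝ)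
    (fun i => Multiplicative.ofAdd (S.s i))
    (fun l => Multiplicative.ofAdd (S.degXi - S.midx l))
    (fun m _ v => Multiplicative.ofAdd (S.degI - S.midx m) * v) τ)

/-- The sum over all edges of `τ` of the absolute value of the degree of the edge. -/
def edgeWeight (τ : Tree d) : ℝ :=
  Multiplicative.toAdd (Tree.fold (A := Multiplicative ℝ)
    (fun _ => 1)
    (fun l => Multiplicative.ofAdd |S.degXi - S.midx l|)
    (fun m _ v => Multiplicative.ofAdd |S.degI - S.midx m| * v) τ)

theorem deg_mul (τ σ : Tree d) : S.deg (τ * σ) = S.deg τ + S.deg σ := by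
  simp only [deg, map_mul]; rfl

theorem deg_one : S.deg 1 = 0 := by simp [deg]

theorem deg_X (k : MIdx d) : S.deg (Tree.X k) = S.midx k := by
  rw [deg, Tree.fold_X, toAdd_prod]
  simp [midx]

theorem deg_Xi (l : MIdx d) : S.deg (Tree.Xi l) = S.degXi - S.midx l := by
  rw [deg, Tree.fold_Xi]; rfl

theorem deg_I (m : MIdx d) (τ : Tree d) :
    S.deg (Tree.I m τ) = S.degI - S.midx m + S.deg τ := by
  rw [deg, Tree.fold_I]; rfl

theorem midx_nonneg (k : MIdx d) : 0 ≤ S.midx k :=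
  Finset.sum_nonneg fun j _ =>
    mul_nonneg (Nat.cast_nonneg _) (zero_le_one.trans (S.one_le j))

theorem edgeWeight_mul (τ σ : Tree d) :
    S.edgeWeight (τ * σ) = S.edgeWeight τ + S.edgeWeight σ := by
  simp only [edgeWeight, map_mul]; rfl

theorem edgeWeight_X (k : MIdx d) : S.edgeWeight (Tree.X k) = 0 := by
  rw [edgeWeight, Tree.fold_X]; simp

theorem edgeWeight_Xi (l : MIdx d) : S.edgeWeight (Tree.Xi l) = |S.degXi - S.midx l| := by
  rw [edgeWeight, Tree.fold_Xi]; rfl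

theorem edgeWeight_I (m : MIdx d) (τ : Tree d) :
    S.edgeWeight (Tree.I m τ) = |S.degI - S.midx m| + S.edgeWeight τ := by
  rw [edgeWeight, Tree.fold_I]; rfl

theorem edgeWeight_nonneg (τ : Tree d) : 0 ≤ S.edgeWeight τ := by
  induction τ using Tree.induction with
  | hX k => rw [edgeWeight_X]
  | hXi l t ih => rw [edgeWeight_mul, edgeWeight_Xi]; positivity
  | hI m s t ih ih' => rw [edgeWeight_mul, edgeWeight_I]; positivity

/-- The finite set of multi-indices `k` with `|k|_𝔰 < c`. -/
def below (c : ℝ) : Finset (MIdx d) :=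
  (Fintype.piFinset fun _ => Finset.range ⌈c⌉₊).filter fun k => S.midx k < c

theorem mem_below {c : ℝ} {k : MIdx d} : k ∈ S.below c ↔ S.midx k < c := by
  simp only [below, Finset.mem_filter, Fintype.mem_piFinset, Finset.mem_range,
    and_iff_right_iff_imp]
  intro h i
  rw [Nat.lt_ceil]
  refine lt_of_le_of_lt ?_ h
  have h1 : ∀ j ∈ Finset.univ, 0 ≤ (k j : ℝ) * S.s j := fun j _ =>
    mul_nonneg (Nat.cast_nonneg _) (zero_le_one.trans (S.one_le j))
  refine le_trans ?_ (Finset.single_le_sum h1 (Finset.mem_univ i))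
  exact le_mul_of_one_le_right (Nat.cast_nonneg _) (S.one_le i)

end Scaling

namespace Tree

variable {d : ℕ}

/-- The multiset `𝓝(τ)` of the types of the edges leaving the root. -/
def rootEdges (τ : Tree d) : Multiset (EdgeType d) :=
  Multiplicative.toAdd (fold (A := Multiplicative (Multiset (EdgeType d)))
    (fun _ => 1)
    (fun l => Multiplicative.ofAdd {(EType.Xi, l)})
    (fun m _ _ => Multiplicative.ofAdd {(EType.I, m)}) τ)

/-- The multiset of the `𝓝(x)`, where `x` runs over the nodes of `τ` other than the root. -/
def upperNodes (τ : Tree d) : Multiset (Multiset (EdgeType d)) :=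
  Multiplicative.toAdd (fold (A := Multiplicative (Multiset (Multiset (EdgeType d))))
    (fun _ => 1)
    (fun _ => Multiplicative.ofAdd {0})
    (fun _ σ v => Multiplicative.ofAdd {rootEdges σ} * v) τ)

/-- The polynomial decoration `𝔫(ρ_τ)` of the root. -/
def rootPoly (τ : Tree d) : MIdx d :=
  Multiplicative.toAdd (fold (A := Multiplicative (MIdx d))
    (fun i => Multiplicative.ofAdd (Pi.single i 1)) (fun _ => 1) (fun _ _ _ => 1) τ)

/-- `τ` is planted if `τ = Ξ_l` or `τ = 𝓘_m[σ]`. -/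
def IsPlanted (τ : Tree d) : Prop := (∃ l, τ = Xi l) ∨ ∃ m σ, τ = I m σ

end Tree

/-- A rule is a set of multisets of edge types. -/
abbrev Rule (d : ℕ) := Set (Multiset (EdgeType d))

namespace Rule

variable {d : ℕ} (R : Rule d) (S : Scaling d)

/-- `R` is normal. -/
def IsNormal : Prop := ∀ A B : Multiset (EdgeType d), A ≤ B → B ∈ R → A ∈ R

/-- `R` is subcritical: there is `reg : {Ξ,𝓘} → ℝ` with `reg Ξ < |Ξ|_𝔰` and
`reg 𝓘 < |𝓘|_𝔰 + inf_{N ∈ R} reg N`, where `reg N = ∑_{(𝔱,k) ∈ N} (reg 𝔱 - |k|_𝔰)`; the number `c`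
is a lower bound of the `reg N`. -/
def IsSubcritical : Prop :=
  ∃ (reg : EType → ℝ) (c : ℝ), reg EType.Xi < S.degXi ∧ reg EType.I < S.degI + c ∧
    ∀ N ∈ R, c ≤ (N.map fun o => reg o.1 - S.midx o.2).sum

/-- `τ` strongly conforms to `R`, i.e. `τ ∈ 𝔗_∘`: `𝓝(x) ∈ R` for all nodes `x` of `τ`. -/
def Conforms (τ : Tree d) : Prop := τ.rootEdges ∈ R ∧ ∀ N ∈ τ.upperNodes, N ∈ R

/-- The set `𝔗_-` of negative trees. -/
def negTrees : Set (Tree d) :=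
  {τ | R.Conforms τ ∧ S.deg τ < 0 ∧ τ.rootPoly = 0 ∧ ¬ τ.IsPlanted}

end Rule

/-! ### Linear spaces of trees -/

/-- `𝓥`, the span of `𝔗`, with the tree product. -/
def TreeAlg (d : ℕ) : Type := MonoidAlgebra ℝ (Tree d)

instance (d : ℕ) : CommRing (TreeAlg d) := inferInstanceAs (CommRing (MonoidAlgebra ℝ (Tree d)))

instance (d : ℕ) : Algebra ℝ (TreeAlg d) :=
  inferInstanceAs (Algebra ℝ (MonoidAlgebra ℝ (Tree d)))

namespace TreeAlg

variable {d : ℕ}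

/-- A tree as a basis vector of `𝓥`. -/
def ofHom : Tree d →* TreeAlg d := MonoidAlgebra.of ℝ (Tree d)

/-- A tree as a basis vector of `𝓥`. -/
def of (τ : Tree d) : TreeAlg d := ofHom τ

/-- The coefficients of an element of `𝓥`. -/
def coeff : TreeAlg d ≃ₗ[ℝ] (Tree d →₀ ℝ) :=
  (MonoidAlgebra.coeffLinearEquiv ℝ : MonoidAlgebra ℝ (Tree d) ≃ₗ[ℝ] (Tree d →₀ ℝ))

theorem coeff_of (τ : Tree d) : coeff (of τ) = Finsupp.single τ 1 := rfl

/-- The linear map on `𝓥` with given values on trees. -/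
def linExt {M : Type*} [AddCommGroup M] [Module ℝ M] (f : Tree d → M) : TreeAlg d →ₗ[ℝ] M :=
  (Finsupp.linearCombination ℝ f).comp coeff.toLinearMap

theorem linExt_of {M : Type*} [AddCommGroup M] [Module ℝ M] (f : Tree d → M) (τ : Tree d) :
    linExt f (of τ) = f τ := by
  simp [linExt, coeff_of]

theorem lin_ext {M : Type*} [AddCommGroup M] [Module ℝ M] {f g : TreeAlg d →ₗ[ℝ] M}
    (h : ∀ τ, f (of τ) = g (of τ)) : f = g := by
  have h' : f ∘ₗ coeff.symm.toLinearMap = g ∘ₗ coeff.symm.toLinearMap := by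
    refine Finsupp.lhom_ext' fun τ => LinearMap.ext_ring ?_
    simpa [← coeff_of] using h τ
  apply LinearMap.ext
  intro v
  simpa using LinearMap.congr_fun h' (coeff v)

theorem of_mul (τ σ : Tree d) : of (τ * σ) = of τ * of σ := map_mul ofHom _ _

theorem of_one : of (1 : Tree d) = 1 := map_one ofHom

/-- The algebra morphism on `𝓥` with given values on trees. -/
def algExt {A : Type*} [CommRing A] [Algebra ℝ A] (f : Tree d →* A) : TreeAlg d →ₐ[ℝ] A :=
  (MonoidAlgebra.lift ℝ A (Tree d) f : MonoidAlgebra ℝ (Tree d) →ₐ[ℝ] A)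

theorem algExt_of {A : Type*} [CommRing A] [Algebra ℝ A] (f : Tree d →* A) (τ : Tree d) :
    algExt f (of τ) = f τ :=
  MonoidAlgebra.lift_of f τ

/-- The linear operator `𝓘_m : 𝓥 → 𝓥`. -/
def I (m : MIdx d) : TreeAlg d →ₗ[ℝ] TreeAlg d := linExt fun τ => of (Tree.I m τ)

/-- The monomial `X^k/k!`. -/
def Xdiv (k : MIdx d) : TreeAlg d := (∏ i, ((k i).factorial : ℝ))⁻¹ • of (Tree.X k)

/-- The `ℓ¹`-norm, with respect to the basis of trees, of the degree-`γ` part of `v`. -/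
def normDeg (S : Scaling d) (γ : ℝ) (v : TreeAlg d) : ℝ :=
  ∑ σ ∈ (coeff v).support, open Classical in if S.deg σ = γ then |coeff v σ| else 0

end TreeAlg

/-- The model space `𝓣`, the span of `𝔗_∘`. -/
def modelSpace {d : ℕ} (R : Rule d) : Submodule ℝ (TreeAlg d) :=
  Submodule.span ℝ (TreeAlg.of '' {τ | R.Conforms τ})

/-! ### Negative renormalisation -/

section Negative

variable {d : ℕ} (S : Scaling d) (R : Rule d)

/-- `𝓕_-`, the span of the forests of trees in `𝔗_-`, i.e. the free commutative algebra generated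
by `𝔗_-`. -/
def NegForests : Type := MvPolynomial (R.negTrees S) ℝ

instance : CommRing (NegForests S R) := inferInstanceAs (CommRing (MvPolynomial (R.negTrees S) ℝ))

instance : Algebra ℝ (NegForests S R) :=
  inferInstanceAs (Algebra ℝ (MvPolynomial (R.negTrees S) ℝ))

/-- A tree in `𝔗_-` as an element of `𝓕_-`. -/
def NegForests.gen (τ : R.negTrees S) : NegForests S R := MvPolynomial.X τ

/-- `G_-`, the set of characters of `𝓕_-`. -/
abbrev NegChar := NegForests S R →ₐ[ℝ] ℝ

/-- `π_-` on a single tree: trees outside `𝔗_-` are sent to `0`. -/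
def piNeg : TreeAlg d →ₗ[ℝ] NegForests S R :=
  TreeAlg.linExt fun τ => open Classical in
    if h : τ ∈ R.negTrees S then NegForests.gen S R ⟨τ, h⟩ else 0

/-- `id ⊗ 𝓘_m` on `𝓕_- ⊗ 𝓥`. -/
def graftRight (m : MIdx d) :
    (NegForests S R ⊗[ℝ] TreeAlg d) →ₗ[ℝ] (NegForests S R ⊗[ℝ] TreeAlg d) :=
  TensorProduct.map LinearMap.id (TreeAlg.I m)

/-- `c ⊗ (f ⊗ v) ↦ (π_-(c) · f) ⊗ v`. -/
def closeRoot : (TreeAlg d ⊗[ℝ] (NegForests S R ⊗[ℝ] TreeAlg d)) →ₗ[ℝ]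
    (NegForests S R ⊗[ℝ] TreeAlg d) :=
  TensorProduct.lift ((LinearMap.mul ℝ (NegForests S R ⊗[ℝ] TreeAlg d)).comp
    ((TensorProduct.mk ℝ (NegForests S R) (TreeAlg d)).flip 1 ∘ₗ piNeg S R))

/-- The sum over `A ⊂ T`, `𝔫_A ≤ 𝔫` and `𝔢_A : ∂(A,T) → ℕ^d` with weight `(1/𝔢_A!) (𝔫 choose 𝔫_A)`,
organised along the construction of the tree `T` (with `|𝔢_A(e)|_𝔰 < M` for every
boundary edge `e`). The first component is the sum over the `A` that do not contain the root, of
`π_-(A, 𝔫_A + π𝔢_A, 𝔢) ⊗ (T/A, [𝔫 - 𝔫_A]_A, 𝔢 + 𝔢_A)`.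
The second component is the sum over the `A` that do contain the root, of `c ⊗ f ⊗ v`, where `c` is
the component of `A` that contains the root, `f` is `π_-` of the forest of the other components,
and `v` is `T/A` (all with the decorations above). Both are multiplicative under
the tree product of `T`, and

* at the root `X_i`: one unit of polynomial decoration belongs to `𝔫_A` or to `𝔫 - 𝔫_A`
  (the powers of this binomial produce the binomial coefficients);
* an edge at the root is outside of `A`, and not in the boundary, if the root is not in `A`;
  otherwise it is either in `A`, or in the boundary `∂(A,T)` and then carries some `e = 𝔢_A`, which
  produces `1/e!`, is added to its decoration, and gives a factor `X^e` at the root of `c`;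
* the sum over all `A` is the sum of the first component and of `closeRoot` of the second one.
  A noise node on its own is never a component of `A`, as `π_-` kills one-node trees. -/
def extract (M : ℝ) : Tree d →* (NegForests S R ⊗[ℝ] TreeAlg d) ×
    (TreeAlg d ⊗[ℝ] (NegForests S R ⊗[ℝ] TreeAlg d)) :=
  Tree.fold
    (fun i =>
      (1 ⊗ₜ TreeAlg.of (Tree.X (Pi.single i 1)),
        TreeAlg.of (Tree.X (Pi.single i 1)) ⊗ₜ 1 +
          1 ⊗ₜ (1 ⊗ₜ TreeAlg.of (Tree.X (Pi.single i 1)))))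
    (fun l =>
      (1 ⊗ₜ TreeAlg.of (Tree.Xi l),
        TreeAlg.of (Tree.Xi l) ⊗ₜ 1 +
          ∑ e ∈ S.below M, TreeAlg.Xdiv e ⊗ₜ (1 ⊗ₜ TreeAlg.of (Tree.Xi (l + e)))))
    (fun m _ p =>
      (graftRight S R m (p.1 + closeRoot S R p.2),
        TensorProduct.map (TreeAlg.I m) LinearMap.id p.2 +
          ∑ e ∈ S.below M,
            TreeAlg.Xdiv e ⊗ₜ graftRight S R (m + e) (p.1 + closeRoot S R p.2)))

/-- `Δ⁻ : 𝓥 → 𝓕_- ⊗ 𝓥`. The component of `A` containing a boundary edge `e` at one of its nodes has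
degree at least `|𝔢_A(e)|_𝔰 - edgeWeight T`, hence is killed by `π_-` unless
`|𝔢_A(e)|_𝔰 < edgeWeight T`; so the bound on `𝔢_A` in `extract` omits only vanishing terms. -/
def deltaNeg : TreeAlg d →ₗ[ℝ] (NegForests S R ⊗[ℝ] TreeAlg d) :=
  TreeAlg.linExt fun τ =>
    (extract S R (S.edgeWeight τ) τ).1 + closeRoot S R (extract S R (S.edgeWeight τ) τ).2

/-- Auxiliary to `deltaNeg_of`: span of the `σ ⊗ w` with `|σ|_𝔰 ≥ c`. -/
def degFilt (c : ℝ) : Submodule ℝ (TreeAlg d ⊗[ℝ] (NegForests S R ⊗[ℝ] TreeAlg d)) :=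
  Submodule.span ℝ {u | ∃ σ w, c ≤ S.deg σ ∧ u = TreeAlg.of σ ⊗ₜ w}

section Cutoff

variable {S R}

theorem tmul_mem_degFilt {c : ℝ} {σ : Tree d} (h : c ≤ S.deg σ)
    (w : NegForests S R ⊗[ℝ] TreeAlg d) : TreeAlg.of σ ⊗ₜ w ∈ degFilt S R c :=
  Submodule.subset_span ⟨σ, w, h, rfl⟩

theorem Xdiv_mem_degFilt {c : ℝ} {e : MIdx d} (h : c ≤ S.midx e)
    (w : NegForests S R ⊗[ℝ] TreeAlg d) : TreeAlg.Xdiv e ⊗ₜ w ∈ degFilt S R c := by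
  rw [TreeAlg.Xdiv, ← TensorProduct.smul_tmul']
  exact Submodule.smul_mem _ _ (tmul_mem_degFilt (by rwa [S.deg_X]) w)

theorem degFilt_anti {c c' : ℝ} (h : c ≤ c') : degFilt S R c' ≤ degFilt S R c := by
  refine Submodule.span_le.2 ?_
  rintro _ ⟨σ, w, hσ, rfl⟩
  exact tmul_mem_degFilt (h.trans hσ) w

theorem mul_mem_degFilt {c c' : ℝ} {u v : TreeAlg d ⊗[ℝ] (NegForests S R ⊗[ℝ] TreeAlg d)}
    (hu : u ∈ degFilt S R c) (hv : v ∈ degFilt S R c') : u * v ∈ degFilt S R (c + c') := by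
  induction hu using Submodule.span_induction with
  | mem u hu =>
    obtain ⟨σ, w, hσ, rfl⟩ := hu
    induction hv using Submodule.span_induction with
    | mem v hv =>
      obtain ⟨σ', w', hσ', rfl⟩ := hv
      rw [Algebra.TensorProduct.tmul_mul_tmul, ← TreeAlg.of_mul]
      exact tmul_mem_degFilt (by rw [S.deg_mul]; exact add_le_add hσ hσ') _
    | zero => rw [mul_zero]; exact Submodule.zero_mem _
    | add x y _ _ hx hy => rw [mul_add]; exact Submodule.add_mem _ hx hy
    | smul r x _ hx => rw [mul_smul_comm]; exact Submodule.smul_mem _ _ hx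
  | zero => rw [zero_mul]; exact Submodule.zero_mem _
  | add x y _ _ hx hy => rw [add_mul]; exact Submodule.add_mem _ hx hy
  | smul r x _ hx => rw [smul_mul_assoc]; exact Submodule.smul_mem _ _ hx

theorem closeRoot_degFilt {u : TreeAlg d ⊗[ℝ] (NegForests S R ⊗[ℝ] TreeAlg d)}
    (hu : u ∈ degFilt S R 0) : closeRoot S R u = 0 := by
  have h : degFilt S R 0 ≤ LinearMap.ker (closeRoot S R) := by
    refine Submodule.span_le.2 ?_
    rintro _ ⟨σ, w, hσ, rfl⟩
    have hn : σ ∉ R.negTrees S := fun h => absurd h.2.1 (not_lt.2 hσ)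
    simp [closeRoot, piNeg, TreeAlg.linExt_of, hn]
  exact h hu

theorem map_I_degFilt {c : ℝ} (m : MIdx d)
    {u : TreeAlg d ⊗[ℝ] (NegForests S R ⊗[ℝ] TreeAlg d)} (hu : u ∈ degFilt S R c) :
    TensorProduct.map (TreeAlg.I m) LinearMap.id u ∈ degFilt S R (S.degI - S.midx m + c) := by
  have h : degFilt S R c ≤ (degFilt S R (S.degI - S.midx m + c)).comap
      (TensorProduct.map (TreeAlg.I m) LinearMap.id) := by
    refine Submodule.span_le.2 ?_
    rintro _ ⟨σ, w, hσ, rfl⟩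
    change TensorProduct.map (TreeAlg.I m) LinearMap.id (TreeAlg.of σ ⊗ₜ w) ∈
      degFilt S R (S.degI - S.midx m + c)
    rw [TensorProduct.map_tmul, TreeAlg.I, TreeAlg.linExt_of]
    exact tmul_mem_degFilt (by rw [S.deg_I]; linarith) _
  exact h hu

theorem sum_below_mem (M : ℝ) (f : MIdx d → NegForests S R ⊗[ℝ] TreeAlg d) :
    ∑ e ∈ S.below M, TreeAlg.Xdiv e ⊗ₜ[ℝ] f e ∈ degFilt S R 0 :=
  Submodule.sum_mem _ fun e _ => Xdiv_mem_degFilt (S.midx_nonneg e) _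

theorem sum_below_sub_mem {M M' : ℝ} (h : M ≤ M') (f : MIdx d → NegForests S R ⊗[ℝ] TreeAlg d) :
    ∑ e ∈ S.below M', TreeAlg.Xdiv e ⊗ₜ[ℝ] f e - ∑ e ∈ S.below M, TreeAlg.Xdiv e ⊗ₜ[ℝ] f e ∈
      degFilt S R M := by
  classical
  have hs : S.below M ⊆ S.below M' := fun e he =>
    S.mem_below.2 ((S.mem_below.1 he).trans_le h)
  rw [← Finset.sum_sdiff hs, add_sub_cancel_right]
  refine Submodule.sum_mem _ fun e he => Xdiv_mem_degFilt ?_ _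
  rw [Finset.mem_sdiff, S.mem_below, S.mem_below] at he
  exact not_lt.1 he.2

theorem extract_Xi (M : ℝ) (l : MIdx d) : extract S R M (Tree.Xi l) =
    (1 ⊗ₜ TreeAlg.of (Tree.Xi l),
        TreeAlg.of (Tree.Xi l) ⊗ₜ 1 +
          ∑ e ∈ S.below M, TreeAlg.Xdiv e ⊗ₜ (1 ⊗ₜ TreeAlg.of (Tree.Xi (l + e)))) := by
  rw [extract, Tree.fold_Xi]

theorem extract_I (M : ℝ) (m : MIdx d) (τ : Tree d) : extract S R M (Tree.I m τ) =
    (graftRight S R m ((extract S R M τ).1 + closeRoot S R (extract S R M τ).2),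
        TensorProduct.map (TreeAlg.I m) LinearMap.id (extract S R M τ).2 +
          ∑ e ∈ S.below M, TreeAlg.Xdiv e ⊗ₜ graftRight S R (m + e)
            ((extract S R M τ).1 + closeRoot S R (extract S R M τ).2)) := by
  rw [extract, Tree.fold_I]

theorem extract_X (M M' : ℝ) (k : MIdx d) :
    extract S R M (Tree.X k) = extract S R M' (Tree.X k) := by
  rw [extract, extract, Tree.fold_X, Tree.fold_X]

theorem extract_X_mem (M : ℝ) (k : MIdx d) :
    (extract S R M (Tree.X k)).2 ∈ degFilt S R 0 := by
  have h1 : (1 : TreeAlg d ⊗[ℝ] (NegForests S R ⊗[ℝ] TreeAlg d)) ∈ degFilt S R 0 :=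
    tmul_mem_degFilt (σ := 1) (by rw [S.deg_one]) 1
  have hm : ∀ u ∈ degFilt S R 0, ∀ v ∈ degFilt S R 0, u * v ∈ degFilt S R 0 :=
    fun u hu v hv => by simpa using mul_mem_degFilt hu hv
  have hp : ∀ u ∈ degFilt S R 0, ∀ n : ℕ, u ^ n ∈ degFilt S R 0 := by
    intro u hu n
    induction n with
    | zero => rw [pow_zero]; exact h1
    | succ n ih => rw [pow_succ]; exact hm _ ih _ hu
  rw [extract, Tree.fold_X, Prod.snd_prod]
  refine Finset.prod_induction _ (· ∈ degFilt S R 0) (fun u v hu hv => hm u hu v hv) h1 ?_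
  intro i _
  rw [Prod.pow_snd]
  refine hp _ ?_ _
  refine Submodule.add_mem _ (tmul_mem_degFilt ?_ _) (tmul_mem_degFilt (σ := 1) ?_ _)
  · rw [S.deg_X]; exact S.midx_nonneg _
  · rw [S.deg_one]

theorem extract_stable {M M' : ℝ} (hM : M ≤ M') (τ : Tree d) (h : S.edgeWeight τ ≤ M) :
    (extract S R M τ).1 = (extract S R M' τ).1 ∧
    (extract S R M τ).2 ∈ degFilt S R (-S.edgeWeight τ) ∧
    (extract S R M' τ).2 ∈ degFilt S R (-S.edgeWeight τ) ∧
    (extract S R M' τ).2 - (extract S R M τ).2 ∈ degFilt S R (M - S.edgeWeight τ) := by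
  have comb : ∀ {a a' b b' : TreeAlg d ⊗[ℝ] (NegForests S R ⊗[ℝ] TreeAlg d)} {p q : ℝ},
      a' ∈ degFilt S R (-p) → a' - a ∈ degFilt S R (M - p) →
      b ∈ degFilt S R (-q) → b' - b ∈ degFilt S R (M - q) →
      a' * b' - a * b ∈ degFilt S R (M - (p + q)) := by
    intro a a' b b' p q ha had hb hbd
    have : a' * b' - a * b = a' * (b' - b) + (a' - a) * b := by ring
    rw [this]
    refine Submodule.add_mem _ ?_ ?_
    · convert mul_mem_degFilt ha hbd using 2; ring
    · convert mul_mem_degFilt had hb using 2; ring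
  have comb' : ∀ {a b : TreeAlg d ⊗[ℝ] (NegForests S R ⊗[ℝ] TreeAlg d)} {p q : ℝ},
      a ∈ degFilt S R (-p) → b ∈ degFilt S R (-q) → a * b ∈ degFilt S R (-(p + q)) := by
    intro a b p q ha hb
    convert mul_mem_degFilt ha hb using 2; ring
  induction τ using Tree.induction with
  | hX k =>
    rw [extract_X M' M k, S.edgeWeight_X, neg_zero, sub_self]
    exact ⟨rfl, extract_X_mem M k, extract_X_mem M k, Submodule.zero_mem _⟩
  | hXi l t ih =>
    rw [S.edgeWeight_mul] at h
    have hw := S.edgeWeight_nonneg (Tree.Xi l)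
    have hw' := S.edgeWeight_nonneg t
    obtain ⟨h1, h2, h3, h4⟩ := ih (by linarith)
    have hwX := S.edgeWeight_Xi l
    have hd : -S.edgeWeight (Tree.Xi l) ≤ S.deg (Tree.Xi l) := by
      rw [S.deg_Xi, hwX]; exact neg_abs_le _
    have hmem : ∀ N : ℝ, (extract S R N (Tree.Xi l)).2 ∈
        degFilt S R (-S.edgeWeight (Tree.Xi l)) := by
      intro N
      rw [extract_Xi]
      exact Submodule.add_mem _ (tmul_mem_degFilt hd _)
        (degFilt_anti (by linarith) (sum_below_mem N _))
    have hdiff : (extract S R M' (Tree.Xi l)).2 - (extract S R M (Tree.Xi l)).2 ∈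
        degFilt S R (M - S.edgeWeight (Tree.Xi l)) := by
      rw [extract_Xi, extract_Xi]
      simp only [add_sub_add_left_eq_sub]
      exact degFilt_anti (by linarith) (sum_below_sub_mem hM _)
    rw [map_mul, map_mul, S.edgeWeight_mul]
    simp only [Prod.fst_mul, Prod.snd_mul]
    refine ⟨?_, comb' (hmem _) h2, comb' (hmem _) h3, comb (hmem _) hdiff h2 h4⟩
    rw [h1, extract_Xi, extract_Xi]
  | hI m s t ihs ih =>
    rw [S.edgeWeight_mul] at h
    have hw := S.edgeWeight_nonneg (Tree.I m s)
    have hw' := S.edgeWeight_nonneg t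
    have hws := S.edgeWeight_nonneg s
    have hwI := S.edgeWeight_I m s
    have habs := neg_abs_le (S.degI - S.midx m)
    have habs' := abs_nonneg (S.degI - S.midx m)
    obtain ⟨h1, h2, h3, h4⟩ := ih (by linarith)
    obtain ⟨k1, k2, k3, k4⟩ := ihs (by linarith)
    have hD : (extract S R M s).1 + closeRoot S R (extract S R M s).2 =
        (extract S R M' s).1 + closeRoot S R (extract S R M' s).2 := by
      have := closeRoot_degFilt (degFilt_anti (by linarith) k4)
      rw [map_sub, sub_eq_zero] at this
      rw [k1, this]
    have hmem : ∀ N : ℝ, (extract S R N s).2 ∈ degFilt S R (-S.edgeWeight s) →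
        (extract S R N (Tree.I m s)).2 ∈ degFilt S R (-S.edgeWeight (Tree.I m s)) := by
      intro N hN
      rw [extract_I]
      exact Submodule.add_mem _ (degFilt_anti (by linarith) (map_I_degFilt m hN))
        (degFilt_anti (by linarith) (sum_below_mem N _))
    have hdiff : (extract S R M' (Tree.I m s)).2 - (extract S R M (Tree.I m s)).2 ∈
        degFilt S R (M - S.edgeWeight (Tree.I m s)) := by
      rw [extract_I, extract_I, hD]
      simp only [add_sub_add_comm, ← map_sub]
      exact Submodule.add_mem _ (degFilt_anti (by linarith) (map_I_degFilt m k4))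
        (degFilt_anti (by linarith) (sum_below_sub_mem hM _))
    rw [map_mul, map_mul, S.edgeWeight_mul]
    simp only [Prod.fst_mul, Prod.snd_mul]
    refine ⟨?_, comb' (hmem _ k2) h2, comb' (hmem _ k3) h3, comb (hmem _ k3) hdiff h2 h4⟩
    rw [h1, extract_I, extract_I, hD]

/-- Any sufficiently large bound on `𝔢_A` gives the same `Δ⁻`: the sum over all `𝔢_A` has only
finitely many non-zero terms, and all of them are taken into account. -/
theorem deltaNeg_of {M : ℝ} (τ : Tree d) (h : S.edgeWeight τ ≤ M) :
    deltaNeg S R (TreeAlg.of τ) =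
      (extract S R M τ).1 + closeRoot S R (extract S R M τ).2 := by
  obtain ⟨h1, -, -, h4⟩ := extract_stable (R := R) h τ le_rfl
  rw [sub_self] at h4
  have := closeRoot_degFilt h4
  rw [map_sub, sub_eq_zero] at this
  rw [deltaNeg, TreeAlg.linExt_of, h1, this]

end Cutoff

/-- `R` is complete: `Δ⁻` maps `𝓣` to `𝓕_- ⊗ 𝓣`. -/
def Rule.IsComplete : Prop :=
  ∀ v ∈ modelSpace R,
    deltaNeg S R v ∈ LinearMap.range (LinearMap.lTensor (NegForests S R) (modelSpace R).subtype)

end Negative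

/-! ### Smooth functions and the kernel -/

/-- Space-time `ℝ^d`. -/
abbrev Space (d : ℕ) := EuclideanSpace ℝ (Fin d)

/-- `C^∞(ℝ^d, ℝ)`. -/
def SmoothFun (d : ℕ) : Submodule ℝ (Space d → ℝ) where
  carrier := {f | ContDiff ℝ ∞ f}
  add_mem' {f g} (hf : ContDiff ℝ ∞ f) (hg : ContDiff ℝ ∞ g) := hf.add hg
  zero_mem' := (contDiff_const : ContDiff ℝ ∞ fun _ : Space d => (0 : ℝ))
  smul_mem' c f (hf : ContDiff ℝ ∞ f) := (contDiff_const (c := c)).smul hf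

namespace SmoothFun

variable {d : ℕ}

theorem contDiff (F : SmoothFun d) : ContDiff ℝ ∞ F.1 := F.2

theorem differentiableAt (F : SmoothFun d) (x : Space d) : DifferentiableAt ℝ F.1 x :=
  ((SmoothFun.contDiff F).differentiable (by simp)).differentiableAt

/-- The partial derivative `∂_i` on smooth functions. -/
def pderiv (i : Fin d) : SmoothFun d →ₗ[ℝ] SmoothFun d where
  toFun F := ⟨fun x => fderiv ℝ F.1 x (EuclideanSpace.single i 1),
    ((SmoothFun.contDiff F).fderiv_right (m := ∞) le_rfl).clm_apply contDiff_const⟩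
  map_add' F G := by
    apply Subtype.ext
    funext x
    change fderiv ℝ (F.1 + G.1) x _ = fderiv ℝ F.1 x _ + fderiv ℝ G.1 x _
    rw [fderiv_add (SmoothFun.differentiableAt F x) (SmoothFun.differentiableAt G x)]
    rfl
  map_smul' c F := by
    apply Subtype.ext
    funext x
    change fderiv ℝ (c • F.1) x _ = c • fderiv ℝ F.1 x _
    rw [fderiv_const_smul (SmoothFun.differentiableAt F x) c]
    rfl

/-- The iterated partial derivative `D^k = ∂_1^{k_1} ⋯ ∂_d^{k_d}`. -/
def D (k : MIdx d) : Module.End ℝ (SmoothFun d) :=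
  (List.ofFn fun i => (pderiv i : Module.End ℝ (SmoothFun d)) ^ k i).prod

end SmoothFun

/-- A kernel `K`: smooth outside of the origin, vanishing for `|z| ≥ 1`, and integrable (so that
convolution with `K` is defined). -/
structure Kernel (d : ℕ) where
  toFun : Space d → ℝ
  smooth : ContDiffOn ℝ ∞ toFun {0}ᶜ
  support : ∀ z, 1 ≤ ‖z‖ → toFun z = 0
  integrable : MeasureTheory.Integrable toFun

/-- `(D^m K * F)(x)`, the convolution of `F` with the distribution `D^m K`. -/
def Kernel.conv {d : ℕ} (K : Kernel d) (m : MIdx d) (F : SmoothFun d) (x : Space d) : ℝ :=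
  ∫ y, K.toFun y * (SmoothFun.D m F).1 (x - y)

/-! ### Positive renormalisation -/

section Positive

variable {d : ℕ} (S : Scaling d)

/-- `Δ⁺`, defined by `Δ⁺ X_i = X_i ⊗ 1 + 1 ⊗ X_i`, `Δ⁺ Ξ_l = Ξ_l ⊗ 1`, multiplicativity, and
`Δ⁺ 𝓘_m τ = (𝓘_m ⊗ id) Δ⁺ τ + ∑_{|k|_𝔰 < |𝓘_m τ|_𝔰} X^k/k! ⊗ 𝓘_{m+k} τ`. The right factors are in the
span `𝓣_+` of the products of `X^k` and trees `𝓘_m τ` of positive degree. -/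
def deltaPos : TreeAlg d →ₐ[ℝ] (TreeAlg d ⊗[ℝ] TreeAlg d) :=
  TreeAlg.algExt (Tree.fold
    (fun i => TreeAlg.of (Tree.X (Pi.single i 1)) ⊗ₜ 1 + 1 ⊗ₜ TreeAlg.of (Tree.X (Pi.single i 1)))
    (fun l => TreeAlg.of (Tree.Xi l) ⊗ₜ 1)
    (fun m τ v => TensorProduct.map (TreeAlg.I m) LinearMap.id v +
      ∑ k ∈ S.below (S.deg (Tree.I m τ)), TreeAlg.Xdiv k ⊗ₜ TreeAlg.of (Tree.I (m + k) τ)))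

/-- `Γ_f = (id ⊗ f) Δ⁺` for a character `f`. -/
def Gam (f : TreeAlg d →ₐ[ℝ] ℝ) : TreeAlg d →ₐ[ℝ] TreeAlg d :=
  ((Algebra.TensorProduct.rid ℝ ℝ (TreeAlg d)).toAlgHom.comp
    (Algebra.TensorProduct.map (AlgHom.id ℝ (TreeAlg d)) f)).comp (deltaPos S)

variable {S}
variable {R : Rule d} (K : Kernel d) (P : modelSpace R →ₗ[ℝ] SmoothFun d)

theorem of_mem_modelSpace {τ : Tree d} (h : R.Conforms τ) : TreeAlg.of τ ∈ modelSpace R :=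
  Submodule.subset_span ⟨τ, h, rfl⟩

/-- A linear map on `𝓣` as a linear map on `𝓥 ⊇ 𝓣`, extended by `0` on the trees
outside of `𝔗_∘`. -/
def extendZero : TreeAlg d →ₗ[ℝ] SmoothFun d :=
  TreeAlg.linExt fun τ => open Classical in
    if h : R.Conforms τ then P ⟨TreeAlg.of τ, of_mem_modelSpace h⟩ else 0

theorem extendZero_apply (v : modelSpace R) : extendZero P v = P v := by
  obtain ⟨v, hv⟩ := v
  induction hv using Submodule.span_induction with
  | mem x h =>
    obtain ⟨τ, hτ, rfl⟩ := h
    have hτ' : R.Conforms τ := hτ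
    simp [extendZero, TreeAlg.linExt_of, hτ']
  | zero => exact (map_zero _).trans (map_zero P).symm
  | add x y hx hy ihx ihy =>
    have h := map_add P ⟨x, hx⟩ ⟨y, hy⟩
    have h' := map_add (extendZero P) x y
    exact h'.trans ((congrArg₂ (· + ·) ihx ihy).trans h.symm)
  | smul a x hx ih =>
    have h := map_smul P a ⟨x, hx⟩
    have h' := map_smul (extendZero P) a x
    exact h'.trans ((congrArg (a • ·) ih).trans h.symm)

variable (S)

/-- `-∑_{|ℓ|_𝔰 < |𝓘_n τ|_𝔰} ((-x)^ℓ/ℓ!) (D^{n+ℓ} K * 𝚷 v)(x)`. -/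
def posVal (x : Space d) (n : MIdx d) (τ : Tree d) (v : TreeAlg d) : ℝ :=
  -∑ l ∈ S.below (S.deg (Tree.I n τ)),
    (∏ i, (-x i) ^ l i / ((l i).factorial : ℝ)) * K.conv (n + l) (extendZero P v) x

/-- The recursion that determines `F_x τ` and `f_x`; see `recentre_of` and `posChar_I`. -/
def recentreAux (x : Space d) : Tree d →* TreeAlg d :=
  Tree.fold
    (fun i => TreeAlg.of (Tree.X (Pi.single i 1)) - algebraMap ℝ (TreeAlg d) (x i))
    (fun l => TreeAlg.of (Tree.Xi l))
    (fun m τ v => TreeAlg.I m v +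
      ∑ k ∈ S.below (S.deg (Tree.I m τ)), posVal S K P x (m + k) τ v • TreeAlg.Xdiv k)

/-- The positive character `f_x` associated with `𝚷` (extended from `𝓣_+` to all of `𝓥`
by `f_x(Ξ_l) = 0`): it is multiplicative, `f_x(X_i) = -x_i`, and
`f_x(𝓘_n τ) = -∑_{|ℓ|_𝔰 < |𝓘_n τ|_𝔰} ((-x)^ℓ/ℓ!) (D^{n+ℓ} K * Π_x τ)(x)`, `Π_x = 𝚷 F_x`. -/
def posChar (x : Space d) : TreeAlg d →ₐ[ℝ] ℝ :=
  TreeAlg.algExt (Tree.fold (fun i => -x i) (fun _ => 0)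
    (fun m τ _ => posVal S K P x m τ (recentreAux S K P x τ)))

/-- `F_x = Γ_{f_x} = (id ⊗ f_x) Δ⁺`. -/
def recentre (x : Space d) : TreeAlg d →ₐ[ℝ] TreeAlg d := Gam S (posChar S K P x)

theorem Gam_of (f : TreeAlg d →ₐ[ℝ] ℝ) (τ : Tree d) :
    Gam S f (TreeAlg.of τ) = Algebra.TensorProduct.rid ℝ ℝ (TreeAlg d)
      (Algebra.TensorProduct.map (AlgHom.id ℝ (TreeAlg d)) f (deltaPos S (TreeAlg.of τ))) := rfl

theorem slice_I (f : TreeAlg d →ₐ[ℝ] ℝ) (m : MIdx d) (w : TreeAlg d ⊗[ℝ] TreeAlg d) :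
    Algebra.TensorProduct.rid ℝ ℝ (TreeAlg d) (Algebra.TensorProduct.map (AlgHom.id ℝ (TreeAlg d)) f
      (TensorProduct.map (TreeAlg.I m) LinearMap.id w)) =
    TreeAlg.I m (Algebra.TensorProduct.rid ℝ ℝ (TreeAlg d)
      (Algebra.TensorProduct.map (AlgHom.id ℝ (TreeAlg d)) f w)) := by
  induction w with
  | zero => simp
  | tmul u v => simp
  | add u v hu hv => simp only [map_add, hu, hv]

/-- `F_x = Γ_{f_x}` satisfies the recursion by which `f_x` was constructed. -/
theorem recentre_of (x : Space d) (τ : Tree d) :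
    recentre S K P x (TreeAlg.of τ) = recentreAux S K P x τ := by
  have key := Tree.hom_congr
    (φ := ((recentre S K P x : TreeAlg d →* TreeAlg d).comp (TreeAlg.ofHom)))
    (ψ := recentreAux S K P x) ?_ ?_ ?_ τ
  · exact key
  · intro i
    change recentre S K P x (TreeAlg.of _) = _
    rw [recentre, Gam_of, deltaPos, TreeAlg.algExt_of, Tree.fold_X_single, recentreAux,
      Tree.fold_X_single]
    simp [posChar, TreeAlg.algExt_of, Tree.fold_X_single, sub_eq_add_neg,
      Algebra.algebraMap_eq_smul_one]
  · intro l
    change recentre S K P x (TreeAlg.of _) = _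
    rw [recentre, Gam_of, deltaPos, TreeAlg.algExt_of, Tree.fold_Xi, recentreAux, Tree.fold_Xi]
    simp
  · intro m t ih
    change recentre S K P x (TreeAlg.of _) = _
    change recentre S K P x (TreeAlg.of _) = _ at ih
    rw [recentre, Gam_of, deltaPos, TreeAlg.algExt_of] at ih
    rw [recentre, Gam_of, deltaPos, TreeAlg.algExt_of, Tree.fold_I, map_add, map_add, slice_I, ih,
      recentreAux, Tree.fold_I]
    congr 1
    rw [map_sum, map_sum]
    refine Finset.sum_congr rfl fun k _ => ?_
    simp only [Algebra.TensorProduct.map_tmul, AlgHom.coe_id, id_eq,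
      Algebra.TensorProduct.rid_tmul]
    rw [posChar, TreeAlg.algExt_of, Tree.fold_I]
    rfl

/-- The defining identity of `f_x` on planted trees. -/
theorem posChar_I (x : Space d) (n : MIdx d) (τ : Tree d) :
    posChar S K P x (TreeAlg.of (Tree.I n τ)) =
      -∑ l ∈ S.below (S.deg (Tree.I n τ)), (∏ i, (-x i) ^ l i / ((l i).factorial : ℝ)) *
        K.conv (n + l) (extendZero P (recentre S K P x (TreeAlg.of τ))) x := by
  rw [recentre_of, posChar, TreeAlg.algExt_of, Tree.fold_I]
  rfl

/-- The polynomial part of `F_x 𝓘_m τ`. -/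
def polyPart (x : Space d) (m : MIdx d) (τ : Tree d) : TreeAlg d :=
  ∑ k ∈ S.below (S.deg (Tree.I m τ)),
    posVal S K P x (m + k) τ (recentreAux S K P x τ) • TreeAlg.Xdiv k

theorem recentre_I (x : Space d) (m : MIdx d) (v : TreeAlg d) :
    recentre S K P x (TreeAlg.I m v) = TreeAlg.I m (recentre S K P x v) +
      TreeAlg.linExt (polyPart S K P x m) v := by
  have h : (recentre S K P x).toLinearMap ∘ₗ TreeAlg.I m =
      TreeAlg.I m ∘ₗ (recentre S K P x).toLinearMap + TreeAlg.linExt (polyPart S K P x m) := by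
    apply TreeAlg.lin_ext
    intro τ
    change recentre S K P x (TreeAlg.I m (TreeAlg.of τ)) =
      TreeAlg.I m (recentre S K P x (TreeAlg.of τ)) +
        TreeAlg.linExt (polyPart S K P x m) (TreeAlg.of τ)
    rw [TreeAlg.linExt_of, TreeAlg.I, TreeAlg.linExt_of, recentre_of, recentre_of, recentreAux,
      Tree.fold_I]
    rfl
  exact LinearMap.congr_fun h v

/-- Auxiliary to `recentre_bijective`: the inverse of `F_x` on polynomials. -/
def shiftX (x : Space d) (k : MIdx d) : TreeAlg d :=
  (∏ i, ((k i).factorial : ℝ))⁻¹ • ∏ i,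
    (TreeAlg.of (Tree.X (Pi.single i 1)) + algebraMap ℝ (TreeAlg d) (x i)) ^ k i

/-- Auxiliary to `recentre_bijective`: the inverse of `F_x`. -/
def recentreInv (x : Space d) : TreeAlg d →ₐ[ℝ] TreeAlg d :=
  TreeAlg.algExt (Tree.fold
    (fun i => TreeAlg.of (Tree.X (Pi.single i 1)) + algebraMap ℝ (TreeAlg d) (x i))
    (fun l => TreeAlg.of (Tree.Xi l))
    (fun m _ v => TreeAlg.I m v - TreeAlg.linExt (fun τ =>
      ∑ k ∈ S.below (S.deg (Tree.I m τ)),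
        posVal S K P x (m + k) τ (recentreAux S K P x τ) • shiftX x k) v))

theorem recentre_Xsingle (x : Space d) (i : Fin d) :
    recentre S K P x (TreeAlg.of (Tree.X (Pi.single i 1))) =
      TreeAlg.of (Tree.X (Pi.single i 1)) - algebraMap ℝ (TreeAlg d) (x i) := by
  rw [recentre_of, recentreAux, Tree.fold_X_single]

theorem recentreInv_Xsingle (x : Space d) (i : Fin d) :
    recentreInv S K P x (TreeAlg.of (Tree.X (Pi.single i 1))) =
      TreeAlg.of (Tree.X (Pi.single i 1)) + algebraMap ℝ (TreeAlg d) (x i) := by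
  rw [recentreInv, TreeAlg.algExt_of, Tree.fold_X_single]

theorem of_X (k : MIdx d) :
    TreeAlg.of (Tree.X k) = ∏ i, TreeAlg.of (Tree.X (Pi.single i 1)) ^ k i := by
  rw [Tree.X_eq_prod]
  exact (map_prod TreeAlg.ofHom _ _).trans (by simp only [map_pow]; rfl)

theorem recentre_shiftX (x : Space d) (k : MIdx d) :
    recentre S K P x (shiftX x k) = TreeAlg.Xdiv k := by
  rw [shiftX, map_smul, map_prod, TreeAlg.Xdiv, of_X]
  congr 1
  refine Finset.prod_congr rfl fun i _ => ?_
  rw [map_pow, map_add, recentre_Xsingle, AlgHom.commutes, sub_add_cancel]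

theorem recentreInv_Xdiv (x : Space d) (k : MIdx d) :
    recentreInv S K P x (TreeAlg.Xdiv k) = shiftX x k := by
  rw [TreeAlg.Xdiv, of_X, map_smul, map_prod, shiftX]
  congr 1
  refine Finset.prod_congr rfl fun i _ => ?_
  rw [map_pow, recentreInv_Xsingle]

theorem recentreInv_polyPart (x : Space d) (m : MIdx d) (τ : Tree d) :
    recentreInv S K P x (polyPart S K P x m τ) = ∑ k ∈ S.below (S.deg (Tree.I m τ)),
        posVal S K P x (m + k) τ (recentreAux S K P x τ) • shiftX x k := by
  rw [polyPart, map_sum]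
  exact Finset.sum_congr rfl fun k _ => by rw [map_smul, recentreInv_Xdiv]

theorem recentreInv_I (x : Space d) (m : MIdx d) (v : TreeAlg d) :
    recentreInv S K P x (TreeAlg.I m v) = TreeAlg.I m (recentreInv S K P x v) -
      TreeAlg.linExt (fun τ => recentreInv S K P x (polyPart S K P x m τ))
        (recentreInv S K P x v) := by
  have h : (recentreInv S K P x).toLinearMap ∘ₗ TreeAlg.I m =
      TreeAlg.I m ∘ₗ (recentreInv S K P x).toLinearMap -
        TreeAlg.linExt (fun τ => recentreInv S K P x (polyPart S K P x m τ)) ∘ₗ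
          (recentreInv S K P x).toLinearMap := by
    apply TreeAlg.lin_ext
    intro τ
    change recentreInv S K P x (TreeAlg.I m (TreeAlg.of τ)) =
      TreeAlg.I m (recentreInv S K P x (TreeAlg.of τ)) - TreeAlg.linExt
        (fun τ => recentreInv S K P x (polyPart S K P x m τ))
        (recentreInv S K P x (TreeAlg.of τ))
    simp only [recentreInv_polyPart]
    rw [TreeAlg.I, TreeAlg.linExt_of]
    simp only [recentreInv, TreeAlg.algExt_of]
    rw [Tree.fold_I]
    rfl
  exact LinearMap.congr_fun h v

theorem recentre_recentreInv_polyPart (x : Space d) (m : MIdx d) (v : TreeAlg d) :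
    recentre S K P x
      (TreeAlg.linExt (fun τ => recentreInv S K P x (polyPart S K P x m τ)) v) =
    TreeAlg.linExt (polyPart S K P x m) v := by
  have h : (recentre S K P x).toLinearMap ∘ₗ
      TreeAlg.linExt (fun τ => recentreInv S K P x (polyPart S K P x m τ)) =
      TreeAlg.linExt (polyPart S K P x m) := by
    apply TreeAlg.lin_ext
    intro τ
    rw [LinearMap.comp_apply, TreeAlg.linExt_of, TreeAlg.linExt_of, AlgHom.toLinearMap_apply,
      recentreInv_polyPart, map_sum, polyPart]
    exact Finset.sum_congr rfl fun k _ => by rw [map_smul, recentre_shiftX]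
  exact LinearMap.congr_fun h v

theorem I_of (m : MIdx d) (τ : Tree d) : TreeAlg.of (Tree.I m τ) = TreeAlg.I m (TreeAlg.of τ) := by
  rw [TreeAlg.I, TreeAlg.linExt_of]

theorem algHom_eq_id {φ : TreeAlg d →ₐ[ℝ] TreeAlg d}
    (hX : ∀ i, φ (TreeAlg.of (Tree.X (Pi.single i 1))) = TreeAlg.of (Tree.X (Pi.single i 1)))
    (hXi : ∀ l, φ (TreeAlg.of (Tree.Xi l)) = TreeAlg.of (Tree.Xi l))
    (hI : ∀ m t, φ (TreeAlg.of t) = TreeAlg.of t →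
      φ (TreeAlg.I m (TreeAlg.of t)) = TreeAlg.I m (TreeAlg.of t)) (v : TreeAlg d) : φ v = v := by
  have h : φ.toLinearMap = LinearMap.id := by
    apply TreeAlg.lin_ext
    intro τ
    refine Tree.hom_congr
      (φ := ((φ : TreeAlg d →* TreeAlg d).comp (TreeAlg.ofHom)))
      (ψ := TreeAlg.ofHom) hX hXi (fun m t ht => ?_) τ
    have := hI m t ht
    rw [← I_of] at this
    exact this
  exact LinearMap.congr_fun h v

/-- `F_x` is invertible. -/
theorem recentre_bijective (x : Space d) : Function.Bijective (recentre S K P x).toLinearMap := by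
  have h1 : ∀ v, recentre S K P x (recentreInv S K P x v) = v := by
    intro v
    refine algHom_eq_id (φ := (recentre S K P x).comp (recentreInv S K P x)) ?_ ?_ ?_ v
    · intro i
      rw [AlgHom.comp_apply, recentreInv_Xsingle, map_add, recentre_Xsingle, AlgHom.commutes,
        sub_add_cancel]
    · intro l
      rw [AlgHom.comp_apply, recentreInv, TreeAlg.algExt_of, Tree.fold_Xi, recentre_of,
        recentreAux, Tree.fold_Xi]
    · intro m t ht
      rw [AlgHom.comp_apply] at ht
      rw [AlgHom.comp_apply, recentreInv_I, map_sub, recentre_I, ht,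
        recentre_recentreInv_polyPart, add_sub_cancel_right]
  have h2 : ∀ v, recentreInv S K P x (recentre S K P x v) = v := by
    intro v
    refine algHom_eq_id (φ := (recentreInv S K P x).comp (recentre S K P x)) ?_ ?_ ?_ v
    · intro i
      rw [AlgHom.comp_apply, recentre_Xsingle, map_sub, recentreInv_Xsingle, AlgHom.commutes,
        add_sub_cancel_right]
    · intro l
      rw [AlgHom.comp_apply, recentre_of, recentreAux, Tree.fold_Xi, recentreInv,
        TreeAlg.algExt_of, Tree.fold_Xi]
    · intro m t ht
      rw [AlgHom.comp_apply] at ht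
      rw [AlgHom.comp_apply, recentre_I, map_add, recentreInv_I, ht, TreeAlg.linExt_of,
        TreeAlg.linExt_of, sub_add_cancel]
  exact Function.bijective_iff_has_inverse.2 ⟨recentreInv S K P x, h2, h1⟩

/-- `Γ_{xy} = F_x⁻¹ F_y`. -/
def GamXY (x y : Space d) : TreeAlg d →ₗ[ℝ] TreeAlg d :=
  (LinearEquiv.ofBijective _ (recentre_bijective S K P x)).symm.toLinearMap ∘ₗ
    (recentre S K P y).toLinearMap

/-- The recentred map `Π_x = 𝚷 F_x`. -/
def recentredMap (x : Space d) : TreeAlg d →ₗ[ℝ] SmoothFun d :=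
  extendZero P ∘ₗ (recentre S K P x).toLinearMap

/-! ### Admissible maps and pre-models -/

variable {S}

/-- `𝚷 : 𝓣 → C^∞` is admissible. -/
def IsAdmissible : Prop :=
  ∃ ξ : SmoothFun d,
    (∀ k τ, R.Conforms τ → ∀ z : Space d,
      (extendZero P (TreeAlg.of (Tree.X k * τ))).1 z =
        (∏ i, z i ^ k i) * (extendZero P (TreeAlg.of τ)).1 z) ∧
    (R.Conforms 1 → ∀ z, (extendZero P (TreeAlg.of 1)).1 z = 1) ∧
    (∀ l, R.Conforms (Tree.Xi l) → extendZero P (TreeAlg.of (Tree.Xi l)) = SmoothFun.D l ξ) ∧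
    (∀ m τ, R.Conforms (Tree.I m τ) → ∀ z,
      (extendZero P (TreeAlg.of (Tree.I m τ))).1 z = K.conv m (extendZero P (TreeAlg.of τ)) z)

variable (S)

/-- `|x|_𝔰 = ∑ |x_i|^{1/𝔰_i}`. -/
def Scaling.norm (x : Space d) : ℝ := ∑ i, |x i| ^ (1 / S.s i)

/-- The rescaled test function `φ_x^λ(z) = λ^{-𝔰_1-…-𝔰_d} φ(λ^{-𝔰_1}(z_1-x_1), …)`. -/
def rescale (φ : Space d → ℝ) (lam : ℝ) (x z : Space d) : ℝ :=
  lam ^ (-∑ i, S.s i) * φ (WithLp.toLp 2 fun i => lam ^ (-S.s i) * (z i - x i))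

/-- The test functions `𝓑^r`: smooth, supported in the unit ball, with `C^r`-norm at most `1`. -/
def testFun (d r : ℕ) : Set (SmoothFun d) :=
  {φ | tsupport φ.1 ⊆ Metric.ball 0 1 ∧
    ∀ k : MIdx d, ∑ i, k i ≤ r → ∀ z, |(SmoothFun.D k φ).1 z| ≤ 1}

/-- `𝚷` is a pre-model: it is admissible and `(Π, Γ)` satisfies the bounds of a model. -/
structure IsPreModel (r : ℕ) : Prop where
  admissible : IsAdmissible K P
  bound_Pi : ∀ τ, R.Conforms τ → ∀ C : Set (Space d), IsCompact C → ∃ c : ℝ,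
    ∀ x ∈ C, ∀ lam : ℝ, 0 < lam → lam ≤ 1 → ∀ φ ∈ testFun d r,
      |∫ z, (recentredMap S K P x (TreeAlg.of τ)).1 z * rescale S φ.1 lam x z| ≤
        c * lam ^ S.deg τ
  bound_Gam : ∀ τ, R.Conforms τ → ∀ C : Set (Space d), IsCompact C → ∃ c : ℝ,
    ∀ γ ∈ S.deg '' {σ | R.Conforms σ}, γ ≤ S.deg τ → ∀ x ∈ C, ∀ y ∈ C,
      TreeAlg.normDeg S γ (GamXY S K P x y (TreeAlg.of τ)) ≤
        c * S.norm (x - y) ^ (S.deg τ - γ)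

variable {S}

/-- `𝚷^g = (g ⊗ 𝚷) Δ⁻`. -/
def renormalise (g : NegChar S R) : modelSpace R →ₗ[ℝ] SmoothFun d :=
  (TensorProduct.lid ℝ (SmoothFun d)).toLinearMap ∘ₗ
    TensorProduct.map g.toLinearMap (extendZero P) ∘ₗ deltaNeg S R ∘ₗ (modelSpace R).subtype

end Positive

end RegStruct

end

/-! Write M = (g ⊗ id)Δ⁻, and let F_x and F_x^g be the recentrings attached to 𝚷 and to 𝚷^g = 𝚷M.
The proof compares them through N_x = F_x⁻¹ M F_x^g (`transfer`). Since F_x N_x = M F_x^g, on 𝓣 one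
gets Π_x^g = Π_x N_x and Γ_{xy}^g = N_x⁻¹ Γ_{xy} N_y. Suppose N_x τ is τ plus trees of degree at
least |τ|_𝔰 whose coefficients are continuous in x, and that N_x⁻¹ does not lower degrees either.
Then the bounds for 𝚷 give those for 𝚷^g: higher powers of λ ≤ 1 are smaller, and surplus powers of
|x - y|_𝔰 are bounded on compact sets.

The triangular form of N_x comes from a factorisation M = M°(id + ρ) (`renormMap_eq`). Here ρ
(`rootExtract`) extracts one negative tree containing the root, while M° (`outerMap`) is
multiplicative with M°𝓘_m τ = 𝓘_m Mτ. The map ρ commutes with every recentring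
(`rootExtract_recentre`): a derivative put on a boundary edge shifts the index of the Taylor
coefficients of F_x and nothing else, so cutting at the root turns F_x into id ⊗ F_x. Hence N_x =
N_x°(id + ρ) with N_x° multiplicative (`transfer_eq`).

On planted trees, F_x𝓘_m τ is 𝓘_m F_x τ minus F_x of a Taylor polynomial of D^m K * Π_x τ at x
(`polyPart_eq`). Therefore N_x°𝓘_m τ is 𝓘_m N_x τ plus, for every σ in N_x τ, the Taylor terms of
orders from |𝓘_m τ|_𝔰 up to |𝓘_m σ|_𝔰; these are monomials of degree at least |𝓘_m τ|_𝔰. As ρ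
removes a tree of negative degree, it raises the degree and lowers the number of edges. Induction on
the number of edges then shows that N_x is unipotent (`transfer_sub_mem`) and inverts it
(`transfer_injective`, `exists_transfer_eq`).

Completeness keeps M, and normality keeps F_x and its inverse, inside 𝓣, where the bounds are
available. Admissibility is algebraic: M commutes with multiplication by X^k and with 𝓘_m, and it
fixes 𝟏 and Ξ_l. -/

noncomputable section

namespace RegStruct

section

/-! ### Edge counts and local data of trees under products and planting. -/

namespace Tree

variable {d : ℕ}

/-- The number of edges of a tree. -/
def edges (τ : Tree d) : ℕ :=
  Multiplicative.toAdd (fold (A := Multiplicative ℕ) (fun _ => 1)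
    (fun _ => Multiplicative.ofAdd 1) (fun _ _ v => Multiplicative.ofAdd 1 * v) τ)

theorem edges_mul (τ σ : Tree d) : (τ * σ).edges = τ.edges + σ.edges := by
  simp only [edges, map_mul]; rfl

theorem edges_X (k : MIdx d) : (X k).edges = 0 := by
  rw [edges, fold_X]; simp

theorem edges_Xi (l : MIdx d) : (Xi l).edges = 1 := by
  rw [edges, fold_Xi]; rfl

theorem edges_I (m : MIdx d) (τ : Tree d) : (I m τ).edges = 1 + τ.edges := by
  rw [edges, fold_I]; rfl

/-- Only monomials have no edges. Read contrapositively, a tree of negative degree has an edge, so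
extracting it strictly lowers the number of edges; the later inductions rest on this. -/
theorem deg_nonneg_of_edges_eq_zero (S : Scaling d) {τ : Tree d} (h : τ.edges = 0) :
    0 ≤ S.deg τ := by
  induction τ using Tree.induction with
  | hX k => rw [S.deg_X]; exact S.midx_nonneg k
  | hXi l t _ => rw [edges_mul, edges_Xi] at h; omega
  | hI m s t _ _ => rw [edges_mul, edges_I] at h; omega

theorem rootEdges_mul (τ σ : Tree d) : (τ * σ).rootEdges = τ.rootEdges + σ.rootEdges := by
  simp only [rootEdges, map_mul]; rfl

theorem rootEdges_X (k : MIdx d) : (X k).rootEdges = 0 := by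
  rw [rootEdges, fold_X]; simp

theorem rootEdges_I (m : MIdx d) (τ : Tree d) : (I m τ).rootEdges = {(EType.I, m)} := by
  rw [rootEdges, fold_I]; rfl

theorem upperNodes_mul (τ σ : Tree d) : (τ * σ).upperNodes = τ.upperNodes + σ.upperNodes := by
  simp only [upperNodes, map_mul]; rfl

theorem upperNodes_X (k : MIdx d) : (X k).upperNodes = 0 := by
  rw [upperNodes, fold_X]; simp

theorem upperNodes_I (m : MIdx d) (τ : Tree d) :
    (I m τ).upperNodes = {τ.rootEdges} + τ.upperNodes := by
  rw [upperNodes, fold_I]; rfl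

theorem rootPoly_mul (τ σ : Tree d) : (τ * σ).rootPoly = τ.rootPoly + σ.rootPoly := by
  simp only [rootPoly, map_mul]; rfl

theorem rootPoly_X (k : MIdx d) : (X k).rootPoly = k := by
  rw [rootPoly, fold_X, toAdd_prod]
  simp only [toAdd_pow, toAdd_ofAdd]
  funext j
  simp [Finset.sum_apply, Pi.single_apply]

end Tree

/-! ### Spans of trees and continuous families -/

variable {d : ℕ}

/-- The span of a set of trees. -/
def treeSpan (D : Set (Tree d)) : Submodule ℝ (TreeAlg d) :=
  Submodule.span ℝ (TreeAlg.of '' D)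

theorem of_mem_treeSpan {D : Set (Tree d)} {σ : Tree d} (h : σ ∈ D) :
    TreeAlg.of σ ∈ treeSpan D := Submodule.subset_span ⟨σ, h, rfl⟩

theorem map_mem_of_mem_treeSpan {W : Type*} [AddCommGroup W] [Module ℝ W]
    (L : TreeAlg d →ₗ[ℝ] W) {D : Set (Tree d)} {N : Submodule ℝ W}
    (h : ∀ σ ∈ D, L (TreeAlg.of σ) ∈ N) {v : TreeAlg d} (hv : v ∈ treeSpan D) : L v ∈ N := by
  have : treeSpan D ≤ N.comap L := by
    refine Submodule.span_le.2 ?_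
    rintro _ ⟨σ, hσ, rfl⟩
    exact h σ hσ
  exact this hv

theorem map_eq_of_mem_treeSpan {W : Type*} [AddCommGroup W] [Module ℝ W]
    {L L' : TreeAlg d →ₗ[ℝ] W} {D : Set (Tree d)}
    (h : ∀ σ ∈ D, L (TreeAlg.of σ) = L' (TreeAlg.of σ)) {v : TreeAlg d} (hv : v ∈ treeSpan D) :
    L v = L' v := by
  have := map_mem_of_mem_treeSpan (L - L') (N := ⊥)
    (fun σ hσ => by simp [h σ hσ]) hv
  simpa [sub_eq_zero] using this

theorem treeSpan_mono {D D' : Set (Tree d)} (h : D ⊆ D') : treeSpan D ≤ treeSpan D' :=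
  Submodule.span_mono (Set.image_mono h)

theorem eq_sum_coeff (v : TreeAlg d) :
    v = ∑ σ ∈ (TreeAlg.coeff v).support, TreeAlg.coeff v σ • TreeAlg.of σ := by
  apply TreeAlg.coeff.injective
  rw [map_sum]
  simp only [map_smul, TreeAlg.coeff_of, Finsupp.smul_single, smul_eq_mul, mul_one]
  exact (Finsupp.sum_single _).symm

theorem mem_treeSpan_of_support {D : Set (Tree d)} {v : TreeAlg d}
    (h : ∀ σ ∈ (TreeAlg.coeff v).support, σ ∈ D) : v ∈ treeSpan D := by
  have := Submodule.sum_mem (treeSpan D) fun σ hσ =>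
    Submodule.smul_mem _ (TreeAlg.coeff v σ) (of_mem_treeSpan (h σ hσ))
  rwa [← eq_sum_coeff] at this

theorem mem_treeSpan_univ (v : TreeAlg d) : v ∈ treeSpan (Set.univ : Set (Tree d)) :=
  mem_treeSpan_of_support fun _ _ => trivial

theorem coeff_eq_zero_of_mem_treeSpan {D : Set (Tree d)} {v : TreeAlg d} (hv : v ∈ treeSpan D)
    {σ : Tree d} (hσ : σ ∉ D) : TreeAlg.coeff v σ = 0 := by
  have := map_mem_of_mem_treeSpan ((Finsupp.lapply σ).comp TreeAlg.coeff.toLinearMap)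
    (D := D) (N := (⊥ : Submodule ℝ ℝ)) (fun ρ hρ => ?_) hv
  · simpa using this
  · have hne : ρ ≠ σ := fun h => hσ (h ▸ hρ)
    simp [TreeAlg.coeff_of, hne]

/-! ### Families with coefficients depending continuously on a parameter. -/

variable {Y : Type*} [TopologicalSpace Y]

/-- Families of elements of the span of `D`, with finitely many trees involved and with coefficients
that are continuous in the parameter. -/
def contFam (Y : Type*) [TopologicalSpace Y] (D : Set (Tree d)) : Submodule ℝ (Y → TreeAlg d) :=
  Submodule.span ℝ {v | ∃ a : Y → ℝ, Continuous a ∧ ∃ σ ∈ D, v = fun y => a y • TreeAlg.of σ}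

theorem smul_of_mem_contFam {D : Set (Tree d)} {a : Y → ℝ} (ha : Continuous a) {σ : Tree d}
    (hσ : σ ∈ D) : (fun y => a y • TreeAlg.of σ) ∈ contFam Y D :=
  Submodule.subset_span ⟨a, ha, σ, hσ, rfl⟩

/-- Families are generated by single trees with continuous weights, so an operator that depends on
the same parameter can be tested tree by tree. The weight stays in the hypothesis here;
`contFam_bind'` removes it once continuous scalars are known to act on families. -/
theorem contFam_bind {D D' : Set (Tree d)} (L : Y → TreeAlg d →ₗ[ℝ] TreeAlg d)
    (h : ∀ σ ∈ D, ∀ a : Y → ℝ, Continuous a →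
      (fun y => a y • L y (TreeAlg.of σ)) ∈ contFam Y D')
    {v : Y → TreeAlg d} (hv : v ∈ contFam Y D) : (fun y => L y (v y)) ∈ contFam Y D' := by
  let Φ : (Y → TreeAlg d) →ₗ[ℝ] (Y → TreeAlg d) := LinearMap.pi fun y => L y ∘ₗ LinearMap.proj y
  have : contFam Y D ≤ (contFam Y D').comap Φ := by
    refine Submodule.span_le.2 ?_
    rintro _ ⟨a, ha, σ, hσ, rfl⟩
    have e : Φ (fun y => a y • TreeAlg.of σ) = fun y => a y • L y (TreeAlg.of σ) := by
      funext y; simp [Φ]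
    simp only [Submodule.comap_coe, Set.mem_preimage, SetLike.mem_coe, e]
    exact h σ hσ a ha
  exact this hv

theorem smul_mem_contFam {D : Set (Tree d)} {a : Y → ℝ} (ha : Continuous a)
    {v : Y → TreeAlg d} (hv : v ∈ contFam Y D) : (fun y => a y • v y) ∈ contFam Y D := by
  refine contFam_bind (fun y => a y • LinearMap.id) (fun σ hσ b hb => ?_) hv
  simp only [LinearMap.smul_apply, LinearMap.id_apply, smul_smul]
  exact smul_of_mem_contFam (hb.mul ha) hσ

theorem contFam_bind' {D D' : Set (Tree d)} (L : Y → TreeAlg d →ₗ[ℝ] TreeAlg d)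
    (h : ∀ σ ∈ D, (fun y => L y (TreeAlg.of σ)) ∈ contFam Y D')
    {v : Y → TreeAlg d} (hv : v ∈ contFam Y D) : (fun y => L y (v y)) ∈ contFam Y D' :=
  contFam_bind L (fun σ hσ _ ha => smul_mem_contFam ha (h σ hσ)) hv

theorem contFam_mono {D D' : Set (Tree d)} (h : D ⊆ D') : contFam Y D ≤ contFam Y D' := by
  refine Submodule.span_mono ?_
  rintro _ ⟨a, ha, σ, hσ, rfl⟩
  exact ⟨a, ha, σ, h hσ, rfl⟩

theorem const_mem_contFam {D : Set (Tree d)} {v : TreeAlg d} (hv : v ∈ treeSpan D) :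
    (fun _ : Y => v) ∈ contFam Y D := by
  refine map_mem_of_mem_treeSpan (LinearMap.pi fun _ : Y => LinearMap.id) (fun σ hσ => ?_) hv
  convert smul_of_mem_contFam (Y := Y) (a := fun _ => 1) continuous_const hσ using 1
  funext y
  simp

theorem mul_mem_contFam {D D' D'' : Set (Tree d)} (h : ∀ σ ∈ D, ∀ ρ ∈ D', σ * ρ ∈ D'')
    {u v : Y → TreeAlg d} (hu : u ∈ contFam Y D) (hv : v ∈ contFam Y D') :
    (fun y => u y * v y) ∈ contFam Y D'' := by
  refine contFam_bind' (fun y => LinearMap.mulRight ℝ (v y)) (fun σ hσ => ?_) hu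
  refine contFam_bind' (fun y => LinearMap.mulLeft ℝ (TreeAlg.of σ)) (fun ρ hρ => ?_) hv
  simp only [LinearMap.mulLeft_apply, ← TreeAlg.of_mul]
  exact const_mem_contFam (of_mem_treeSpan (h σ hσ ρ hρ))

theorem continuous_of_mem_contFam {D : Set (Tree d)} (L : Y → TreeAlg d →ₗ[ℝ] ℝ)
    (h : ∀ σ ∈ D, Continuous fun y => L y (TreeAlg.of σ)) {v : Y → TreeAlg d}
    (hv : v ∈ contFam Y D) : Continuous fun y => L y (v y) := by
  induction hv using Submodule.span_induction with
  | mem u hu =>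
    obtain ⟨a, ha, σ, hσ, rfl⟩ := hu
    simp only [map_smul, smul_eq_mul]
    exact ha.mul (h σ hσ)
  | zero => simpa using continuous_const
  | add u v _ _ hu hv =>
    simp only [Pi.add_apply, map_add]
    exact hu.add hv
  | smul c u _ hu => simpa using hu.const_mul c

theorem continuous_coeff_of_mem_contFam {D : Set (Tree d)} {v : Y → TreeAlg d}
    (hv : v ∈ contFam Y D) (σ : Tree d) : Continuous fun y => TreeAlg.coeff (v y) σ :=
  continuous_of_mem_contFam (fun _ => (Finsupp.lapply σ).comp TreeAlg.coeff.toLinearMap)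
    (fun _ _ => continuous_const) hv

theorem mem_treeSpan_of_mem_contFam {D : Set (Tree d)} {v : Y → TreeAlg d}
    (hv : v ∈ contFam Y D) (y : Y) : v y ∈ treeSpan D := by
  induction hv using Submodule.span_induction with
  | mem u hu =>
    obtain ⟨a, ha, σ, hσ, rfl⟩ := hu
    exact Submodule.smul_mem _ _ (of_mem_treeSpan hσ)
  | zero => exact Submodule.zero_mem _
  | add u v _ _ hu hv => exact Submodule.add_mem _ hu hv
  | smul c u _ hu => exact Submodule.smul_mem _ c hu

/-- Finiteness uniform in the parameter lets the constants of the model bounds be added over one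
finite set of trees serving all base points. -/
theorem exists_finset_of_mem_contFam {D : Set (Tree d)} {v : Y → TreeAlg d}
    (hv : v ∈ contFam Y D) : ∃ s : Finset (Tree d), (∀ σ ∈ s, σ ∈ D) ∧
      ∀ y, (TreeAlg.coeff (v y)).support ⊆ s := by
  classical
  induction hv using Submodule.span_induction with
  | mem u hu =>
    obtain ⟨a, ha, σ, hσ, rfl⟩ := hu
    refine ⟨{σ}, by simpa using hσ, fun y => ?_⟩
    rw [map_smul, TreeAlg.coeff_of]
    exact Finsupp.support_smul.trans Finsupp.support_single_subset
  | zero => exact ⟨∅, by simp, fun y => by simp⟩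
  | add u v _ _ hu hv =>
    obtain ⟨s, hs, hs'⟩ := hu
    obtain ⟨t, ht, ht'⟩ := hv
    refine ⟨s ∪ t, fun σ hσ => (Finset.mem_union.1 hσ).elim (hs σ) (ht σ), fun y => ?_⟩
    rw [Pi.add_apply, map_add]
    exact Finsupp.support_add.trans (Finset.union_subset_union (hs' y) (ht' y))
  | smul c u _ hu =>
    obtain ⟨s, hs, hs'⟩ := hu
    refine ⟨s, hs, fun y => ?_⟩
    rw [Pi.smul_apply, map_smul]
    exact Finsupp.support_smul.trans (hs' y)

/-- Trees are a basis, so coefficients outside `D'` vanish identically and can be dropped. This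
merges degree bounds with conformity to the rule, which are obtained by unrelated arguments. -/
theorem mem_contFam_of_mem_treeSpan {D D' : Set (Tree d)} {v : Y → TreeAlg d}
    (hv : v ∈ contFam Y D) (hv' : ∀ y, v y ∈ treeSpan D') : v ∈ contFam Y (D ∩ D') := by
  classical
  obtain ⟨s, hs, hs'⟩ := exists_finset_of_mem_contFam hv
  have e : v = ∑ σ ∈ s.filter (· ∈ D'), fun y => TreeAlg.coeff (v y) σ • TreeAlg.of σ := by
    funext y
    rw [Finset.sum_apply]
    refine (eq_sum_coeff (v y)).trans (Finset.sum_subset (fun σ hσ => ?_) fun σ _ hσ => ?_)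
    · refine Finset.mem_filter.2 ⟨hs' y hσ, ?_⟩
      by_contra hn
      exact Finsupp.mem_support_iff.1 hσ (coeff_eq_zero_of_mem_treeSpan (hv' y) hn)
    · rw [Finsupp.notMem_support_iff.1 hσ, zero_smul]
  rw [e]
  refine Submodule.sum_mem _ fun σ hσ => ?_
  rw [Finset.mem_filter] at hσ
  exact smul_of_mem_contFam (continuous_coeff_of_mem_contFam hv σ) ⟨hs σ hσ.1, hσ.2⟩

end

section

variable {d : ℕ}

theorem Tree.mul_induction {p : Tree d → Prop} (h1 : p 1) (hmul : ∀ s t, p s → p t → p (s * t))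
    (hX : ∀ i, p (Tree.X (Pi.single i 1))) (hXi : ∀ l, p (Tree.Xi l))
    (hI : ∀ m s, p s → p (Tree.I m s)) (t : Tree d) : p t := by
  have hpow : ∀ (s : Tree d), p s → ∀ n : ℕ, p (s ^ n) := by
    intro s hs n
    induction n with
    | zero => rwa [pow_zero]
    | succ n ih => rw [pow_succ]; exact hmul _ _ ih hs
  induction t using Tree.induction with
  | hX k =>
    rw [Tree.X_eq_prod]
    exact Finset.prod_induction _ p hmul h1 fun i _ => hpow _ (hX i) _
  | hXi l t ih => exact hmul _ _ (hXi l) ih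
  | hI m s t ih ih' => exact hmul _ _ (hI m s ih) ih'

/-! ### Divided powers -/

/-- The divided power `a^k/k!`. -/
def dpow {A : Type*} [CommRing A] [Algebra ℝ A] (a : Fin d → A) (k : MIdx d) : A :=
  (∏ i, ((k i).factorial : ℝ))⁻¹ • ∏ i, a i ^ k i

/-- The multi-indices `e ≤ k`. -/
def MIdx.lower (k : MIdx d) : Finset (MIdx d) := Fintype.piFinset fun i => Finset.range (k i + 1)

theorem MIdx.mem_lower {k e : MIdx d} : e ∈ MIdx.lower k ↔ e ≤ k := by
  simp [MIdx.lower, Pi.le_def]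

theorem dpow_eq_prod {A : Type*} [CommRing A] [Algebra ℝ A] (a : Fin d → A) (k : MIdx d) :
    dpow a k = ∏ i, (((k i).factorial : ℝ)⁻¹ • a i ^ k i) := by
  rw [dpow, Finset.prod_smul, Finset.prod_inv_distrib]

theorem inv_factorial_smul_add_pow {A : Type*} [CommRing A] [Algebra ℝ A] (a b : A) (n : ℕ) :
    ((n.factorial : ℝ)⁻¹ • (a + b) ^ n) = ∑ j ∈ Finset.range (n + 1),
      ((j.factorial : ℝ)⁻¹ • a ^ j) * (((n - j).factorial : ℝ)⁻¹ • b ^ (n - j)) := by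
  rw [add_pow, Finset.smul_sum]
  refine Finset.sum_congr rfl fun j hj => ?_
  have hj' : j ≤ n := Nat.lt_succ_iff.1 (Finset.mem_range.1 hj)
  rw [smul_mul_smul_comm, mul_comm _ ((n.choose j : ℕ) : A), ← nsmul_eq_mul,
    ← Nat.cast_smul_eq_nsmul ℝ, smul_smul]
  congr 1
  have h := Nat.choose_mul_factorial_mul_factorial hj'
  have hn : (n.factorial : ℝ) ≠ 0 := by positivity
  have h1 : (j.factorial : ℝ) ≠ 0 := by positivity
  have h2 : ((n - j).factorial : ℝ) ≠ 0 := by positivity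
  field_simp
  have h' : (n.choose j : ℝ) * j.factorial * (n - j).factorial = n.factorial := by exact_mod_cast h
  linarith

/-- The binomial theorem in each coordinate; with factorials absorbed, no binomial coefficients
remain. -/
theorem dpow_add {A : Type*} [CommRing A] [Algebra ℝ A] (a b : Fin d → A) (k : MIdx d) :
    dpow (fun i => a i + b i) k = ∑ e ∈ MIdx.lower k, dpow a e * dpow b (k - e) := by
  simp only [dpow_eq_prod, inv_factorial_smul_add_pow]
  rw [Finset.prod_univ_sum]
  refine Finset.sum_congr rfl fun e _ => ?_
  rw [← Finset.prod_mul_distrib]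
  rfl

theorem map_dpow {A B : Type*} [CommRing A] [Algebra ℝ A] [CommRing B] [Algebra ℝ B]
    (φ : A →ₐ[ℝ] B) (a : Fin d → A) (k : MIdx d) :
    φ (dpow a k) = dpow (fun i => φ (a i)) k := by
  simp [dpow, map_prod, map_pow]

theorem Xdiv_eq_dpow (k : MIdx d) :
    TreeAlg.Xdiv k = dpow (fun i => TreeAlg.of (Tree.X (Pi.single i 1))) k := by
  rw [TreeAlg.Xdiv, of_X, dpow]

theorem Scaling.midx_add (S : Scaling d) (k l : MIdx d) :
    S.midx (k + l) = S.midx k + S.midx l := by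
  simp [midx, add_mul, Finset.sum_add_distrib]

/-- Substitute k = e + j: additivity of |·|_𝔰 turns |k|_𝔰 < c into |j|_𝔰 < c - |e|_𝔰, and |e|_𝔰 < c
then follows from |j|_𝔰 ≥ 0. This allows powers to be expanded inside truncated sums. -/
theorem sum_below_lower {A : Type*} [AddCommMonoid A] (S : Scaling d) (c : ℝ)
    (F : MIdx d → MIdx d → A) :
    ∑ k ∈ S.below c, ∑ e ∈ MIdx.lower k, F e (k - e) =
      ∑ e ∈ S.below c, ∑ j ∈ S.below (c - S.midx e), F e j := by
  rw [Finset.sum_sigma', Finset.sum_sigma']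
  refine Finset.sum_bij' (fun p _ => ⟨p.2, p.1 - p.2⟩) (fun p _ => ⟨p.1 + p.2, p.1⟩)
    ?_ ?_ ?_ ?_ ?_
  · rintro ⟨k, e⟩ h
    simp only [Finset.mem_sigma, S.mem_below, MIdx.mem_lower] at h ⊢
    have := S.midx_add (k - e) e
    rw [tsub_add_cancel_of_le h.2] at this
    have h0 := S.midx_nonneg (k - e)
    constructor <;> linarith [h.1]
  · rintro ⟨e, j⟩ h
    simp only [Finset.mem_sigma, S.mem_below, MIdx.mem_lower] at h ⊢
    rw [S.midx_add]
    exact ⟨by linarith, le_self_add⟩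
  · rintro ⟨k, e⟩ h
    simp only [Finset.mem_sigma, MIdx.mem_lower] at h
    simp [add_tsub_cancel_of_le h.2]
  · rintro ⟨e, j⟩ _
    simp
  · rintro ⟨k, e⟩ _
    rfl

/-! ### Cuts at the root -/

variable (S : Scaling d)

/-- The sum over the subtrees containing the root of the subtree tensor the contracted tree. -/
def rootCut (M : ℝ) : Tree d →* TreeAlg d ⊗[ℝ] TreeAlg d :=
  Tree.fold
    (fun i => TreeAlg.of (Tree.X (Pi.single i 1)) ⊗ₜ 1 + 1 ⊗ₜ TreeAlg.of (Tree.X (Pi.single i 1)))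
    (fun l => TreeAlg.of (Tree.Xi l) ⊗ₜ 1 +
      ∑ e ∈ S.below M, TreeAlg.Xdiv e ⊗ₜ TreeAlg.of (Tree.Xi (l + e)))
    (fun m τ u => TensorProduct.map (TreeAlg.I m) LinearMap.id u +
      ∑ e ∈ S.below M, TreeAlg.Xdiv e ⊗ₜ TreeAlg.of (Tree.I (m + e) τ))

theorem rootCut_X (M : ℝ) (i : Fin d) : rootCut S M (Tree.X (Pi.single i 1)) =
    TreeAlg.of (Tree.X (Pi.single i 1)) ⊗ₜ 1 + 1 ⊗ₜ TreeAlg.of (Tree.X (Pi.single i 1)) := by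
  rw [rootCut, Tree.fold_X_single]

theorem rootCut_Xi (M : ℝ) (l : MIdx d) : rootCut S M (Tree.Xi l) =
    TreeAlg.of (Tree.Xi l) ⊗ₜ 1 +
      ∑ e ∈ S.below M, TreeAlg.Xdiv e ⊗ₜ TreeAlg.of (Tree.Xi (l + e)) := by
  rw [rootCut, Tree.fold_Xi]

theorem rootCut_I (M : ℝ) (m : MIdx d) (τ : Tree d) : rootCut S M (Tree.I m τ) =
    TensorProduct.map (TreeAlg.I m) LinearMap.id (rootCut S M τ) +
      ∑ e ∈ S.below M, TreeAlg.Xdiv e ⊗ₜ TreeAlg.of (Tree.I (m + e) τ) := by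
  rw [rootCut, Tree.fold_I]

/-- The linear extension of `rootCut`. -/
def rootCutAlg (M : ℝ) : TreeAlg d →ₐ[ℝ] TreeAlg d ⊗[ℝ] TreeAlg d :=
  TreeAlg.algExt (rootCut S M)

theorem rootCutAlg_of (M : ℝ) (τ : Tree d) : rootCutAlg S M (TreeAlg.of τ) = rootCut S M τ :=
  TreeAlg.algExt_of _ _

theorem rootCutAlg_I (M : ℝ) (m : MIdx d) (v : TreeAlg d) :
    rootCutAlg S M (TreeAlg.I m v) =
      TensorProduct.map (TreeAlg.I m) LinearMap.id (rootCutAlg S M v) +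
      ∑ e ∈ S.below M, TreeAlg.Xdiv e ⊗ₜ TreeAlg.I (m + e) v := by
  have h : (rootCutAlg S M).toLinearMap ∘ₗ TreeAlg.I m =
      TensorProduct.map (TreeAlg.I m) LinearMap.id ∘ₗ (rootCutAlg S M).toLinearMap +
      ∑ e ∈ S.below M, (TensorProduct.mk ℝ _ _ (TreeAlg.Xdiv e)) ∘ₗ TreeAlg.I (m + e) := by
    apply TreeAlg.lin_ext
    intro τ
    simp [← I_of, rootCutAlg_of, rootCut_I, LinearMap.sum_apply]
  simpa [LinearMap.sum_apply] using LinearMap.congr_fun h v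

theorem tmul_dpow_left (e : MIdx d) :
    (TreeAlg.Xdiv e ⊗ₜ[ℝ] (1 : TreeAlg d)) =
      dpow (fun i => TreeAlg.of (Tree.X (Pi.single i 1)) ⊗ₜ[ℝ] (1 : TreeAlg d)) e := by
  rw [Xdiv_eq_dpow]
  exact map_dpow (Algebra.TensorProduct.includeLeft : TreeAlg d →ₐ[ℝ] TreeAlg d ⊗[ℝ] TreeAlg d) _ _

theorem tmul_dpow_right (e : MIdx d) :
    ((1 : TreeAlg d) ⊗ₜ[ℝ] TreeAlg.Xdiv e) =
      dpow (fun i => (1 : TreeAlg d) ⊗ₜ[ℝ] TreeAlg.of (Tree.X (Pi.single i 1))) e := by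
  rw [Xdiv_eq_dpow]
  exact map_dpow
    (Algebra.TensorProduct.includeRight : TreeAlg d →ₐ[ℝ] TreeAlg d ⊗[ℝ] TreeAlg d) _ _

/-- Each X_i is primitive for the cut, so this is the binomial theorem for divided powers. -/
theorem rootCutAlg_Xdiv (M : ℝ) (k : MIdx d) : rootCutAlg S M (TreeAlg.Xdiv k) =
    ∑ e ∈ MIdx.lower k, TreeAlg.Xdiv e ⊗ₜ TreeAlg.Xdiv (k - e) := by
  rw [Xdiv_eq_dpow, map_dpow]
  simp only [rootCutAlg_of, rootCut_X]
  rw [dpow_add]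
  refine Finset.sum_congr rfl fun e _ => ?_
  rw [← tmul_dpow_left, ← tmul_dpow_right, Algebra.TensorProduct.tmul_mul_tmul, mul_one, one_mul]

/-! ### Filtering cuts by the degree of the left factor. -/

/-- The span of the `σ ⊗ ρ` with `D σ ρ`. -/
def cutSpan (D : Tree d → Tree d → Prop) : Submodule ℝ (TreeAlg d ⊗[ℝ] TreeAlg d) :=
  Submodule.span ℝ {u | ∃ σ ρ, D σ ρ ∧ u = TreeAlg.of σ ⊗ₜ TreeAlg.of ρ}

theorem tmul_mem_cutSpan {D : Tree d → Tree d → Prop} {σ ρ : Tree d} (h : D σ ρ) :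
    TreeAlg.of σ ⊗ₜ TreeAlg.of ρ ∈ cutSpan D := Submodule.subset_span ⟨σ, ρ, h, rfl⟩

theorem map_mem_of_mem_cutSpan {W : Type*} [AddCommGroup W] [Module ℝ W]
    (L : TreeAlg d ⊗[ℝ] TreeAlg d →ₗ[ℝ] W) {D : Tree d → Tree d → Prop} {N : Submodule ℝ W}
    (h : ∀ σ ρ, D σ ρ → L (TreeAlg.of σ ⊗ₜ TreeAlg.of ρ) ∈ N) {u : TreeAlg d ⊗[ℝ] TreeAlg d}
    (hu : u ∈ cutSpan D) : L u ∈ N := by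
  have : cutSpan D ≤ N.comap L := by
    refine Submodule.span_le.2 ?_
    rintro _ ⟨σ, ρ, hσ, rfl⟩
    exact h σ ρ hσ
  exact this hu

theorem cutSpan_mono {D D' : Tree d → Tree d → Prop} (h : ∀ σ ρ, D σ ρ → D' σ ρ) :
    cutSpan D ≤ cutSpan D' := by
  intro u hu
  exact map_mem_of_mem_cutSpan LinearMap.id (fun σ ρ hσ => tmul_mem_cutSpan (h σ ρ hσ)) hu

theorem mul_mem_cutSpan {D D' D'' : Tree d → Tree d → Prop}
    (h : ∀ σ ρ σ' ρ', D σ ρ → D' σ' ρ' → D'' (σ * σ') (ρ * ρ')) {u v : TreeAlg d ⊗[ℝ] TreeAlg d}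
    (hu : u ∈ cutSpan D) (hv : v ∈ cutSpan D') : u * v ∈ cutSpan D'' := by
  refine map_mem_of_mem_cutSpan (LinearMap.mulRight ℝ v) (fun σ ρ hσ => ?_) hu
  refine map_mem_of_mem_cutSpan (LinearMap.mulLeft ℝ _) (fun σ' ρ' hσ' => ?_) hv
  rw [LinearMap.mulLeft_apply, Algebra.TensorProduct.tmul_mul_tmul, ← TreeAlg.of_mul,
    ← TreeAlg.of_mul]
  exact tmul_mem_cutSpan (h _ _ _ _ hσ hσ')

theorem Xdiv_tmul_mem_cutSpan {D : Tree d → Tree d → Prop} {e : MIdx d} {ρ : Tree d}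
    (h : D (Tree.X e) ρ) : TreeAlg.Xdiv e ⊗ₜ TreeAlg.of ρ ∈ cutSpan D := by
  rw [TreeAlg.Xdiv, ← TensorProduct.smul_tmul']
  exact Submodule.smul_mem _ _ (tmul_mem_cutSpan h)

/-- The span of the `σ ⊗ ρ` with `|σ|_𝔰 ≥ c`. -/
abbrev leftFilt (c : ℝ) : Submodule ℝ (TreeAlg d ⊗[ℝ] TreeAlg d) :=
  cutSpan fun σ _ => c ≤ S.deg σ

variable {S}

theorem leftFilt_anti {c c' : ℝ} (h : c ≤ c') : leftFilt S c' ≤ leftFilt S c :=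
  cutSpan_mono fun _ _ hσ => h.trans hσ

theorem mul_mem_leftFilt {c c' : ℝ} {u v : TreeAlg d ⊗[ℝ] TreeAlg d}
    (hu : u ∈ leftFilt S c) (hv : v ∈ leftFilt S c') : u * v ∈ leftFilt S (c + c') :=
  mul_mem_cutSpan (fun _ _ _ _ h h' => by rw [S.deg_mul]; exact add_le_add h h') hu hv

theorem tmul_mem_leftFilt {c : ℝ} {σ : Tree d} (h : c ≤ S.deg σ) (w : TreeAlg d) :
    TreeAlg.of σ ⊗ₜ w ∈ leftFilt S c :=
  map_mem_of_mem_treeSpan (TensorProduct.mk ℝ _ _ (TreeAlg.of σ))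
    (fun _ _ => tmul_mem_cutSpan h) (mem_treeSpan_univ w)

theorem Xdiv_mem_leftFilt {c : ℝ} {e : MIdx d} (h : c ≤ S.midx e) (w : TreeAlg d) :
    TreeAlg.Xdiv e ⊗ₜ w ∈ leftFilt S c := by
  rw [TreeAlg.Xdiv, ← TensorProduct.smul_tmul']
  exact Submodule.smul_mem _ _ (tmul_mem_leftFilt (by rwa [S.deg_X]) w)

theorem map_I_mem_leftFilt {c : ℝ} (m : MIdx d) {u : TreeAlg d ⊗[ℝ] TreeAlg d}
    (hu : u ∈ leftFilt S c) : TensorProduct.map (TreeAlg.I m) LinearMap.id u ∈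
      leftFilt S (S.degI - S.midx m + c) := by
  refine map_mem_of_mem_cutSpan _ (fun σ ρ hσ => ?_) hu
  rw [TensorProduct.map_tmul, ← I_of]
  exact tmul_mem_cutSpan (by rw [S.deg_I]; linarith)

theorem map_I_mem_leftFilt' {c : ℝ} {m : MIdx d} {τ : Tree d} {u : TreeAlg d ⊗[ℝ] TreeAlg d}
    (hu : u ∈ leftFilt S (c - S.edgeWeight τ)) :
    TensorProduct.map (TreeAlg.I m) LinearMap.id u ∈
      leftFilt S (c - S.edgeWeight (Tree.I m τ)) := by
  refine leftFilt_anti ?_ (map_I_mem_leftFilt m hu)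
  rw [S.edgeWeight_I]
  linarith [neg_abs_le (S.degI - S.midx m)]

theorem sum_below_sub_mem_leftFilt {M M' : ℝ} (h : M ≤ M') {f : MIdx d → TreeAlg d} :
    ∑ e ∈ S.below M', TreeAlg.Xdiv e ⊗ₜ[ℝ] f e - ∑ e ∈ S.below M, TreeAlg.Xdiv e ⊗ₜ[ℝ] f e ∈
      leftFilt S M := by
  classical
  have hs : S.below M ⊆ S.below M' := fun e he =>
    S.mem_below.2 ((S.mem_below.1 he).trans_le h)
  rw [← Finset.sum_sdiff hs, add_sub_cancel_right]
  refine Submodule.sum_mem _ fun e he => Xdiv_mem_leftFilt ?_ _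
  rw [Finset.mem_sdiff, S.mem_below, S.mem_below] at he
  exact not_lt.1 he.2

/-- Differences of products telescope, and the remaining factor lowers the left degree by at most
its edge weight. Errors of truncation thus stay at left degree at least `M - S.edgeWeight τ`; as
soon as `M` is at least the edge weight they are invisible to π_-. -/
theorem hom_close {M : ℝ} (hM : 0 ≤ M) {φ ψ : Tree d →* TreeAlg d ⊗[ℝ] TreeAlg d}
    (hψ : ∀ τ, ψ τ ∈ leftFilt S (0 - S.edgeWeight τ))
    (hX : ∀ i, φ (Tree.X (Pi.single i 1)) = ψ (Tree.X (Pi.single i 1)))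
    (hXi : ∀ l, φ (Tree.Xi l) - ψ (Tree.Xi l) ∈ leftFilt S (M - S.edgeWeight (Tree.Xi l)))
    (hI : ∀ m τ, φ τ - ψ τ ∈ leftFilt S (M - S.edgeWeight τ) →
      φ (Tree.I m τ) - ψ (Tree.I m τ) ∈ leftFilt S (M - S.edgeWeight (Tree.I m τ)))
    (τ : Tree d) : φ τ - ψ τ ∈ leftFilt S (M - S.edgeWeight τ) := by
  induction τ using Tree.mul_induction with
  | h1 => simp
  | hmul s t hs ht =>
    have e : φ (s * t) - ψ (s * t) = φ s * (φ t - ψ t) + (φ s - ψ s) * ψ t := by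
      rw [map_mul, map_mul]; ring
    have hφ : φ s ∈ leftFilt S (0 - S.edgeWeight s) := by
      rw [← sub_add_cancel (φ s) (ψ s)]
      exact Submodule.add_mem _ (leftFilt_anti (by linarith) hs) (hψ s)
    rw [e, S.edgeWeight_mul]
    refine Submodule.add_mem _ ?_ ?_
    · exact leftFilt_anti (by linarith) (mul_mem_leftFilt hφ ht)
    · exact leftFilt_anti (by linarith) (mul_mem_leftFilt hs (hψ t))
  | hX i => rw [hX, sub_self]; exact Submodule.zero_mem _
  | hXi l => exact hXi l
  | hI m s hs => exact hI m s hs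

/-- A boundary decoration e adds |e|_𝔰 to the left factor through X^e and subtracts it from the edge
on the right, so degree is conserved; every edge goes to exactly one side. Only edges on the left
can contribute negatively there, whence the lower bound. -/
theorem rootCut_mem (M : ℝ) (τ : Tree d) : rootCut S M τ ∈ cutSpan fun σ ρ =>
    S.deg σ + S.deg ρ = S.deg τ ∧ σ.edges + ρ.edges = τ.edges ∧ -S.edgeWeight τ ≤ S.deg σ := by
  have hw := S.edgeWeight_nonneg (d := d)
  induction τ using Tree.mul_induction with
  | h1 =>
    rw [map_one, Algebra.TensorProduct.one_def, ← TreeAlg.of_one]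
    exact tmul_mem_cutSpan ⟨by simp [S.deg_one], by simp [Tree.one_def, Tree.edges_X], by
      simp [Tree.one_def, S.edgeWeight_X, S.deg_X, Scaling.midx]⟩
  | hmul s t hs ht =>
    rw [map_mul]
    refine mul_mem_cutSpan (fun σ ρ σ' ρ' h h' => ?_) hs ht
    simp only [S.deg_mul, S.edgeWeight_mul, Tree.edges_mul]
    exact ⟨by linarith [h.1, h'.1], by have := h.2.1; have := h'.2.1; omega,
      by linarith [h.2.2, h'.2.2]⟩
  | hX i =>
    rw [rootCut_X, ← TreeAlg.of_one]
    have h0 := S.midx_nonneg (Pi.single i 1)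
    refine Submodule.add_mem _ (tmul_mem_cutSpan ?_) (tmul_mem_cutSpan ?_) <;>
      simp [S.deg_X, S.edgeWeight_X, Tree.one_def, Tree.edges_X, Scaling.midx]
    simpa [Scaling.midx] using h0
  | hXi l =>
    rw [rootCut_Xi, ← TreeAlg.of_one]
    refine Submodule.add_mem _ (tmul_mem_cutSpan ?_) (Submodule.sum_mem _ fun e _ =>
      Xdiv_tmul_mem_cutSpan ?_)
    · refine ⟨by simp [S.deg_one], by simp [Tree.one_def, Tree.edges_X], ?_⟩
      rw [S.edgeWeight_Xi, S.deg_Xi]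
      exact neg_abs_le _
    · refine ⟨?_, by simp [Tree.edges_X, Tree.edges_Xi], ?_⟩
      · simp only [S.deg_X, S.deg_Xi, S.midx_add]; ring
      · rw [S.deg_X]; linarith [S.midx_nonneg e, hw (Tree.Xi l)]
  | hI m s hs =>
    rw [rootCut_I]
    refine Submodule.add_mem _ (map_mem_of_mem_cutSpan _ (fun σ ρ h => ?_) hs)
      (Submodule.sum_mem _ fun e _ => Xdiv_tmul_mem_cutSpan ?_)
    · rw [TensorProduct.map_tmul, ← I_of]
      refine tmul_mem_cutSpan ⟨?_, ?_, ?_⟩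
      · rw [S.deg_I, S.deg_I, ← h.1]; ring
      · rw [Tree.edges_I, Tree.edges_I, ← h.2.1]; ring
      · rw [S.deg_I, S.edgeWeight_I]
        linarith [neg_abs_le (S.degI - S.midx m), h.2.2]
    · refine ⟨?_, by simp [Tree.edges_X, Tree.edges_I], ?_⟩
      · simp only [S.deg_X, S.deg_I, S.midx_add]; ring
      · rw [S.deg_X]; linarith [S.midx_nonneg e, hw (Tree.I m s)]

theorem rootCut_mem_leftFilt (M : ℝ) (τ : Tree d) :
    rootCut S M τ ∈ leftFilt S (0 - S.edgeWeight τ) :=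
  cutSpan_mono (fun _ _ h => by rw [zero_sub]; exact h.2.2) (rootCut_mem M τ)

/-- A larger cut-off only adds boundary decorations with |e|_𝔰 ≥ `M`, and these put X^e into the
left factor. -/
theorem rootCut_stable {M M' : ℝ} (hM : 0 ≤ M) (h : M ≤ M') (τ : Tree d) :
    rootCut S M' τ - rootCut S M τ ∈ leftFilt S (M - S.edgeWeight τ) := by
  have hw := S.edgeWeight_nonneg (d := d)
  refine hom_close hM (rootCut_mem_leftFilt M) (fun i => ?_) (fun l => ?_) (fun m τ hτ => ?_) τ
  · rw [rootCut_X, rootCut_X]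
  · rw [rootCut_Xi, rootCut_Xi, add_sub_add_left_eq_sub]
    exact leftFilt_anti (by linarith [hw (Tree.Xi l)]) (sum_below_sub_mem_leftFilt h)
  · rw [rootCut_I, rootCut_I, add_sub_add_comm, ← map_sub]
    exact Submodule.add_mem _ (map_I_mem_leftFilt' hτ)
      (leftFilt_anti (by linarith [hw (Tree.I m τ)]) (sum_below_sub_mem_leftFilt h))

end

section

variable {d : ℕ} {S : Scaling d}

/-! ### Extraction at the root and recentring -/

section Recentre

variable {R : Rule d} (K : Kernel d) (P : modelSpace R →ₗ[ℝ] SmoothFun d)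

theorem recentre_Xi (x : Space d) (l : MIdx d) :
    recentre S K P x (TreeAlg.of (Tree.Xi l)) = TreeAlg.of (Tree.Xi l) := by
  rw [recentre_of, recentreAux, Tree.fold_Xi]

theorem recentre_I_of (x : Space d) (m : MIdx d) (τ : Tree d) :
    recentre S K P x (TreeAlg.of (Tree.I m τ)) =
      TreeAlg.I m (recentre S K P x (TreeAlg.of τ)) + polyPart S K P x m τ := by
  rw [I_of, recentre_I, TreeAlg.linExt_of]

theorem sum_below_sub_mem_leftFilt_of_eq_zero {c M : ℝ} {f : MIdx d → TreeAlg d}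
    (hf : ∀ e, e ∉ S.below c → f e = 0) :
    ∑ e ∈ S.below c, TreeAlg.Xdiv e ⊗ₜ[ℝ] f e - ∑ e ∈ S.below M, TreeAlg.Xdiv e ⊗ₜ[ℝ] f e ∈
      leftFilt S M := by
  -- As `f` vanishes off `S.below c`, the first range can be enlarged until it contains the second.
  have h : ∑ e ∈ S.below c, TreeAlg.Xdiv e ⊗ₜ[ℝ] f e =
      ∑ e ∈ S.below (max c M), TreeAlg.Xdiv e ⊗ₜ[ℝ] f e := by
    refine Finset.sum_subset (fun e he => ?_) fun e _ he => ?_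
    · rw [S.mem_below] at he ⊢
      exact he.trans_le (le_max_left _ _)
    · rw [hf e he, TensorProduct.tmul_zero]
  rw [h]
  exact sum_below_sub_mem_leftFilt (le_max_right _ _)

/-- The coefficient of X^k/k! depends on `m` and k only through `m` + k, and its range |k|_𝔰 < |𝓘_m
τ|_𝔰 becomes the range for 𝓘_{m+e} τ once X^e is split off. So the split lands on the polynomial
part of the differentiated tree, which is why cutting and recentring are compatible. -/
theorem rootCutAlg_polyPart (M : ℝ) (x : Space d) (m : MIdx d) (τ : Tree d) :
    rootCutAlg S M (polyPart S K P x m τ) = ∑ e ∈ S.below (S.deg (Tree.I m τ)),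
      TreeAlg.Xdiv e ⊗ₜ polyPart S K P x (m + e) τ := by
  have hc : ∀ e, S.deg (Tree.I m τ) - S.midx e = S.deg (Tree.I (m + e) τ) := fun e => by
    rw [S.deg_I, S.deg_I, S.midx_add]; ring
  have := sum_below_lower S (S.deg (Tree.I m τ)) fun e j =>
    TreeAlg.Xdiv e ⊗ₜ[ℝ] (posVal S K P x (m + e + j) τ (recentreAux S K P x τ) • TreeAlg.Xdiv j)
  simp only [hc, ← TensorProduct.tmul_sum] at this
  rw [polyPart, map_sum]
  refine Eq.trans (Finset.sum_congr rfl fun k _ => ?_) this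
  rw [map_smul, rootCutAlg_Xdiv, Finset.smul_sum]
  refine Finset.sum_congr rfl fun e he => ?_
  rw [add_assoc, add_tsub_cancel_of_le (MIdx.mem_lower.1 he), TensorProduct.tmul_smul]

/-- Recentring of the right factor. -/
def recentreRight (S : Scaling d) (x : Space d) :
    TreeAlg d ⊗[ℝ] TreeAlg d →ₐ[ℝ] TreeAlg d ⊗[ℝ] TreeAlg d :=
  Algebra.TensorProduct.map (AlgHom.id ℝ (TreeAlg d)) (recentre S K P x)

theorem recentreRight_tmul (x : Space d) (u v : TreeAlg d) :
    recentreRight K P S x (u ⊗ₜ v) = u ⊗ₜ recentre S K P x v := rfl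

theorem recentreRight_map_I (x : Space d) (m : MIdx d) (u : TreeAlg d ⊗[ℝ] TreeAlg d) :
    recentreRight K P S x (TensorProduct.map (TreeAlg.I m) LinearMap.id u) =
      TensorProduct.map (TreeAlg.I m) LinearMap.id (recentreRight K P S x u) := by
  induction u with
  | zero => simp
  | tmul u v => simp [recentreRight_tmul]
  | add u v hu hv => simp only [map_add, hu, hv]

/-- On generators the two sides differ only for planted trees, where the boundary decorations of the
polynomial part run over |e|_𝔰 < |𝓘_m τ|_𝔰 on one side and over |e|_𝔰 < `M` on the other. -/
theorem rootCut_recentre {M : ℝ} (hM : 0 ≤ M) (x : Space d) (τ : Tree d) :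
    rootCutAlg S M (recentre S K P x (TreeAlg.of τ)) - recentreRight K P S x (rootCut S M τ) ∈
      leftFilt S (M - S.edgeWeight τ) := by
  refine hom_close hM
    (φ := ((rootCutAlg S M).comp (recentre S K P x) : TreeAlg d →* _).comp TreeAlg.ofHom)
    (ψ := (recentreRight K P S x : _ →* _).comp (rootCut S M)) ?_ ?_ ?_ ?_ τ
  · intro τ
    refine map_mem_of_mem_cutSpan (recentreRight K P S x).toLinearMap (fun σ ρ hσ => ?_)
      (rootCut_mem_leftFilt M τ)
    exact tmul_mem_leftFilt hσ _
  · intro i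
    change rootCutAlg S M (recentre S K P x (TreeAlg.of _)) =
      recentreRight K P S x (rootCut S M _)
    rw [recentre_Xsingle, map_sub, AlgHom.commutes, rootCutAlg_of, rootCut_X, map_add,
      recentreRight_tmul, recentreRight_tmul, recentre_Xsingle, map_one, TensorProduct.tmul_sub,
      add_sub_assoc]
    congr 2
    -- The scalar produced by the shift sits on the left factor and is moved to the right one.
    rw [Algebra.TensorProduct.algebraMap_apply, Algebra.algebraMap_eq_smul_one,
      TensorProduct.smul_tmul]
  · intro l
    change rootCutAlg S M (recentre S K P x (TreeAlg.of _)) -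
      recentreRight K P S x (rootCut S M _) ∈ _
    rw [recentre_Xi, rootCutAlg_of, rootCut_Xi, map_add, map_sum]
    simp only [recentreRight_tmul, recentre_Xi, map_one, sub_self]
    exact Submodule.zero_mem _
  · intro m τ hτ
    change rootCutAlg S M (recentre S K P x (TreeAlg.of _)) -
      recentreRight K P S x (rootCut S M _) ∈ _
    change rootCutAlg S M (recentre S K P x (TreeAlg.of _)) -
      recentreRight K P S x (rootCut S M _) ∈ _ at hτ
    have h1 := map_I_mem_leftFilt' (m := m) hτ
    -- If |e|_𝔰 ≥ |𝓘_m τ|_𝔰, then 𝓘_{m+e} τ has degree at most 0 and its polynomial part is an empty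
    -- sum.
    have h2 := sum_below_sub_mem_leftFilt_of_eq_zero (S := S) (c := S.deg (Tree.I m τ)) (M := M)
      (f := fun e => polyPart S K P x (m + e) τ) (fun e he => by
        rw [polyPart]
        refine Finset.sum_eq_zero fun j hj => absurd ?_ he
        rw [S.mem_below] at hj ⊢
        rw [S.deg_I, S.midx_add] at hj
        rw [S.deg_I]
        linarith [S.midx_nonneg j])
    have hw := S.edgeWeight_nonneg (Tree.I m τ)
    convert Submodule.add_mem _ h1
      (leftFilt_anti (c := M - S.edgeWeight (Tree.I m τ)) (by linarith) h2) using 1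
    rw [recentre_I_of, map_add, rootCutAlg_I, rootCutAlg_polyPart, rootCut_I, map_add, map_sum,
      recentreRight_map_I, map_sub]
    simp only [recentreRight_tmul, recentre_I_of, TensorProduct.tmul_add, Finset.sum_add_distrib]
    abel

end Recentre

/-! ### Extraction of a single negative tree at the root. -/

section Extract

variable {R : Rule d} (g : NegChar S R)

/-- The functional on single trees induced by a character. -/
def negFunctional : TreeAlg d →ₗ[ℝ] ℝ := g.toLinearMap ∘ₗ piNeg S R

theorem negFunctional_of_notMem {τ : Tree d} (h : τ ∉ R.negTrees S) :
    negFunctional g (TreeAlg.of τ) = 0 := by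
  rw [negFunctional, LinearMap.comp_apply, piNeg, TreeAlg.linExt_of, dif_neg h, map_zero]

/-- `c ⊗ v ↦ g(π_- c) v`. -/
def negSlice : TreeAlg d ⊗[ℝ] TreeAlg d →ₗ[ℝ] TreeAlg d :=
  (TensorProduct.lid ℝ (TreeAlg d)).toLinearMap ∘ₗ
    TensorProduct.map (negFunctional g) LinearMap.id

theorem negSlice_tmul (u v : TreeAlg d) :
    negSlice g (u ⊗ₜ v) = negFunctional g u • v := by simp [negSlice]

/-- Members of 𝔗_- have negative degree. This turns the congruences modulo `leftFilt` into
equalities. -/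
theorem negSlice_leftFilt {u : TreeAlg d ⊗[ℝ] TreeAlg d} (hu : u ∈ leftFilt S 0) :
    negSlice g u = 0 := by
  have := map_mem_of_mem_cutSpan (negSlice g) (N := ⊥) (fun σ ρ hσ => ?_) hu
  · simpa using this
  · rw [negSlice_tmul, negFunctional_of_notMem g fun h => absurd h.2.1 (not_lt.2 hσ), zero_smul]
    exact Submodule.zero_mem _

/-- The sum over the extractions of a single negative tree at the root. -/
def rootExtract : TreeAlg d →ₗ[ℝ] TreeAlg d :=
  TreeAlg.linExt fun τ => negSlice g (rootCut S (S.edgeWeight τ) τ)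

theorem rootExtract_of {M : ℝ} {τ : Tree d} (h : S.edgeWeight τ ≤ M) :
    rootExtract g (TreeAlg.of τ) = negSlice g (rootCut S M τ) := by
  have := negSlice_leftFilt g (leftFilt_anti (sub_self (S.edgeWeight τ)).ge
    (rootCut_stable (S.edgeWeight_nonneg τ) h τ))
  rw [map_sub, sub_eq_zero] at this
  rw [rootExtract, TreeAlg.linExt_of, this]

/-- Each tree in `v` needs its own cut-off and there are finitely many of them, so one large cut-off
serves all. -/
theorem rootExtract_eventually (v : TreeAlg d) : ∀ᶠ M in Filter.atTop,
    rootExtract g v = negSlice g (rootCutAlg S M v) := by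
  induction mem_treeSpan_univ v using Submodule.span_induction with
  | mem u hu =>
    obtain ⟨τ, -, rfl⟩ := hu
    filter_upwards [Filter.eventually_ge_atTop (S.edgeWeight τ)] with M hM
    rw [rootCutAlg_of, rootExtract_of g hM]
  | zero => simp
  | add u v _ _ hu hv => filter_upwards [hu, hv] with M h h'; simp only [map_add, h, h']
  | smul c u _ hu => filter_upwards [hu] with M h; simp only [map_smul, h]

theorem negSlice_recentreRight {R₁ : Rule d} (K : Kernel d) (P : modelSpace R₁ →ₗ[ℝ] SmoothFun d)
    (x : Space d) (u : TreeAlg d ⊗[ℝ] TreeAlg d) :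
    negSlice g (recentreRight K P S x u) = recentre S K P x (negSlice g u) := by
  induction u with
  | zero => simp
  | tmul u v => rw [recentreRight_tmul, negSlice_tmul, negSlice_tmul, map_smul]
  | add u v hu hv => simp only [map_add, hu, hv]

/-- Extraction at the root commutes with recentring. -/
theorem rootExtract_recentre {R₁ : Rule d} (K : Kernel d) (P : modelSpace R₁ →ₗ[ℝ] SmoothFun d)
    (x : Space d) (v : TreeAlg d) :
    rootExtract g (recentre S K P x v) = recentre S K P x (rootExtract g v) := by
  have h : rootExtract g ∘ₗ (recentre S K P x).toLinearMap =
      (recentre S K P x).toLinearMap ∘ₗ rootExtract g := by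
    apply TreeAlg.lin_ext
    intro τ
    change rootExtract g (recentre S K P x (TreeAlg.of τ)) =
      recentre S K P x (rootExtract g (TreeAlg.of τ))
    -- The cut-off must be valid for all trees of F_x τ and must also exceed the weight of τ, so
    -- that the error in `rootCut_recentre` has nonnegative left degree.
    obtain ⟨M, h1, h2⟩ := ((rootExtract_eventually g (recentre S K P x (TreeAlg.of τ))).and
      (Filter.eventually_ge_atTop (S.edgeWeight τ))).exists
    have h0 := S.edgeWeight_nonneg τ
    have := negSlice_leftFilt g (leftFilt_anti (by linarith)
      (rootCut_recentre K P (h0.trans h2) x τ))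
    rw [map_sub, sub_eq_zero] at this
    rw [h1, this, negSlice_recentreRight, rootExtract_of g h2]
  exact LinearMap.congr_fun h v

/-- Extraction at the root increases the degree and decreases the number of edges. -/
theorem rootExtract_mem (τ : Tree d) : rootExtract g (TreeAlg.of τ) ∈
    treeSpan {σ | S.deg τ ≤ S.deg σ ∧ σ.edges < τ.edges} := by
  rw [rootExtract_of g le_rfl]
  refine map_mem_of_mem_cutSpan _ (fun σ ρ h => ?_) (rootCut_mem _ τ)
  rw [negSlice_tmul]
  by_cases hσ : σ ∈ R.negTrees S
  · refine Submodule.smul_mem _ _ (of_mem_treeSpan ⟨?_, ?_⟩)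
    -- Degree is conserved by the cut, so removing σ of negative degree raises the degree of what
    -- remains.
    · linarith [h.1, hσ.2.1]
    · have : σ.edges ≠ 0 := fun h0 =>
        absurd (Tree.deg_nonneg_of_edges_eq_zero S h0) (not_le.2 hσ.2.1)
      have := h.2.1
      omega
  · rw [negFunctional_of_notMem g hσ, zero_smul]
    exact Submodule.zero_mem _

theorem negFunctional_Xdiv (e : MIdx d) : negFunctional g (TreeAlg.Xdiv e) = 0 := by
  rw [TreeAlg.Xdiv, map_smul, negFunctional_of_notMem, smul_zero]
  intro h
  have := h.2.1
  rw [S.deg_X] at this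
  exact absurd (S.midx_nonneg e) (not_le.2 this)

theorem rootExtract_one : rootExtract g (TreeAlg.of (1 : Tree d)) = 0 := by
  rw [rootExtract_of g le_rfl, map_one, Algebra.TensorProduct.one_def, negSlice_tmul,
    ← TreeAlg.of_one, negFunctional_of_notMem, zero_smul]
  intro h
  have := h.2.1
  rw [S.deg_one] at this
  exact lt_irrefl _ this

theorem rootExtract_Xi (l : MIdx d) : rootExtract g (TreeAlg.of (Tree.Xi l)) = 0 := by
  rw [rootExtract_of g le_rfl, rootCut_Xi, map_add, map_sum, negSlice_tmul,
    negFunctional_of_notMem g fun h => h.2.2.2 (.inl ⟨l, rfl⟩), zero_smul, zero_add]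
  refine Finset.sum_eq_zero fun e _ => ?_
  rw [negSlice_tmul, negFunctional_Xdiv, zero_smul]

/-- The left factors of the cut are planted trees, which 𝔗_- excludes, or monomials, whose degree is
nonnegative. -/
theorem rootExtract_I (m : MIdx d) (τ : Tree d) :
    rootExtract g (TreeAlg.of (Tree.I m τ)) = 0 := by
  rw [rootExtract_of g le_rfl, rootCut_I, map_add, map_sum]
  have h : ∀ u : TreeAlg d ⊗[ℝ] TreeAlg d,
      negSlice g (TensorProduct.map (TreeAlg.I m) LinearMap.id u) = 0 := by
    intro u
    have h0 : negFunctional g ∘ₗ TreeAlg.I m = 0 := TreeAlg.lin_ext fun σ => by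
      rw [LinearMap.comp_apply, ← I_of,
        negFunctional_of_notMem g fun h => h.2.2.2 (.inr ⟨m, σ, rfl⟩), LinearMap.zero_apply]
    induction u with
    | zero => simp
    | tmul u v =>
      rw [TensorProduct.map_tmul, negSlice_tmul, ← LinearMap.comp_apply, h0]
      simp
    | add u v hu hv => rw [map_add, map_add, hu, hv, add_zero]
  rw [h, zero_add]
  refine Finset.sum_eq_zero fun e _ => ?_
  rw [negSlice_tmul, negFunctional_Xdiv, zero_smul]

/-- Trees in 𝔗_- have no polynomial decoration at the root, so every X_i at the root must go to the
contracted tree. -/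
theorem rootExtract_X_mul (k : MIdx d) (τ : Tree d) :
    rootExtract g (TreeAlg.of (Tree.X k * τ)) =
      TreeAlg.of (Tree.X k) * rootExtract g (TreeAlg.of τ) := by
  have hX : ∀ (i : Fin d) (u : TreeAlg d ⊗[ℝ] TreeAlg d),
      negSlice g ((TreeAlg.of (Tree.X (Pi.single i 1)) ⊗ₜ 1 +
        1 ⊗ₜ TreeAlg.of (Tree.X (Pi.single i 1))) * u) =
      TreeAlg.of (Tree.X (Pi.single i 1)) * negSlice g u := by
    intro i u
    have h0 : negFunctional g ∘ₗ
        LinearMap.mulLeft ℝ (TreeAlg.of (Tree.X (Pi.single i 1))) = 0 := by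
      refine TreeAlg.lin_ext fun σ => ?_
      rw [LinearMap.comp_apply, LinearMap.mulLeft_apply, ← TreeAlg.of_mul,
        negFunctional_of_notMem g fun h => ?_, LinearMap.zero_apply]
      have := congrFun h.2.2.1 i
      rw [Tree.rootPoly_mul, Tree.rootPoly_X] at this
      simp at this
    induction u with
    | zero => simp
    | tmul u v =>
      have h1 : negFunctional g (TreeAlg.of (Tree.X (Pi.single i 1)) * u) = 0 :=
        LinearMap.congr_fun h0 u
      rw [add_mul, Algebra.TensorProduct.tmul_mul_tmul, Algebra.TensorProduct.tmul_mul_tmul,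
        map_add, negSlice_tmul, negSlice_tmul, negSlice_tmul, h1, zero_smul, zero_add, one_mul,
        mul_smul_comm]
    | add u v hu hv => rw [mul_add, map_add, map_add, hu, hv, mul_add]
  have key : ∀ (M : ℝ) (u : TreeAlg d ⊗[ℝ] TreeAlg d),
      negSlice g (rootCut S M (Tree.X k) * u) = TreeAlg.of (Tree.X k) * negSlice g u := by
    intro M
    rw [Tree.X_eq_prod]
    refine Finset.prod_induction (fun i => (Tree.X (Pi.single i 1) : Tree d) ^ k i)
      (fun s => ∀ u, negSlice g (rootCut S M s * u) = TreeAlg.of s * negSlice g u)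
      (fun s t hs ht u => ?_) (fun u => ?_) (fun i _ => ?_)
    · rw [map_mul (rootCut S M), mul_assoc, hs, ht, TreeAlg.of_mul, mul_assoc]
    · rw [map_one, one_mul, TreeAlg.of_one, one_mul]
    · generalize k i = n
      induction n with
      | zero => intro u; rw [pow_zero, map_one, one_mul, TreeAlg.of_one, one_mul]
      | succ n ih =>
        intro u
        rw [pow_succ, map_mul (rootCut S M), mul_assoc, ih, rootCut_X, hX, TreeAlg.of_mul, mul_assoc]
  obtain ⟨M, h1, h2⟩ := ((rootExtract_eventually g (TreeAlg.of (Tree.X k * τ))).and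
    (rootExtract_eventually g (TreeAlg.of τ))).exists
  rw [h1, h2, rootCutAlg_of, rootCutAlg_of, map_mul, key]

end Extract

end

section

variable {d : ℕ} {S : Scaling d}

/-! ### Factorisation of the renormalisation map -/

section Renorm

variable {R : Rule d} (g : NegChar S R)

/-- `g ⊗ id` on `𝓕_- ⊗ 𝓥`. -/
def negMap : NegForests S R ⊗[ℝ] TreeAlg d →ₐ[ℝ] TreeAlg d :=
  (Algebra.TensorProduct.lid ℝ (TreeAlg d)).toAlgHom.comp
    (Algebra.TensorProduct.map g (AlgHom.id ℝ (TreeAlg d)))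

theorem negMap_tmul (f : NegForests S R) (v : TreeAlg d) : negMap g (f ⊗ₜ v) = g f • v := by
  simp [negMap]

/-- The renormalisation map `(g ⊗ id) Δ⁻`. -/
def renormMap : TreeAlg d →ₗ[ℝ] TreeAlg d := (negMap g).toLinearMap ∘ₗ deltaNeg S R

/-- The part of the renormalisation map that extracts only away from the root. -/
def outerMap : TreeAlg d →ₐ[ℝ] TreeAlg d :=
  TreeAlg.algExt (Tree.fold (fun i => TreeAlg.of (Tree.X (Pi.single i 1)))
    (fun l => TreeAlg.of (Tree.Xi l)) (fun m τ _ => TreeAlg.I m (renormMap g (TreeAlg.of τ))))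

theorem outerMap_Xsingle (i : Fin d) : outerMap g (TreeAlg.of (Tree.X (Pi.single i 1))) =
    TreeAlg.of (Tree.X (Pi.single i 1)) := by
  rw [outerMap, TreeAlg.algExt_of, Tree.fold_X_single]

theorem outerMap_X (k : MIdx d) :
    outerMap g (TreeAlg.of (Tree.X k)) = TreeAlg.of (Tree.X k) := by
  rw [of_X, map_prod]
  simp only [map_pow, outerMap_Xsingle]

theorem outerMap_Xdiv (k : MIdx d) : outerMap g (TreeAlg.Xdiv k) = TreeAlg.Xdiv k := by
  rw [TreeAlg.Xdiv, map_smul, outerMap_X]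

theorem outerMap_Xi (l : MIdx d) :
    outerMap g (TreeAlg.of (Tree.Xi l)) = TreeAlg.of (Tree.Xi l) := by
  rw [outerMap, TreeAlg.algExt_of, Tree.fold_Xi]

theorem outerMap_I (m : MIdx d) (v : TreeAlg d) :
    outerMap g (TreeAlg.I m v) = TreeAlg.I m (renormMap g v) := by
  have h : (outerMap g).toLinearMap ∘ₗ TreeAlg.I m = TreeAlg.I m ∘ₗ renormMap g := by
    apply TreeAlg.lin_ext
    intro τ
    rw [LinearMap.comp_apply, ← I_of, AlgHom.toLinearMap_apply, outerMap, TreeAlg.algExt_of,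
      Tree.fold_I]
    rfl
  exact LinearMap.congr_fun h v

theorem negMap_graftRight (m : MIdx d) (u : NegForests S R ⊗[ℝ] TreeAlg d) :
    negMap g (graftRight S R m u) = TreeAlg.I m (negMap g u) := by
  induction u with
  | zero => simp
  | tmul f v => simp [graftRight, negMap_tmul]
  | add u v hu hv => simp only [map_add, hu, hv]

/-- `id ⊗ g ⊗ id`. -/
def negMapRight (g : NegChar S R) :
    TreeAlg d ⊗[ℝ] (NegForests S R ⊗[ℝ] TreeAlg d) →ₐ[ℝ] TreeAlg d ⊗[ℝ] TreeAlg d :=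
  Algebra.TensorProduct.map (AlgHom.id ℝ (TreeAlg d)) (negMap g)

theorem negMapRight_tmul (c : TreeAlg d) (u : NegForests S R ⊗[ℝ] TreeAlg d) :
    negMapRight g (c ⊗ₜ u) = c ⊗ₜ negMap g u := rfl

theorem negMapRight_map_I (m : MIdx d)
    (u : TreeAlg d ⊗[ℝ] (NegForests S R ⊗[ℝ] TreeAlg d)) :
    negMapRight g (TensorProduct.map (TreeAlg.I m) LinearMap.id u) =
      TensorProduct.map (TreeAlg.I m) LinearMap.id (negMapRight g u) := by
  induction u with
  | zero => simp
  | tmul c u => simp [negMapRight_tmul]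
  | add u v hu hv => simp only [map_add, hu, hv]

/-- `outerMap` on the right factor. -/
def outerRight (g : NegChar S R) : TreeAlg d ⊗[ℝ] TreeAlg d →ₐ[ℝ] TreeAlg d ⊗[ℝ] TreeAlg d :=
  Algebra.TensorProduct.map (AlgHom.id ℝ (TreeAlg d)) (outerMap g)

theorem outerRight_tmul (u v : TreeAlg d) : outerRight g (u ⊗ₜ v) = u ⊗ₜ outerMap g v := rfl

theorem outerRight_map_I (m : MIdx d) (u : TreeAlg d ⊗[ℝ] TreeAlg d) :
    outerRight g (TensorProduct.map (TreeAlg.I m) LinearMap.id u) =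
      TensorProduct.map (TreeAlg.I m) LinearMap.id (outerRight g u) := by
  induction u with
  | zero => simp
  | tmul u v => simp [outerRight_tmul]
  | add u v hu hv => simp only [map_add, hu, hv]

theorem extract_Xsingle (M : ℝ) (i : Fin d) : extract S R M (Tree.X (Pi.single i 1)) =
    (1 ⊗ₜ TreeAlg.of (Tree.X (Pi.single i 1)),
      TreeAlg.of (Tree.X (Pi.single i 1)) ⊗ₜ 1 +
        1 ⊗ₜ (1 ⊗ₜ TreeAlg.of (Tree.X (Pi.single i 1)))) := by
  rw [extract, Tree.fold_X_single]

/-- Both components are multiplicative, so generators suffice. What sits above an edge outside the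
root component is renormalised on its own by the full Δ⁻, exactly as `outerMap` treats planted
trees. -/
theorem negMap_extract {M : ℝ} (τ : Tree d) (h : S.edgeWeight τ ≤ M) :
    negMap g (extract S R M τ).1 = outerMap g (TreeAlg.of τ) ∧
    negMapRight g (extract S R M τ).2 = outerRight g (rootCut S M τ) := by
  induction τ using Tree.mul_induction with
  | h1 =>
    rw [map_one, map_one, TreeAlg.of_one, map_one, Prod.fst_one, Prod.snd_one, map_one, map_one,
      map_one]
    exact ⟨rfl, rfl⟩
  | hmul s t hs ht =>
    rw [S.edgeWeight_mul] at h
    have hws := S.edgeWeight_nonneg s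
    have hwt := S.edgeWeight_nonneg t
    obtain ⟨hs1, hs2⟩ := hs (by linarith)
    obtain ⟨ht1, ht2⟩ := ht (by linarith)
    rw [map_mul (extract S R M), TreeAlg.of_mul, map_mul (outerMap g), map_mul (rootCut S M),
      map_mul (outerRight g), Prod.fst_mul, Prod.snd_mul, map_mul (negMap g),
      map_mul (negMapRight g), hs1, hs2, ht1, ht2]
    exact ⟨rfl, rfl⟩
  | hX i =>
    rw [extract_Xsingle, outerMap_Xsingle, rootCut_X]
    simp only [map_add, negMap_tmul, negMapRight_tmul, outerRight_tmul, outerMap_Xsingle, map_one,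
      one_smul]
    exact ⟨trivial, trivial⟩
  | hXi l =>
    rw [extract_Xi, outerMap_Xi, rootCut_Xi]
    simp only [map_add, map_sum, negMap_tmul, negMapRight_tmul, outerRight_tmul, outerMap_Xi,
      map_one, one_smul]
    exact ⟨trivial, trivial⟩
  | hI m s hs =>
    rw [S.edgeWeight_I] at h
    have hw : S.edgeWeight s ≤ M := by linarith [abs_nonneg (S.degI - S.midx m)]
    -- The cut-off exceeds the weight of the branch, so the sum inside the graft is Δ⁻ of that
    -- branch.
    rw [extract_I, ← deltaNeg_of s hw, rootCut_I]
    have hr : negMap g (deltaNeg S R (TreeAlg.of s)) = renormMap g (TreeAlg.of s) := rfl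
    simp only [map_add, map_sum, negMapRight_tmul, outerRight_tmul, negMapRight_map_I,
      outerRight_map_I, negMap_graftRight, (hs hw).2, I_of, outerMap_I, hr]
    exact ⟨trivial, trivial⟩

theorem negMap_closeRoot (u : TreeAlg d ⊗[ℝ] (NegForests S R ⊗[ℝ] TreeAlg d)) :
    negMap g (closeRoot S R u) = negSlice g (negMapRight g u) := by
  induction u with
  | zero => simp
  | tmul c u =>
    rw [negMapRight_tmul, negSlice_tmul]
    change negMap g ((piNeg S R c ⊗ₜ 1) * u) = _
    rw [map_mul, negMap_tmul, smul_mul_assoc, one_mul]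
    rfl
  | add u v hu hv => simp only [map_add, hu, hv]

theorem negSlice_outerRight (u : TreeAlg d ⊗[ℝ] TreeAlg d) :
    negSlice g (outerRight g u) = outerMap g (negSlice g u) := by
  induction u with
  | zero => simp
  | tmul u v => rw [outerRight_tmul, negSlice_tmul, negSlice_tmul, map_smul]
  | add u v hu hv => simp only [map_add, hu, hv]

/-- The renormalisation map extracts at the root first, and then away from the root. -/
theorem renormMap_eq (v : TreeAlg d) : renormMap g v = outerMap g (v + rootExtract g v) := by
  have h : renormMap g = (outerMap g).toLinearMap ∘ₗ (LinearMap.id + rootExtract g) := by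
    apply TreeAlg.lin_ext
    intro τ
    obtain ⟨h1, h2⟩ := negMap_extract g τ le_rfl
    change negMap g (deltaNeg S R (TreeAlg.of τ)) =
      outerMap g (TreeAlg.of τ + rootExtract g (TreeAlg.of τ))
    rw [deltaNeg_of τ le_rfl, map_add, h1, negMap_closeRoot, h2, negSlice_outerRight,
      rootExtract_of g le_rfl, map_add]
  exact LinearMap.congr_fun h v

theorem renormMap_one : renormMap g (TreeAlg.of 1) = TreeAlg.of 1 := by
  rw [renormMap_eq, rootExtract_one, add_zero, TreeAlg.of_one, map_one]

theorem renormMap_Xi (l : MIdx d) :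
    renormMap g (TreeAlg.of (Tree.Xi l)) = TreeAlg.of (Tree.Xi l) := by
  rw [renormMap_eq, rootExtract_Xi, add_zero, outerMap_Xi]

theorem renormMap_I (m : MIdx d) (τ : Tree d) :
    renormMap g (TreeAlg.of (Tree.I m τ)) = TreeAlg.I m (renormMap g (TreeAlg.of τ)) := by
  rw [renormMap_eq, rootExtract_I, add_zero, I_of, outerMap_I]

theorem renormMap_X_mul (k : MIdx d) (τ : Tree d) : renormMap g (TreeAlg.of (Tree.X k * τ)) =
    TreeAlg.of (Tree.X k) * renormMap g (TreeAlg.of τ) := by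
  rw [renormMap_eq, renormMap_eq, rootExtract_X_mul, TreeAlg.of_mul, ← mul_add,
    map_mul, outerMap_X]

/-- Completeness places Δ⁻v in 𝓕_- ⊗ 𝓣, and g turns the left factors into scalars. -/
theorem renormMap_mem (h : Rule.IsComplete S R) {v : TreeAlg d} (hv : v ∈ modelSpace R) :
    renormMap g v ∈ modelSpace R := by
  obtain ⟨w, hw⟩ := h v hv
  change negMap g (deltaNeg S R v) ∈ _
  rw [← hw]
  clear hw
  induction w with
  | zero => simp
  | tmul f v =>
    rw [LinearMap.lTensor_tmul, negMap_tmul]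
    exact Submodule.smul_mem _ _ v.2
  | add u v hu hv => rw [map_add, map_add]; exact Submodule.add_mem _ hu hv

theorem extendZero_renormalise (P : modelSpace R →ₗ[ℝ] SmoothFun d) {v : TreeAlg d}
    (hv : v ∈ modelSpace R) :
    extendZero (renormalise P g) v = extendZero P (renormMap g v) := by
  rw [extendZero_apply (renormalise P g) ⟨v, hv⟩]
  change TensorProduct.lid ℝ (SmoothFun d)
    (TensorProduct.map g.toLinearMap (extendZero P) (deltaNeg S R v)) =
      extendZero P (negMap g (deltaNeg S R v))
  generalize deltaNeg S R v = u
  induction u with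
  | zero => simp
  | tmul f v => simp [negMap_tmul]
  | add u v hu hv => simp only [map_add, hu, hv]

end Renorm

end

section

variable {d : ℕ} {S : Scaling d}

/-! ### Convolution with the kernel -/

namespace Kernel

variable (K : Kernel d)

/-- The kernel vanishes outside the open unit ball, so a bound on `G` within distance one of `x`
yields an integrable majorant of the integrand. -/
theorem norm_mul_le {G : Space d → ℝ} {s : Set (Space d)} {C : ℝ} (hC : ∀ z ∈ s, ‖G z‖ ≤ C)
    {x y : Space d} (h : ‖y‖ < 1 → x - y ∈ s) : ‖K.toFun y * G (x - y)‖ ≤ C * ‖K.toFun y‖ := by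
  rw [norm_mul, mul_comm]
  rcases le_or_gt 1 ‖y‖ with hy | hy
  · simp [K.support y hy]
  · exact mul_le_mul_of_nonneg_right (hC _ (h hy)) (norm_nonneg _)

theorem aestronglyMeasurable_mul {G : Space d → ℝ} (hG : Continuous G) (x : Space d) :
    MeasureTheory.AEStronglyMeasurable (fun y => K.toFun y * G (x - y)) :=
  K.integrable.aestronglyMeasurable.mul
    (hG.comp (continuous_const.sub continuous_id)).aestronglyMeasurable

theorem integrable_mul {G : Space d → ℝ} (hG : Continuous G) (x : Space d) :
    MeasureTheory.Integrable fun y => K.toFun y * G (x - y) := by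
  obtain ⟨C, hC⟩ := (isCompact_closedBall x 1).exists_bound_of_continuousOn hG.continuousOn
  refine (K.integrable.norm.const_mul C).mono' (K.aestronglyMeasurable_mul hG x)
    (Filter.Eventually.of_forall fun y => K.norm_mul_le hC fun hy => ?_)
  rw [Metric.mem_closedBall, dist_eq_norm]
  simpa using hy.le

theorem continuous_integral_mul {G : Space d → ℝ} (hG : Continuous G) :
    Continuous fun x => ∫ y, K.toFun y * G (x - y) := by
  refine continuous_iff_continuousAt.2 fun x => ?_
  -- Radius 2: base points vary within distance 1 of `x`, and the kernel reaches a further distance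
  -- 1.
  obtain ⟨C, hC⟩ := (isCompact_closedBall x 2).exists_bound_of_continuousOn hG.continuousOn
  refine MeasureTheory.continuousAt_of_dominated (bound := fun y => C * ‖K.toFun y‖)
    (Filter.Eventually.of_forall fun z => K.aestronglyMeasurable_mul hG z) ?_
    (K.integrable.norm.const_mul C) (Filter.Eventually.of_forall fun y => ?_)
  · filter_upwards [Metric.ball_mem_nhds x one_pos] with z hz
    refine Filter.Eventually.of_forall fun y => K.norm_mul_le hC fun hy => ?_
    rw [Metric.mem_ball, dist_eq_norm] at hz
    rw [Metric.mem_closedBall, dist_eq_norm]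
    calc ‖z - y - x‖ = ‖(z - x) - y‖ := by congr 1; abel
      _ ≤ ‖z - x‖ + ‖y‖ := norm_sub_le _ _
      _ ≤ 2 := by linarith
  · exact (continuous_const.mul (hG.comp (continuous_id.sub continuous_const))).continuousAt

/-- `F ↦ (D^m K * F)(x)` as a linear form. -/
def convLin (m : MIdx d) (x : Space d) : SmoothFun d →ₗ[ℝ] ℝ where
  toFun F := K.conv m F x
  map_add' F G := by
    have h := fun F : SmoothFun d =>
      K.integrable_mul (SmoothFun.contDiff (SmoothFun.D m F)).continuous x
    simp only [conv]
    rw [← MeasureTheory.integral_add (h F) (h G), map_add]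
    refine MeasureTheory.integral_congr_ae (Filter.Eventually.of_forall fun y => ?_)
    exact mul_add _ _ _
  map_smul' c F := by
    simp only [conv, RingHom.id_apply, smul_eq_mul]
    rw [← MeasureTheory.integral_const_mul, map_smul]
    refine MeasureTheory.integral_congr_ae (Filter.Eventually.of_forall fun y => ?_)
    exact mul_left_comm _ _ _

theorem convLin_apply (m : MIdx d) (x : Space d) (F : SmoothFun d) :
    K.convLin m x F = K.conv m F x := rfl

theorem continuous_conv (m : MIdx d) (F : SmoothFun d) : Continuous (K.conv m F) :=
  K.continuous_integral_mul (SmoothFun.contDiff (SmoothFun.D m F)).continuous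

end Kernel

/-! ### Recentring as a continuous family -/

variable {R : Rule d} (K : Kernel d) (P : modelSpace R →ₗ[ℝ] SmoothFun d)
  {Y : Type*} [TopologicalSpace Y]

theorem continuous_conv_of_mem_contFam {x : Y → Space d} (hx : Continuous x)
    (Q : TreeAlg d →ₗ[ℝ] SmoothFun d) (m : MIdx d) {D : Set (Tree d)} {v : Y → TreeAlg d}
    (hv : v ∈ contFam Y D) : Continuous fun y => K.conv m (Q (v y)) (x y) :=
  continuous_of_mem_contFam (fun y => K.convLin m (x y) ∘ₗ Q)
    (fun σ _ => (K.continuous_conv m (Q (TreeAlg.of σ))).comp hx) hv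

theorem continuous_posVal {x : Y → Space d} (hx : Continuous x) (n : MIdx d) (τ : Tree d)
    {D : Set (Tree d)} {v : Y → TreeAlg d} (hv : v ∈ contFam Y D) :
    Continuous fun y => posVal S K P (x y) n τ (v y) := by
  unfold posVal
  refine (continuous_finsetSum _ fun l _ => Continuous.mul (continuous_finsetProd _ fun i _ => ?_)
    (continuous_conv_of_mem_contFam K hx (extendZero P) _ hv)).neg
  fun_prop

/-- The trees whose edges at the root are among those of `τ` and all of whose other nodes comply
with the rule. -/
def branches (R₀ : Rule d) (τ : Tree d) : Set (Tree d) :=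
  {σ | σ.rootEdges ≤ τ.rootEdges ∧ ∀ N ∈ σ.upperNodes, N ∈ R₀}

theorem mul_mem_branches {R₀ : Rule d} {σ σ' τ τ' : Tree d} (h : σ ∈ branches R₀ τ)
    (h' : σ' ∈ branches R₀ τ') : σ * σ' ∈ branches R₀ (τ * τ') := by
  refine ⟨?_, fun N hN => ?_⟩
  · rw [Tree.rootEdges_mul, Tree.rootEdges_mul]
    exact add_le_add h.1 h'.1
  · rw [Tree.upperNodes_mul, Multiset.mem_add] at hN
    exact hN.elim (h.2 N) (h'.2 N)

theorem X_mem_branches (R₀ : Rule d) (k : MIdx d) (τ : Tree d) : Tree.X k ∈ branches R₀ τ :=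
  ⟨by rw [Tree.rootEdges_X]; exact Multiset.zero_le _, by simp [Tree.upperNodes_X]⟩

/-- Planting makes the root of σ an inner node, so its edges become subject to the rule; normality
covers the case in which some were lost. -/
theorem I_mem_branches {R₀ : Rule d} (hR₀ : R₀.IsNormal) {m : MIdx d} {σ τ : Tree d}
    (hτ : τ.rootEdges ∈ R₀) (h : σ ∈ branches R₀ τ) : Tree.I m σ ∈ branches R₀ (Tree.I m τ) := by
  refine ⟨by rw [Tree.rootEdges_I, Tree.rootEdges_I], fun N hN => ?_⟩
  rw [Tree.upperNodes_I, Multiset.mem_add, Multiset.mem_singleton] at hN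
  rcases hN with rfl | hN
  · exact hR₀ _ _ h.1 hτ
  · exact h.2 N hN

theorem conforms_of_mem_branches {R₀ : Rule d} (hR₀ : R₀.IsNormal) {σ τ : Tree d}
    (hτ : R₀.Conforms τ) (h : σ ∈ branches R₀ τ) : R₀.Conforms σ :=
  ⟨hR₀ _ _ h.1 hτ.1, h.2⟩

theorem Xdiv_mem_treeSpan {D : Set (Tree d)} {k : MIdx d} (h : Tree.X k ∈ D) :
    TreeAlg.Xdiv k ∈ treeSpan D := Submodule.smul_mem _ _ (of_mem_treeSpan h)

/-- With the trivial rule, continuity of coefficients becomes available for every tree. -/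
theorem univ_isNormal : Rule.IsNormal (Set.univ : Rule d) := fun _ _ _ _ => trivial

/-- Recentring a planted tree either keeps its edge and recentres the branch, or replaces the whole
by a monomial, so edges at a node can only be lost. The new coefficients are convolutions of the
recentred branch, already a continuous family, evaluated at a continuous point. -/
theorem recentre_mem_contFam {R₀ : Rule d} (hR₀ : R₀.IsNormal) {x : Y → Space d}
    (hx : Continuous x) (τ : Tree d) (hτ : ∀ N ∈ τ.upperNodes, N ∈ R₀) :
    (fun y => recentre S K P (x y) (TreeAlg.of τ)) ∈ contFam Y (branches R₀ τ) := by
  induction τ using Tree.mul_induction with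
  | h1 =>
    simp only [TreeAlg.of_one, map_one]
    rw [← TreeAlg.of_one]
    exact const_mem_contFam (of_mem_treeSpan (X_mem_branches _ 0 _))
  | hmul s t hs ht =>
    simp only [Tree.upperNodes_mul, Multiset.mem_add] at hτ
    simp only [TreeAlg.of_mul, map_mul]
    exact mul_mem_contFam (fun _ h _ h' => mul_mem_branches h h')
      (hs fun N hN => hτ N (.inl hN)) (ht fun N hN => hτ N (.inr hN))
  | hX i =>
    simp only [recentre_Xsingle, Algebra.algebraMap_eq_smul_one]
    rw [← TreeAlg.of_one]
    exact Submodule.sub_mem _ (const_mem_contFam (of_mem_treeSpan (X_mem_branches _ _ _)))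
      (smul_of_mem_contFam (by fun_prop) (X_mem_branches _ 0 _))
  | hXi l =>
    simp only [recentre_Xi]
    exact const_mem_contFam (of_mem_treeSpan ⟨le_rfl, hτ⟩)
  | hI m s hs =>
    simp only [Tree.upperNodes_I, Multiset.mem_add, Multiset.mem_singleton] at hτ
    have ih := hs fun N hN => hτ N (.inr hN)
    simp only [recentre_I_of, polyPart, ← recentre_of]
    refine Submodule.add_mem _ (contFam_bind' (fun _ => TreeAlg.I m) (fun σ hσ => ?_) ih) ?_
    · simp only [← I_of]
      exact const_mem_contFam (of_mem_treeSpan (I_mem_branches hR₀ (hτ _ (.inl rfl)) hσ))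
    · have : (fun y => ∑ k ∈ S.below (S.deg (Tree.I m s)), posVal S K P (x y) (m + k) s
          (recentre S K P (x y) (TreeAlg.of s)) • TreeAlg.Xdiv (d := d) k) =
          ∑ k ∈ S.below (S.deg (Tree.I m s)), fun y => posVal S K P (x y) (m + k) s
          (recentre S K P (x y) (TreeAlg.of s)) • TreeAlg.Xdiv k := by
        funext y; simp
      rw [this]
      exact Submodule.sum_mem _ fun k _ => smul_mem_contFam (continuous_posVal K P hx _ _ ih)
        (const_mem_contFam (Xdiv_mem_treeSpan (X_mem_branches _ _ _)))

/-! ### Translation of monomials and the inverse recentring. -/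

theorem dpow_X_add (c : Fin d → ℝ) (k : MIdx d) :
    dpow (fun i => TreeAlg.of (Tree.X (Pi.single i 1)) + algebraMap ℝ (TreeAlg d) (c i)) k =
      ∑ e ∈ MIdx.lower k, dpow c (k - e) • TreeAlg.Xdiv e := by
  rw [dpow_add]
  refine Finset.sum_congr rfl fun e _ => ?_
  rw [← Xdiv_eq_dpow, Algebra.smul_def, mul_comm]
  congr 1
  exact (map_dpow (Algebra.ofId ℝ (TreeAlg d)) c (k - e)).symm

theorem continuous_dpow {c : Y → Fin d → ℝ} (hc : ∀ i, Continuous fun y => c y i) (k : MIdx d) :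
    Continuous fun y => dpow (c y) k :=
  continuous_const.mul (continuous_finsetProd _ fun i _ => (hc i).pow _)

theorem shiftX_eq (x : Space d) (k : MIdx d) :
    shiftX x k = ∑ e ∈ MIdx.lower k, dpow (fun i => x i) (k - e) • TreeAlg.Xdiv e :=
  dpow_X_add (fun i => x i) k

theorem shiftX_mem_contFam {D : Set (Tree d)} (hD : ∀ k, Tree.X k ∈ D) {x : Y → Space d}
    (hx : Continuous x) (k : MIdx d) : (fun y => shiftX (x y) k) ∈ contFam Y D := by
  have : (fun y => shiftX (x y) k) = ∑ e ∈ MIdx.lower k,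
      fun y => dpow (fun i => x y i) (k - e) • TreeAlg.Xdiv e := by
    funext y; simp [shiftX_eq]
  rw [this]
  refine Submodule.sum_mem _ fun e _ => smul_mem_contFam ?_
    (const_mem_contFam (Xdiv_mem_treeSpan (hD e)))
  exact continuous_dpow (c := fun y i => x y i) (fun i => by fun_prop) _

theorem recentreInv_Xi (x : Space d) (l : MIdx d) :
    recentreInv S K P x (TreeAlg.of (Tree.Xi l)) = TreeAlg.of (Tree.Xi l) := by
  rw [recentreInv, TreeAlg.algExt_of, Tree.fold_Xi]

theorem recentreInv_mem_contFam {R₀ : Rule d} (hR₀ : R₀.IsNormal) {x : Y → Space d}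
    (hx : Continuous x) (τ : Tree d) (hτ : ∀ N ∈ τ.upperNodes, N ∈ R₀) :
    (fun y => recentreInv S K P (x y) (TreeAlg.of τ)) ∈ contFam Y (branches R₀ τ) := by
  induction τ using Tree.mul_induction with
  | h1 =>
    simp only [TreeAlg.of_one, map_one]
    rw [← TreeAlg.of_one]
    exact const_mem_contFam (of_mem_treeSpan (X_mem_branches _ 0 _))
  | hmul s t hs ht =>
    simp only [Tree.upperNodes_mul, Multiset.mem_add] at hτ
    simp only [TreeAlg.of_mul, map_mul]
    exact mul_mem_contFam (fun _ h _ h' => mul_mem_branches h h')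
      (hs fun N hN => hτ N (.inl hN)) (ht fun N hN => hτ N (.inr hN))
  | hX i =>
    simp only [recentreInv_Xsingle, Algebra.algebraMap_eq_smul_one]
    rw [← TreeAlg.of_one]
    exact Submodule.add_mem _ (const_mem_contFam (of_mem_treeSpan (X_mem_branches _ _ _)))
      (smul_of_mem_contFam (by fun_prop) (X_mem_branches _ 0 _))
  | hXi l =>
    simp only [recentreInv_Xi]
    exact const_mem_contFam (of_mem_treeSpan ⟨le_rfl, hτ⟩)
  | hI m s hs =>
    simp only [Tree.upperNodes_I, Multiset.mem_add, Multiset.mem_singleton] at hτ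
    have ih := hs fun N hN => hτ N (.inr hN)
    simp only [I_of, recentreInv_I, recentreInv_polyPart, ← recentre_of]
    refine Submodule.sub_mem _ (contFam_bind' (fun _ => TreeAlg.I m) (fun σ hσ => ?_) ih)
      (contFam_bind' (fun y => TreeAlg.linExt _) (fun σ _ => ?_) ih)
    · simp only [← I_of]
      exact const_mem_contFam (of_mem_treeSpan (I_mem_branches hR₀ (hτ _ (.inl rfl)) hσ))
    · have : (fun y => ∑ k ∈ S.below (S.deg (Tree.I m σ)), posVal S K P (x y) (m + k) σ
          (recentre S K P (x y) (TreeAlg.of σ)) • shiftX (x y) k) =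
          ∑ k ∈ S.below (S.deg (Tree.I m σ)), fun y => posVal S K P (x y) (m + k) σ
          (recentre S K P (x y) (TreeAlg.of σ)) • shiftX (x y) k := by
        funext y; simp
      simp only [TreeAlg.linExt_of]
      rw [this]
      -- Only continuity of the coefficient matters here, so the trivial rule suffices for F_x σ.
      exact Submodule.sum_mem _ fun k _ => smul_mem_contFam
        (continuous_posVal K P hx _ _ (recentre_mem_contFam K P univ_isNormal hx σ
          fun _ _ => trivial))
        (shiftX_mem_contFam (fun k => X_mem_branches _ k _) hx k)

end

section

variable {d : ℕ} {S : Scaling d}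

/-! ### The renormalised recentring in terms of the original one -/

/-! ### Recentring expressed by Taylor polynomials. -/

section Taylor

variable {R : Rule d} (K : Kernel d) (P : modelSpace R →ₗ[ℝ] SmoothFun d)

theorem recentre_recentreInv (x : Space d) (v : TreeAlg d) :
    recentre S K P x (recentreInv S K P x v) = v := by
  refine algHom_eq_id (φ := (recentre S K P x).comp (recentreInv S K P x)) ?_ ?_ ?_ v
  · intro i
    rw [AlgHom.comp_apply, recentreInv_Xsingle, map_add, recentre_Xsingle, AlgHom.commutes,
      sub_add_cancel]
  · intro l
    rw [AlgHom.comp_apply, recentreInv_Xi, recentre_Xi]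
  · intro m t ht
    rw [AlgHom.comp_apply] at ht
    rw [AlgHom.comp_apply, recentreInv_I, map_sub, recentre_I, ht,
      recentre_recentreInv_polyPart, add_sub_cancel_right]

theorem GamXY_eq (x y : Space d) (v : TreeAlg d) :
    GamXY S K P x y v = recentreInv S K P x (recentre S K P y v) := by
  rw [GamXY, LinearMap.comp_apply]
  refine (LinearEquiv.symm_apply_eq _).2 ?_
  exact (recentre_recentreInv K P x _).symm

/-- The Taylor polynomial `∑_{|p|_𝔰 < c} (D^{m+p} K * F)(x) X^p/p!`. -/
def taylor (S : Scaling d) (x : Space d) (m : MIdx d) (c : ℝ) : SmoothFun d →ₗ[ℝ] TreeAlg d :=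
  ∑ p ∈ S.below c, (K.convLin (m + p) x).smulRight (TreeAlg.Xdiv p)

theorem taylor_apply (x : Space d) (m : MIdx d) (c : ℝ) (F : SmoothFun d) :
    taylor K S x m c F = ∑ p ∈ S.below c, K.conv (m + p) F x • TreeAlg.Xdiv p := by
  simp [taylor, LinearMap.sum_apply, Kernel.convLin_apply]

theorem recentre_Xdiv (x : Space d) (k : MIdx d) : recentre S K P x (TreeAlg.Xdiv k) =
    ∑ e ∈ MIdx.lower k, dpow (fun i => -x i) (k - e) • TreeAlg.Xdiv e := by
  rw [Xdiv_eq_dpow, map_dpow, ← dpow_X_add]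
  simp only [recentre_Xsingle, map_neg, sub_eq_add_neg]

/-- On polynomials every recentring is the translation X ↦ X - x, whichever map it is built from. -/
theorem recentre_taylor {R' : Rule d} (P' : modelSpace R' →ₗ[ℝ] SmoothFun d) (x : Space d)
    (m : MIdx d) (c : ℝ) (F : SmoothFun d) :
    recentre S K P x (taylor K S x m c F) = recentre S K P' x (taylor K S x m c F) := by
  simp only [taylor_apply, map_sum, map_smul, recentre_Xdiv]

theorem outerMap_recentre_taylor (g : NegChar S R) {R' : Rule d}
    (P' : modelSpace R' →ₗ[ℝ] SmoothFun d) (x : Space d) (m : MIdx d) (c : ℝ)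
    (F : SmoothFun d) :
    outerMap g (recentre S K P' x (taylor K S x m c F)) =
      recentre S K P x (taylor K S x m c F) := by
  simp only [taylor_apply, map_sum, map_smul, recentre_Xdiv, outerMap_Xdiv]

/-- The double sum over k and ℓ in the definition of f_x is the binomial expansion of (X - x)^p/p!
with p = k + ℓ, truncated at |p|_𝔰 < |𝓘_m τ|_𝔰; and X - x is F_x X. -/
theorem polyPart_eq (x : Space d) (m : MIdx d) (τ : Tree d) : polyPart S K P x m τ =
    -recentre S K P x (taylor K S x m (S.deg (Tree.I m τ))
      (extendZero P (recentre S K P x (TreeAlg.of τ)))) := by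
  have hc : ∀ e, S.deg (Tree.I m τ) - S.midx e = S.deg (Tree.I (m + e) τ) := fun e => by
    rw [S.deg_I, S.deg_I, S.midx_add]; ring
  have := sum_below_lower S (S.deg (Tree.I m τ)) fun e j =>
    (dpow (fun i => -x i) j * K.conv (m + e + j)
      (extendZero P (recentre S K P x (TreeAlg.of τ))) x) • TreeAlg.Xdiv (d := d) e
  simp only [hc] at this
  rw [taylor_apply, map_sum]
  have e1 : ∀ k : MIdx d, recentre S K P x (K.conv (m + k)
      (extendZero P (recentre S K P x (TreeAlg.of τ))) x • TreeAlg.Xdiv k) =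
      ∑ e ∈ MIdx.lower k, (dpow (fun i => -x i) (k - e) * K.conv (m + e + (k - e))
      (extendZero P (recentre S K P x (TreeAlg.of τ))) x) • TreeAlg.Xdiv e := by
    intro k
    rw [map_smul, recentre_Xdiv, Finset.smul_sum]
    refine Finset.sum_congr rfl fun e he => ?_
    rw [add_assoc, add_tsub_cancel_of_le (MIdx.mem_lower.1 he), smul_smul, mul_comm]
  rw [Finset.sum_congr rfl fun k _ => e1 k, this, polyPart, ← Finset.sum_neg_distrib]
  refine Finset.sum_congr rfl fun e _ => ?_
  rw [← Finset.sum_smul, posVal, ← recentre_of, ← neg_smul]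
  congr 2
  refine Finset.sum_congr rfl fun l _ => ?_
  congr 1
  rw [dpow_eq_prod]
  refine Finset.prod_congr rfl fun i _ => ?_
  rw [smul_eq_mul, div_eq_inv_mul]

/-- A linear map on `𝓥`, seen as a linear map on the model space of the trivial rule. -/
def fullMap (L : TreeAlg d →ₗ[ℝ] SmoothFun d) :
    modelSpace (Set.univ : Rule d) →ₗ[ℝ] SmoothFun d := L ∘ₗ (modelSpace Set.univ).subtype

theorem extendZero_fullMap (L : TreeAlg d →ₗ[ℝ] SmoothFun d) (v : TreeAlg d) :
    extendZero (fullMap L) v = L v := by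
  have h : extendZero (fullMap L) = L := by
    apply TreeAlg.lin_ext
    intro τ
    have hτ : Rule.Conforms (Set.univ : Rule d) τ := ⟨trivial, fun _ _ => trivial⟩
    rw [extendZero, TreeAlg.linExt_of, dif_pos hτ]
    rfl
  rw [h]

end Taylor

/-! ### The operator relating the two recentrings. -/

section Transfer

variable {R : Rule d} (K : Kernel d) (P : modelSpace R →ₗ[ℝ] SmoothFun d) (g : NegChar S R)

/-- The renormalised map, defined on all trees. -/
def renormFull : modelSpace (Set.univ : Rule d) →ₗ[ℝ] SmoothFun d :=
  fullMap (extendZero P ∘ₗ renormMap g)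

/-- The map `N_x` with `F_x N_x = M F_x^g`, where `M` is the renormalisation map and `F_x^g` the
recentring for the renormalised map. -/
def transfer (x : Space d) : TreeAlg d →ₗ[ℝ] TreeAlg d :=
  (recentreInv S K P x).toLinearMap ∘ₗ renormMap g ∘ₗ
    (recentre S K (renormFull P g) x).toLinearMap

theorem recentre_transfer (x : Space d) (v : TreeAlg d) :
    recentre S K P x (transfer K P g x v) =
      renormMap g (recentre S K (renormFull P g) x v) :=
  recentre_recentreInv K P x _

/-- The difference of two Taylor polynomials of `K * Π_x σ`. -/
def taylorGap (S : Scaling d) (x : Space d) (m : MIdx d) (c : ℝ) (σ : Tree d) : TreeAlg d :=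
  taylor K S x m (S.deg (Tree.I m σ)) (extendZero P (recentre S K P x (TreeAlg.of σ))) -
    taylor K S x m c (extendZero P (recentre S K P x (TreeAlg.of σ)))

/-- The multiplicative part of `transfer`. -/
def innerTransfer (x : Space d) : TreeAlg d →ₐ[ℝ] TreeAlg d :=
  TreeAlg.algExt (Tree.fold (fun i => TreeAlg.of (Tree.X (Pi.single i 1)))
    (fun l => TreeAlg.of (Tree.Xi l))
    (fun m τ _ => TreeAlg.I m (transfer K P g x (TreeAlg.of τ)) +
      TreeAlg.linExt (taylorGap K P S x m (S.deg (Tree.I m τ))) (transfer K P g x (TreeAlg.of τ))))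

theorem innerTransfer_X (x : Space d) (i : Fin d) :
    innerTransfer K P g x (TreeAlg.of (Tree.X (Pi.single i 1))) =
      TreeAlg.of (Tree.X (Pi.single i 1)) := by
  rw [innerTransfer, TreeAlg.algExt_of, Tree.fold_X_single]

theorem innerTransfer_Xi (x : Space d) (l : MIdx d) :
    innerTransfer K P g x (TreeAlg.of (Tree.Xi l)) = TreeAlg.of (Tree.Xi l) := by
  rw [innerTransfer, TreeAlg.algExt_of, Tree.fold_Xi]

theorem innerTransfer_I (x : Space d) (m : MIdx d) (τ : Tree d) :
    innerTransfer K P g x (TreeAlg.of (Tree.I m τ)) =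
      TreeAlg.I m (transfer K P g x (TreeAlg.of τ)) +
      TreeAlg.linExt (taylorGap K P S x m (S.deg (Tree.I m τ)))
        (transfer K P g x (TreeAlg.of τ)) := by
  rw [innerTransfer, TreeAlg.algExt_of, Tree.fold_I]

/-- Of the two Taylor polynomials, the one with order adapted to each tree reproduces `polyPart` by
`polyPart_eq`; the one of fixed order `c` depends on `v` only through Π_x `v`. -/
theorem recentre_linExt_taylorGap (x : Space d) (m : MIdx d) (c : ℝ) (v : TreeAlg d) :
    recentre S K P x (TreeAlg.linExt (taylorGap K P S x m c) v) =
      -TreeAlg.linExt (polyPart S K P x m) v -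
        recentre S K P x (taylor K S x m c (extendZero P (recentre S K P x v))) := by
  have h : (recentre S K P x).toLinearMap ∘ₗ TreeAlg.linExt (taylorGap K P S x m c) =
      -TreeAlg.linExt (polyPart S K P x m) - (recentre S K P x).toLinearMap ∘ₗ
        taylor K S x m c ∘ₗ extendZero P ∘ₗ (recentre S K P x).toLinearMap := by
    apply TreeAlg.lin_ext
    intro τ
    simp only [LinearMap.comp_apply, LinearMap.sub_apply, LinearMap.neg_apply, TreeAlg.linExt_of,
      AlgHom.toLinearMap_apply, taylorGap, polyPart_eq, map_sub, neg_neg]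
  exact LinearMap.congr_fun h v

/-- All maps are multiplicative, so planted trees decide. There the renormalised side truncates the
Taylor polynomial at |𝓘_m τ|_𝔰, while F_x𝓘_m N_x τ truncates it at |𝓘_m σ|_𝔰 for each σ in N_x τ;
`taylorGap` is the discrepancy. -/
theorem recentre_innerTransfer (x : Space d) (v : TreeAlg d) :
    recentre S K P x (innerTransfer K P g x v) =
      outerMap g (recentre S K (renormFull P g) x v) := by
  have h : ((recentre S K P x).comp (innerTransfer K P g x)).toLinearMap =
      ((outerMap g).comp (recentre S K (renormFull P g) x)).toLinearMap := by
    apply TreeAlg.lin_ext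
    intro τ
    refine Tree.hom_congr
      (φ := ((recentre S K P x).comp (innerTransfer K P g x) : TreeAlg d →* TreeAlg d).comp TreeAlg.ofHom)
      (ψ := ((outerMap g).comp (recentre S K (renormFull P g) x) : TreeAlg d →* TreeAlg d).comp
        TreeAlg.ofHom) ?_ ?_ ?_ τ
    · intro i
      change recentre S K P x (innerTransfer K P g x (TreeAlg.of _)) =
        outerMap g (recentre S K (renormFull P g) x (TreeAlg.of _))
      rw [innerTransfer_X, recentre_Xsingle, recentre_Xsingle, map_sub, outerMap_Xsingle,
        AlgHom.commutes]
    · intro l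
      change recentre S K P x (innerTransfer K P g x (TreeAlg.of _)) =
        outerMap g (recentre S K (renormFull P g) x (TreeAlg.of _))
      rw [innerTransfer_Xi, recentre_Xi, recentre_Xi, outerMap_Xi]
    · intro m t _
      change recentre S K P x (innerTransfer K P g x (TreeAlg.of _)) =
        outerMap g (recentre S K (renormFull P g) x (TreeAlg.of _))
      -- This is Π_x^g = Π_x N_x: both Taylor polynomials expand the same function.
      have hQ : extendZero (renormFull P g) (recentre S K (renormFull P g) x (TreeAlg.of t)) =
          extendZero P (recentre S K P x (transfer K P g x (TreeAlg.of t))) := by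
        rw [recentre_transfer, renormFull, extendZero_fullMap]
        rfl
      rw [innerTransfer_I, map_add, recentre_I, recentre_linExt_taylorGap, recentre_I_of,
        polyPart_eq, map_add, outerMap_I, ← recentre_transfer, map_neg, hQ,
        outerMap_recentre_taylor K P g]
      abel
  exact LinearMap.congr_fun h v

/-- Apply the injective F_x and use M = M°(id + ρ); ρ passes through F_x^g, since extraction at the
root commutes with the recentring of any map, in particular the renormalised one. -/
theorem transfer_eq (x : Space d) (v : TreeAlg d) :
    transfer K P g x v = innerTransfer K P g x (v + rootExtract g v) := by
  apply (recentre_bijective S K P x).1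
  change recentre S K P x _ = recentre S K P x _
  rw [recentre_transfer, recentre_innerTransfer, renormMap_eq, map_add, map_add,
    rootExtract_recentre, map_add]

/-! ### Triangularity for degree and number of edges, and inversion. -/

/-- The trees of degree at least `|τ|_𝔰` with fewer edges than `τ`. -/
def above (S : Scaling d) (τ : Tree d) : Set (Tree d) :=
  {σ | S.deg τ ≤ S.deg σ ∧ σ.edges < τ.edges}

/-- The trees of degree at least `|τ|_𝔰` with at most as many edges as `τ`. -/
def aboveEq (S : Scaling d) (τ : Tree d) : Set (Tree d) :=
  {σ | S.deg τ ≤ S.deg σ ∧ σ.edges ≤ τ.edges}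

theorem above_subset_aboveEq (τ : Tree d) : above S τ ⊆ aboveEq S τ := fun _ h => ⟨h.1, h.2.le⟩

theorem mem_aboveEq_of_sub_mem {τ : Tree d} {v : Space d → TreeAlg d}
    (h : (fun x => v x - TreeAlg.of τ) ∈ contFam (Space d) (above S τ)) :
    v ∈ contFam (Space d) (aboveEq S τ) := by
  have e : v = (fun x => v x - TreeAlg.of τ) + fun _ => TreeAlg.of τ := by
    funext x; simp
  rw [e]
  exact Submodule.add_mem _ (contFam_mono (above_subset_aboveEq τ) h)
    (const_mem_contFam (of_mem_treeSpan ⟨le_rfl, le_rfl⟩))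

/-- Because σ has at least the degree of τ, the shorter Taylor polynomial is contained in the longer
one. What is left are monomials of degree at least |𝓘_m τ|_𝔰, which have no edges. -/
theorem taylorGap_mem {m : MIdx d} {σ τ : Tree d} (h : S.deg τ ≤ S.deg σ) :
    (fun x => taylorGap K P S x m (S.deg (Tree.I m τ)) σ) ∈
      contFam (Space d) (above S (Tree.I m τ)) := by
  classical
  have hs : S.below (S.deg (Tree.I m τ)) ⊆ S.below (S.deg (Tree.I m σ)) := fun e he => by
    rw [S.mem_below, S.deg_I] at he ⊢
    linarith
  have e : (fun x => taylorGap K P S x m (S.deg (Tree.I m τ)) σ) =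
      ∑ p ∈ S.below (S.deg (Tree.I m σ)) \ S.below (S.deg (Tree.I m τ)), fun x =>
        K.conv (m + p) (extendZero P (recentre S K P x (TreeAlg.of σ))) x • TreeAlg.Xdiv p := by
    funext x
    rw [taylorGap, taylor_apply, taylor_apply, ← Finset.sum_sdiff hs, add_sub_cancel_right,
      Finset.sum_apply]
  rw [e]
  refine Submodule.sum_mem _ fun p hp => smul_mem_contFam ?_
    (const_mem_contFam (Xdiv_mem_treeSpan ⟨?_, ?_⟩))
  · exact continuous_conv_of_mem_contFam K continuous_id _ _
      (recentre_mem_contFam K P univ_isNormal continuous_id σ fun _ _ => trivial)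
  · rw [Finset.mem_sdiff, S.mem_below, S.mem_below] at hp
    rw [S.deg_X]
    exact not_lt.1 hp.2
  · rw [Tree.edges_X, Tree.edges_I]
    omega

/-- Only branches of planted trees call the hypothesis on `transfer`, and a branch has fewer edges
than its planted tree; hence `n` itself is allowed in the conclusion. -/
theorem innerTransfer_sub_mem {n : ℕ} (hn : ∀ σ : Tree d, σ.edges < n →
      (fun x => transfer K P g x (TreeAlg.of σ) - TreeAlg.of σ) ∈ contFam (Space d) (above S σ))
    (τ : Tree d) (hτ : τ.edges ≤ n) :
    (fun x => innerTransfer K P g x (TreeAlg.of τ) - TreeAlg.of τ) ∈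
      contFam (Space d) (above S τ) := by
  induction τ using Tree.mul_induction with
  | h1 =>
    simp only [TreeAlg.of_one, map_one, sub_self]
    exact Submodule.zero_mem _
  | hmul s t hs ht =>
    rw [Tree.edges_mul] at hτ
    have hs := hs (by omega)
    have ht := ht (by omega)
    have e : (fun x => innerTransfer K P g x (TreeAlg.of (s * t)) - TreeAlg.of (s * t)) =
        (fun x => (innerTransfer K P g x (TreeAlg.of s) - TreeAlg.of s) *
          innerTransfer K P g x (TreeAlg.of t)) +
        fun x => TreeAlg.of s * (innerTransfer K P g x (TreeAlg.of t) - TreeAlg.of t) := by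
      funext x
      simp only [Pi.add_apply, TreeAlg.of_mul, map_mul]
      ring
    rw [e]
    refine Submodule.add_mem _ (mul_mem_contFam ?_ hs (mem_aboveEq_of_sub_mem ht))
      (mul_mem_contFam ?_ (const_mem_contFam (of_mem_treeSpan (Set.mem_singleton s))) ht)
    · rintro σ ⟨h1, h2⟩ ρ ⟨h3, h4⟩
      exact ⟨by rw [S.deg_mul, S.deg_mul]; linarith,
        by rw [Tree.edges_mul, Tree.edges_mul]; omega⟩
    · rintro _ rfl ρ ⟨h3, h4⟩
      exact ⟨by rw [S.deg_mul, S.deg_mul]; linarith,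
        by rw [Tree.edges_mul, Tree.edges_mul]; omega⟩
  | hX i =>
    simp only [innerTransfer_X, sub_self]
    exact Submodule.zero_mem _
  | hXi l =>
    simp only [innerTransfer_Xi, sub_self]
    exact Submodule.zero_mem _
  | hI m s _ =>
    rw [Tree.edges_I] at hτ
    have hs := hn s (by omega)
    have e : (fun x => innerTransfer K P g x (TreeAlg.of (Tree.I m s)) -
          TreeAlg.of (Tree.I m s)) =
        (fun x => TreeAlg.I m (transfer K P g x (TreeAlg.of s) - TreeAlg.of s)) +
        fun x => TreeAlg.linExt (taylorGap K P S x m (S.deg (Tree.I m s)))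
          (transfer K P g x (TreeAlg.of s)) := by
      funext x
      simp only [Pi.add_apply, innerTransfer_I, map_sub, ← I_of]
      abel
    rw [e]
    refine Submodule.add_mem _ (contFam_bind' (fun _ => TreeAlg.I m) (fun σ hσ => ?_) hs)
      (contFam_bind' (fun x => TreeAlg.linExt (taylorGap K P S x m (S.deg (Tree.I m s))))
        (fun σ hσ => ?_) (mem_aboveEq_of_sub_mem hs))
    · simp only [← I_of]
      refine const_mem_contFam (of_mem_treeSpan ⟨?_, ?_⟩)
      · rw [S.deg_I, S.deg_I]; linarith [hσ.1]
      · rw [Tree.edges_I, Tree.edges_I]; have := hσ.2; omega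
    · simp only [TreeAlg.linExt_of]
      exact taylorGap_mem K P hσ.1

/-- In N_x = N_x°(id + ρ) the term N_x°ρτ is harmless, since ρ already raises the degree and drops
an edge, while N_x°τ - τ involves N_x on smaller trees only. -/
theorem transfer_sub_mem (τ : Tree d) :
    (fun x => transfer K P g x (TreeAlg.of τ) - TreeAlg.of τ) ∈
      contFam (Space d) (above S τ) := by
  induction hn : τ.edges using Nat.strong_induction_on generalizing τ with
  | _ n ih =>
    have hin := innerTransfer_sub_mem K P g (n := n) fun σ hσ => ih _ hσ σ rfl
    have e : (fun x => transfer K P g x (TreeAlg.of τ) - TreeAlg.of τ) =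
        (fun x => innerTransfer K P g x (TreeAlg.of τ) - TreeAlg.of τ) +
        fun x => innerTransfer K P g x (rootExtract g (TreeAlg.of τ)) := by
      funext x
      rw [Pi.add_apply, transfer_eq, map_add]
      abel
    rw [e]
    refine Submodule.add_mem _ (hin τ hn.le)
      (contFam_bind' (fun x => (innerTransfer K P g x).toLinearMap) (fun σ hσ => ?_)
        (const_mem_contFam (rootExtract_mem g τ)))
    have hsub : aboveEq S σ ⊆ above S τ := fun ρ hρ => ⟨hσ.1.trans hρ.1, hρ.2.trans_lt hσ.2⟩
    refine contFam_mono hsub (mem_aboveEq_of_sub_mem (hin σ ?_))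
    have := hσ.2
    omega

theorem transfer_mem (τ : Tree d) :
    (fun x => transfer K P g x (TreeAlg.of τ)) ∈ contFam (Space d) {σ | S.deg τ ≤ S.deg σ} :=
  contFam_mono (fun _ h => h.1) (mem_aboveEq_of_sub_mem (transfer_sub_mem K P g τ))

/-- If N_x v = 0 then v = -(N_x - id)v, which has fewer edges than v; repeating this exhausts v. -/
theorem transfer_injective (x : Space d) : Function.Injective (transfer K P g x) := by
  have key : ∀ n : ℕ, ∀ v ∈ treeSpan {σ : Tree d | σ.edges < n},
      transfer K P g x v = 0 → v = 0 := by
    intro n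
    induction n with
    | zero => intro v hv _; simpa [treeSpan] using hv
    | succ n ih =>
      intro v hv h0
      refine ih v ?_ h0
      have := map_mem_of_mem_treeSpan (transfer K P g x - LinearMap.id)
        (N := treeSpan {σ : Tree d | σ.edges < n}) (fun σ hσ => ?_) hv
      · rw [LinearMap.sub_apply, h0, zero_sub, LinearMap.id_apply] at this
        simpa using Submodule.neg_mem _ this
      · refine treeSpan_mono (fun ρ hρ => ?_)
          (mem_treeSpan_of_mem_contFam (transfer_sub_mem K P g σ) x)
        exact hρ.2.trans_le (Nat.lt_succ_iff.1 hσ)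
  refine (injective_iff_map_eq_zero _).2 fun v hv => ?_
  refine key ((TreeAlg.coeff v).support.sup Tree.edges + 1) v ?_ hv
  exact mem_treeSpan_of_support fun σ hσ => Nat.lt_succ_iff.2 (Finset.le_sup hσ)

/-- The recursion N_x⁻¹τ = τ - N_x⁻¹(N_x τ - τ) descends in the number of edges and preserves both
continuity in x and the lower bound on degrees. -/
theorem exists_transfer_eq (τ : Tree d) :
    ∃ w ∈ contFam (Space d) {σ | S.deg τ ≤ S.deg σ}, ∀ x, transfer K P g x (w x) =
      TreeAlg.of τ := by
  induction hn : τ.edges using Nat.strong_induction_on generalizing τ with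
  | _ n ih =>
    have key : ∀ v ∈ contFam (Space d) (above S τ),
        ∃ w ∈ contFam (Space d) {σ | S.deg τ ≤ S.deg σ}, ∀ x, transfer K P g x (w x) = v x := by
      intro v hv
      induction hv using Submodule.span_induction with
      | mem v hv =>
        obtain ⟨a, ha, σ, hσ, rfl⟩ := hv
        obtain ⟨w, hw, hw'⟩ := ih σ.edges (hn ▸ hσ.2) σ rfl
        refine ⟨fun x => a x • w x, smul_mem_contFam ha
          (contFam_mono (fun ρ hρ => le_trans hσ.1 hρ) hw), fun x => ?_⟩
        rw [map_smul, hw']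
      | zero => exact ⟨0, Submodule.zero_mem _, fun x => by simp⟩
      | add u v _ _ hu hv =>
        obtain ⟨w, hw, hw'⟩ := hu
        obtain ⟨z, hz, hz'⟩ := hv
        exact ⟨w + z, Submodule.add_mem _ hw hz, fun x => by simp [hw', hz']⟩
      | smul c u _ hu =>
        obtain ⟨w, hw, hw'⟩ := hu
        exact ⟨c • w, Submodule.smul_mem _ _ hw, fun x => by simp [hw']⟩
    obtain ⟨w, hw, hw'⟩ := key _ (transfer_sub_mem K P g τ)
    refine ⟨(fun _ => TreeAlg.of τ) - w, Submodule.sub_mem _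
      (const_mem_contFam (of_mem_treeSpan (show S.deg τ ≤ S.deg τ from le_rfl))) hw, fun x => ?_⟩
    rw [Pi.sub_apply, map_sub, hw', sub_sub_cancel]

end Transfer

end

section

variable {d : ℕ} {S : Scaling d}

/-! ### Norms on the model space -/

namespace TreeAlg

theorem normDeg_eq_sum (γ : ℝ) {v : TreeAlg d} {s : Finset (Tree d)} (h : (coeff v).support ⊆ s) :
    normDeg S γ v = ∑ σ ∈ s, open Classical in if S.deg σ = γ then |coeff v σ| else 0 :=
  Finset.sum_subset h fun σ _ hσ => by rw [Finsupp.notMem_support_iff.1 hσ]; simp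

theorem normDeg_zero (γ : ℝ) : normDeg S γ (0 : TreeAlg d) = 0 := by simp [normDeg]

theorem normDeg_nonneg (γ : ℝ) (v : TreeAlg d) : 0 ≤ normDeg S γ v :=
  Finset.sum_nonneg fun σ _ => by split_ifs <;> positivity

theorem normDeg_add_le (γ : ℝ) (u v : TreeAlg d) :
    normDeg S γ (u + v) ≤ normDeg S γ u + normDeg S γ v := by
  classical
  have hs : (coeff (u + v)).support ⊆ (coeff u).support ∪ (coeff v).support := by
    rw [map_add]; exact Finsupp.support_add
  rw [normDeg_eq_sum γ hs, normDeg_eq_sum γ (v := u) Finset.subset_union_left,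
    normDeg_eq_sum γ (v := v) Finset.subset_union_right, ← Finset.sum_add_distrib]
  refine Finset.sum_le_sum fun σ _ => ?_
  split_ifs
  · rw [map_add]; exact abs_add_le _ _
  · simp

theorem normDeg_smul (γ c : ℝ) (v : TreeAlg d) :
    normDeg S γ (c • v) = |c| * normDeg S γ v := by
  have hs : (coeff (c • v)).support ⊆ (coeff v).support := by
    rw [map_smul]; exact Finsupp.support_smul
  rw [normDeg_eq_sum γ hs, normDeg, Finset.mul_sum]
  refine Finset.sum_congr rfl fun σ _ => ?_
  rw [map_smul, Finsupp.smul_apply, smul_eq_mul, abs_mul, mul_ite, mul_zero]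

theorem normDeg_sum_le (γ : ℝ) {ι : Type*} (s : Finset ι) (v : ι → TreeAlg d) :
    normDeg S γ (∑ i ∈ s, v i) ≤ ∑ i ∈ s, normDeg S γ (v i) :=
  Finset.le_sum_of_subadditive _ (normDeg_zero γ).le (normDeg_add_le γ) s v

theorem abs_coeff_le_normDeg (v : TreeAlg d) (ρ : Tree d) :
    |coeff v ρ| ≤ normDeg S (S.deg ρ) v := by
  classical
  have hs : (coeff v).support ⊆ insert ρ (coeff v).support := Finset.subset_insert _ _
  rw [normDeg_eq_sum _ hs]
  refine le_trans ?_ (Finset.single_le_sum (fun σ _ => ?_) (Finset.mem_insert_self ρ _))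
  · simp
  · split_ifs <;> positivity

theorem normDeg_le_sum (γ : ℝ) {v : TreeAlg d} {s : Finset (Tree d)}
    (h : (coeff v).support ⊆ s) : normDeg S γ v ≤ ∑ σ ∈ s, |coeff v σ| := by
  rw [normDeg_eq_sum γ h]
  refine Finset.sum_le_sum fun σ _ => ?_
  split_ifs
  · rfl
  · positivity

theorem normDeg_eq_zero {γ c : ℝ} (h : γ < c) {v : TreeAlg d}
    (hv : v ∈ treeSpan {σ | c ≤ S.deg σ}) : normDeg S γ v = 0 := by
  refine Finset.sum_eq_zero fun σ _ => ?_
  split_ifs with hσ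
  · rw [coeff_eq_zero_of_mem_treeSpan hv, abs_zero]
    exact not_le.2 (hσ.trans_lt h)
  · rfl

end TreeAlg

theorem exists_bound_of_isCompact {Y : Type*} [TopologicalSpace Y] {C : Set Y} (hC : IsCompact C)
    {a : Y → ℝ} (ha : Continuous a) : ∃ A : ℝ, 0 ≤ A ∧ ∀ y ∈ C, |a y| ≤ A := by
  obtain ⟨A, hA⟩ := hC.exists_bound_of_continuousOn ha.continuousOn
  exact ⟨|A|, abs_nonneg _, fun y hy => (hA y hy).trans (le_abs_self _)⟩

theorem exists_normDeg_bound {Y : Type*} [TopologicalSpace Y] {C : Set Y} (hC : IsCompact C)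
    {D : Set (Tree d)} {w : Y → TreeAlg d} (hw : w ∈ contFam Y D) :
    ∃ b : ℝ, 0 ≤ b ∧ ∀ γ, ∀ y ∈ C, TreeAlg.normDeg S γ (w y) ≤ b := by
  obtain ⟨s, -, hs⟩ := exists_finset_of_mem_contFam hw
  obtain ⟨b, hb, hb'⟩ := exists_bound_of_isCompact hC
    (continuous_finsetSum s fun σ _ => (continuous_coeff_of_mem_contFam hw σ).abs)
  exact ⟨b, hb, fun γ y hy =>
    (TreeAlg.normDeg_le_sum γ (hs y)).trans ((le_abs_self _).trans (hb' y hy))⟩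

theorem Scaling.norm_nonneg (x : Space d) : 0 ≤ S.norm x :=
  Finset.sum_nonneg fun _ _ => Real.rpow_nonneg (abs_nonneg _) _

theorem Scaling.continuous_norm : Continuous (S.norm : Space d → ℝ) := by
  unfold Scaling.norm
  refine continuous_finsetSum _ fun i _ => Continuous.rpow_const (by fun_prop) fun _ => .inr ?_
  exact one_div_nonneg.2 (zero_le_one.trans (S.one_le i))

/-! ### Recentring on the model space -/

section ModelSpace

variable {R : Rule d} (K : Kernel d)

theorem conforms_branches_subset (hR : R.IsNormal) {τ : Tree d} (hτ : R.Conforms τ) :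
    branches R τ ⊆ {σ | R.Conforms σ} := fun _ h => conforms_of_mem_branches hR hτ h

theorem recentre_mem_modelSpace (hR : R.IsNormal) {R' : Rule d}
    (P : modelSpace R' →ₗ[ℝ] SmoothFun d) (x : Space d) {v : TreeAlg d} (hv : v ∈ modelSpace R) :
    recentre S K P x v ∈ modelSpace R :=
  map_mem_of_mem_treeSpan (recentre S K P x).toLinearMap (fun τ hτ => treeSpan_mono
    (conforms_branches_subset hR hτ) (mem_treeSpan_of_mem_contFam
      (recentre_mem_contFam K P hR continuous_id τ hτ.2) x)) hv

theorem recentreInv_mem_modelSpace (hR : R.IsNormal) {R' : Rule d}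
    (P : modelSpace R' →ₗ[ℝ] SmoothFun d) (x : Space d) {v : TreeAlg d} (hv : v ∈ modelSpace R) :
    recentreInv S K P x v ∈ modelSpace R :=
  map_mem_of_mem_treeSpan (recentreInv S K P x).toLinearMap (fun τ hτ => treeSpan_mono
    (conforms_branches_subset hR hτ) (mem_treeSpan_of_mem_contFam
      (recentreInv_mem_contFam K P hR continuous_id τ hτ.2) x)) hv

theorem GamXY_mem_modelSpace (hR : R.IsNormal) {R' : Rule d}
    (P : modelSpace R' →ₗ[ℝ] SmoothFun d) (x y : Space d) {v : TreeAlg d}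
    (hv : v ∈ modelSpace R) : GamXY S K P x y v ∈ modelSpace R := by
  rw [GamXY_eq]
  exact recentreInv_mem_modelSpace K hR P x (recentre_mem_modelSpace K hR P y hv)

theorem GamXY_mem_contFam (hR : R.IsNormal) {R' : Rule d}
    (P : modelSpace R' →ₗ[ℝ] SmoothFun d) {τ : Tree d} (hτ : R.Conforms τ) :
    (fun p : Space d × Space d => GamXY S K P p.1 p.2 (TreeAlg.of τ)) ∈
      contFam (Space d × Space d) {σ | R.Conforms σ} := by
  simp only [GamXY_eq]
  have h := fun (σ : Tree d) (hσ : R.Conforms σ) => contFam_mono (conforms_branches_subset hR hσ)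
    (recentreInv_mem_contFam (Y := Space d × Space d) (S := S) K P hR continuous_fst σ hσ.2)
  exact contFam_bind' (fun p : Space d × Space d => (recentreInv S K P p.1).toLinearMap)
    (D := branches R τ) (v := fun p => recentre S K P p.2 (TreeAlg.of τ))
    (fun σ hσ => h σ (conforms_of_mem_branches hR hτ hσ))
    (recentre_mem_contFam K P hR continuous_snd τ hτ.2)

variable (P : modelSpace R →ₗ[ℝ] SmoothFun d) (g : NegChar S R)

/-- The two maps may differ off 𝓣, but the coefficients of F_x only use Π_x of branches. A branch
conforms when the nodes above the root do, and normality keeps its recentring in 𝓣. -/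
theorem recentre_renormalise_of (hR : R.IsNormal) (x : Space d) (τ : Tree d)
    (hτ : ∀ N ∈ τ.upperNodes, N ∈ R) :
    recentre S K (renormalise P g) x (TreeAlg.of τ) =
      recentre S K (renormFull P g) x (TreeAlg.of τ) := by
  induction τ using Tree.mul_induction with
  | h1 => rw [TreeAlg.of_one, map_one, map_one]
  | hmul s t hs ht =>
    simp only [Tree.upperNodes_mul, Multiset.mem_add] at hτ
    rw [TreeAlg.of_mul, map_mul, map_mul, hs fun N hN => hτ N (.inl hN),
      ht fun N hN => hτ N (.inr hN)]
  | hX i => rw [recentre_Xsingle, recentre_Xsingle]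
  | hXi l => rw [recentre_Xi, recentre_Xi]
  | hI m s hs =>
    simp only [Tree.upperNodes_I, Multiset.mem_add, Multiset.mem_singleton] at hτ
    have hs' : R.Conforms s := ⟨hτ _ (.inl rfl), fun N hN => hτ N (.inr hN)⟩
    have ih := hs hs'.2
    rw [recentre_I_of, recentre_I_of, polyPart_eq, polyPart_eq,
      recentre_taylor K (renormalise P g) (renormFull P g), extendZero_renormalise g P
        (recentre_mem_modelSpace K hR _ x (of_mem_modelSpace hs')), ih]
    simp only [renormFull, extendZero_fullMap]
    rfl

theorem recentre_renormalise (hR : R.IsNormal) (x : Space d) {v : TreeAlg d}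
    (hv : v ∈ modelSpace R) :
    recentre S K (renormalise P g) x v = recentre S K (renormFull P g) x v :=
  map_eq_of_mem_treeSpan (L := (recentre S K (renormalise P g) x).toLinearMap)
    (L' := (recentre S K (renormFull P g) x).toLinearMap)
    (fun τ hτ => recentre_renormalise_of K P g hR x τ hτ.2) hv

theorem transfer_mem_modelSpace (hR : R.IsNormal) (hc : Rule.IsComplete S R) (x : Space d)
    {v : TreeAlg d} (hv : v ∈ modelSpace R) : transfer K P g x v ∈ modelSpace R :=
  recentreInv_mem_modelSpace K hR P x
    (renormMap_mem g hc (recentre_mem_modelSpace K hR _ x hv))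

theorem recentredMap_renormalise (hR : R.IsNormal) (x : Space d) {v : TreeAlg d}
    (hv : v ∈ modelSpace R) : recentredMap S K (renormalise P g) x v =
      recentredMap S K P x (transfer K P g x v) := by
  change extendZero (renormalise P g) (recentre S K (renormalise P g) x v) =
    extendZero P (recentre S K P x (transfer K P g x v))
  rw [extendZero_renormalise g P (recentre_mem_modelSpace K hR _ x hv),
    recentre_renormalise K P g hR x hv, recentre_transfer]

/-- Applying F_x to either side gives M F_y^g `v`. -/
theorem transfer_GamXY (hR : R.IsNormal) (x y : Space d) {v : TreeAlg d}
    (hv : v ∈ modelSpace R) :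
    transfer K P g x (GamXY S K (renormalise P g) x y v) =
      GamXY S K P x y (transfer K P g y v) := by
  apply (recentre_bijective S K P x).1
  change recentre S K P x _ = recentre S K P x _
  rw [recentre_transfer, ← recentre_renormalise K P g hR x
    (GamXY_mem_modelSpace K hR _ x y hv), GamXY_eq, GamXY_eq, recentre_recentreInv,
    recentre_recentreInv, recentre_transfer, recentre_renormalise K P g hR y hv]

theorem transfer_mem_contFam (hR : R.IsNormal) (hc : Rule.IsComplete S R) {τ : Tree d}
    (hτ : R.Conforms τ) : (fun x => transfer K P g x (TreeAlg.of τ)) ∈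
      contFam (Space d) ({σ | S.deg τ ≤ S.deg σ} ∩ {σ | R.Conforms σ}) :=
  mem_contFam_of_mem_treeSpan (transfer_mem K P g τ) fun x =>
    transfer_mem_modelSpace K P g hR hc x (of_mem_modelSpace hτ)

end ModelSpace

/-! ### The renormalised map is a pre-model -/

section PreModel

variable {R : Rule d} {K : Kernel d} {P : modelSpace R →ₗ[ℝ] SmoothFun d} (g : NegChar S R)

/-- Evaluation at a point. -/
def SmoothFun.evalAt (z : Space d) : SmoothFun d →ₗ[ℝ] ℝ :=
  LinearMap.proj z ∘ₗ (SmoothFun d).subtype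

theorem conforms_X_mul {k : MIdx d} {τ : Tree d} (h : R.Conforms τ) :
    R.Conforms (Tree.X k * τ) := by
  rw [Rule.Conforms, Tree.rootEdges_mul, Tree.upperNodes_mul, Tree.rootEdges_X,
    Tree.upperNodes_X, zero_add, zero_add]
  exact h

/-- Nothing is extracted at the root of 𝟏, Ξ_l or 𝓘_m[τ], and X^k factors out of M, so each identity
for 𝚷, with the same ξ, passes to 𝚷M by linearity; completeness ensures that it is applied to
conforming trees. -/
theorem isAdmissible_renormalise (hc : Rule.IsComplete S R) (h : IsAdmissible K P) :
    IsAdmissible K (renormalise P g) := by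
  obtain ⟨ξ, h1, h2, h3, h4⟩ := h
  have ext : ∀ {τ}, R.Conforms τ → extendZero (renormalise P g) (TreeAlg.of τ) =
      extendZero P (renormMap g (TreeAlg.of τ)) := fun hτ =>
    extendZero_renormalise g P (of_mem_modelSpace hτ)
  refine ⟨ξ, fun k τ hτ z => ?_, fun hτ z => ?_, fun l hτ => ?_, fun m τ hτ z => ?_⟩
  · rw [ext hτ, ext (conforms_X_mul hτ), renormMap_X_mul]
    refine map_eq_of_mem_treeSpan
      (L := SmoothFun.evalAt z ∘ₗ extendZero P ∘ₗ LinearMap.mulLeft ℝ (TreeAlg.of (Tree.X k)))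
      (L' := (∏ i, z i ^ k i) • (SmoothFun.evalAt z ∘ₗ extendZero P)) (fun σ hσ => ?_)
      (renormMap_mem g hc (of_mem_modelSpace hτ))
    simp only [LinearMap.comp_apply, LinearMap.mulLeft_apply, ← TreeAlg.of_mul]
    exact h1 k σ hσ z
  · rw [ext hτ, renormMap_one]
    exact h2 hτ z
  · rw [ext hτ, renormMap_Xi]
    exact h3 l hτ
  · have hτ1 := hτ.1
    have hτ2 := hτ.2
    rw [Tree.rootEdges_I] at hτ1
    rw [Tree.upperNodes_I] at hτ2
    simp only [Multiset.mem_add, Multiset.mem_singleton] at hτ2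
    have hτ' : R.Conforms τ := ⟨hτ2 _ (.inl rfl), fun N hN => hτ2 N (.inr hN)⟩
    rw [ext hτ, ext hτ', renormMap_I]
    refine map_eq_of_mem_treeSpan (L := SmoothFun.evalAt z ∘ₗ extendZero P ∘ₗ TreeAlg.I m)
      (L' := K.convLin m z ∘ₗ extendZero P) (fun σ hσ => ?_)
      (renormMap_mem g hc (of_mem_modelSpace hτ'))
    simp only [LinearMap.comp_apply, ← I_of]
    refine h4 m σ ⟨by rwa [Tree.rootEdges_I], fun N hN => ?_⟩ z
    rw [Tree.upperNodes_I, Multiset.mem_add, Multiset.mem_singleton] at hN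
    exact hN.elim (fun h => h ▸ hσ.1) (hσ.2 N)

/-- Needed for additivity of the pairing with test functions. The rescaled function lives in the box
with half-widths λ^{𝔰_i} around `x`, because the unit ball lies in the unit cube. -/
theorem integrable_mul_rescale (F : SmoothFun d) {r : ℕ} {φ : SmoothFun d}
    (hφ : φ ∈ testFun d r) {lam : ℝ} (hlam : 0 < lam) (x : Space d) :
    MeasureTheory.Integrable fun z => F.1 z * rescale S φ.1 lam x z := by
  have hc : Continuous (rescale S φ.1 lam x) := by
    refine continuous_const.mul ((SmoothFun.contDiff φ).continuous.comp
      ((PiLp.continuous_toLp 2 _).comp (continuous_pi fun i => ?_)))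
    fun_prop
  have hs : HasCompactSupport (rescale S φ.1 lam x) := by
    refine HasCompactSupport.intro (K := WithLp.toLp 2 ''
      Set.univ.pi fun i => Set.Icc (x i - lam ^ S.s i) (x i + lam ^ S.s i))
      ((isCompact_univ_pi fun i => isCompact_Icc).image (PiLp.continuous_toLp 2 _))
      fun z hz => ?_
    by_contra h0
    apply hz
    have h1 : (WithLp.toLp 2 fun i => lam ^ (-S.s i) * (z i - x i) : Space d) ∈
        Metric.ball (0 : Space d) 1 := hφ.1 (subset_tsupport _ (right_ne_zero_of_mul h0))
    rw [mem_ball_zero_iff] at h1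
    refine ⟨WithLp.ofLp z, fun i _ => ?_, rfl⟩
    have h2 := (PiLp.norm_apply_le (WithLp.toLp 2 fun i => lam ^ (-S.s i) * (z i - x i) : Space d)
      i).trans h1.le
    have hp : 0 < lam ^ S.s i := Real.rpow_pos_of_pos hlam _
    simp only [Real.norm_eq_abs, abs_mul, Real.rpow_neg hlam.le, abs_inv, abs_of_pos hp] at h2
    rw [inv_mul_le_iff₀ hp, mul_one] at h2
    obtain ⟨h3, h4⟩ := abs_le.1 h2
    exact ⟨by linarith, by linarith⟩
  exact ((SmoothFun.contDiff F).continuous.mul hc).integrable_of_hasCompactSupport hs.mul_left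

/-- For λ ≤ 1 a higher degree gives a smaller power of λ, and continuous weights are bounded on `C`.
-/
theorem bound_Pi_of_mem_contFam {r : ℕ} (hP : IsPreModel S K P r) {c₀ : ℝ}
    {v : Space d → TreeAlg d}
    (hv : v ∈ contFam (Space d) ({σ | c₀ ≤ S.deg σ} ∩ {σ | R.Conforms σ}))
    {C : Set (Space d)} (hC : IsCompact C) : ∃ c : ℝ,
    ∀ x ∈ C, ∀ lam : ℝ, 0 < lam → lam ≤ 1 → ∀ φ ∈ testFun d r,
      |∫ z, (recentredMap S K P x (v x)).1 z * rescale S φ.1 lam x z| ≤ c * lam ^ c₀ := by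
  have hsmul : ∀ (a : ℝ) (u : TreeAlg d) (x : Space d) (ψ : Space d → ℝ),
      ∫ z, (recentredMap S K P x (a • u)).1 z * ψ z =
        a * ∫ z, (recentredMap S K P x u).1 z * ψ z := by
    intro a u x ψ
    rw [map_smul, ← MeasureTheory.integral_const_mul]
    refine MeasureTheory.integral_congr_ae (Filter.Eventually.of_forall fun z => ?_)
    exact mul_assoc _ _ _
  induction hv using Submodule.span_induction with
  | mem v hv =>
    obtain ⟨a, ha, σ, ⟨hσ, hσ'⟩, rfl⟩ := hv
    obtain ⟨A, hA, hA'⟩ := exists_bound_of_isCompact hC ha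
    obtain ⟨c, hc⟩ := hP.bound_Pi σ hσ' C hC
    refine ⟨A * |c|, fun x hx lam h0 h1 φ hφ => ?_⟩
    rw [hsmul, abs_mul, mul_assoc]
    refine mul_le_mul (hA' x hx) ?_ (abs_nonneg _) hA
    refine (hc x hx lam h0 h1 φ hφ).trans ?_
    exact mul_le_mul (le_abs_self c) (Real.rpow_le_rpow_of_exponent_ge h0 h1 hσ)
      (Real.rpow_nonneg h0.le _) (abs_nonneg c)
  | zero => exact ⟨0, fun x _ lam _ _ φ _ => by simp⟩
  | add u v _ _ hu hv =>
    obtain ⟨c, hc⟩ := hu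
    obtain ⟨c', hc'⟩ := hv
    refine ⟨c + c', fun x hx lam h0 h1 φ hφ => ?_⟩
    have e : ∫ z, (recentredMap S K P x ((u + v) x)).1 z * rescale S φ.1 lam x z =
        (∫ z, (recentredMap S K P x (u x)).1 z * rescale S φ.1 lam x z) +
        ∫ z, (recentredMap S K P x (v x)).1 z * rescale S φ.1 lam x z := by
      rw [Pi.add_apply, map_add, ← MeasureTheory.integral_add
        (integrable_mul_rescale _ hφ h0 x) (integrable_mul_rescale _ hφ h0 x)]
      refine MeasureTheory.integral_congr_ae (Filter.Eventually.of_forall fun z => ?_)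
      exact add_mul _ _ _
    rw [e, add_mul]
    exact (abs_add_le _ _).trans (add_le_add (hc x hx lam h0 h1 φ hφ) (hc' x hx lam h0 h1 φ hφ))
  | smul a u _ hu =>
    obtain ⟨c, hc⟩ := hu
    refine ⟨|a| * c, fun x hx lam h0 h1 φ hφ => ?_⟩
    rw [Pi.smul_apply, hsmul, abs_mul, mul_assoc]
    exact mul_le_mul_of_nonneg_left (hc x hx lam h0 h1 φ hφ) (abs_nonneg a)

/-- Composition of the bound on `Γ_{xy}` with a family of maps that do not decrease the degree. -/
theorem bound_Gam_of_conforms (hR : R.IsNormal) {r : ℕ} (hP : IsPreModel S K P r)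
    {w : Tree d → Space d → TreeAlg d}
    (hw : ∀ ρ, w ρ ∈ contFam (Space d) {σ | S.deg ρ ≤ S.deg σ}) {t : ℝ} {σ : Tree d}
    (hσ : R.Conforms σ) (ht : t ≤ S.deg σ) {C : Set (Space d)} (hC : IsCompact C) :
    ∃ c : ℝ, 0 ≤ c ∧ ∀ γ ≤ t, ∀ x ∈ C, ∀ y ∈ C,
      TreeAlg.normDeg S γ (TreeAlg.linExt (fun ρ => w ρ x) (GamXY S K P x y (TreeAlg.of σ))) ≤
        c * S.norm (x - y) ^ (t - γ) := by
  obtain ⟨s, hs, hs'⟩ := exists_finset_of_mem_contFam (GamXY_mem_contFam (S := S) K hR P hσ)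
  obtain ⟨c, hc⟩ := hP.bound_Gam σ hσ C hC
  obtain ⟨D, hD, hD'⟩ := exists_bound_of_isCompact (hC.prod hC) (a := fun p => S.norm (p.1 - p.2))
    (S.continuous_norm.comp (continuous_fst.sub continuous_snd))
  choose b hb hb' using fun ρ => exists_normDeg_bound (S := S) hC (hw ρ)
  -- The base 1 + D is at least 1, so surplus powers of the distance can be bounded with the
  -- exponent raised to one that does not depend on γ.
  refine ⟨∑ ρ ∈ s, |c| * (1 + D) ^ |S.deg σ - S.deg ρ| * b ρ,
    Finset.sum_nonneg fun ρ _ => mul_nonneg (by positivity) (hb ρ), fun γ hγ x hx y hy => ?_⟩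
  set n := S.norm (x - y) with hn
  have hn0 : 0 ≤ n := S.norm_nonneg _
  have hn1 : n ≤ 1 + D := by
    have := (le_abs_self _).trans (hD' (x, y) ⟨hx, hy⟩)
    simp only at this
    linarith
  have e : TreeAlg.linExt (fun ρ => w ρ x) (GamXY S K P x y (TreeAlg.of σ)) =
      ∑ ρ ∈ s, TreeAlg.coeff (GamXY S K P x y (TreeAlg.of σ)) ρ • w ρ x := by
    rw [TreeAlg.linExt, LinearMap.comp_apply, Finsupp.linearCombination_apply]
    exact Finsupp.sum_of_support_subset _ (hs' (x, y)) _ fun ρ _ => zero_smul _ _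
  rw [e, Finset.sum_mul]
  refine (TreeAlg.normDeg_sum_le γ s _).trans (Finset.sum_le_sum fun ρ hρ => ?_)
  rw [TreeAlg.normDeg_smul]
  -- A tree ρ with |ρ|_𝔰 > γ does not contribute, since `w ρ` only has degrees at least |ρ|_𝔰.
  rcases lt_or_ge γ (S.deg ρ) with h | h
  · rw [TreeAlg.normDeg_eq_zero h (mem_treeSpan_of_mem_contFam (hw ρ) x), mul_zero]
    have := hb ρ
    positivity
  have h1 : |TreeAlg.coeff (GamXY S K P x y (TreeAlg.of σ)) ρ| ≤
      |c| * ((1 + D) ^ |S.deg σ - S.deg ρ| * n ^ (t - γ)) := by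
    refine (TreeAlg.abs_coeff_le_normDeg (S := S) _ ρ).trans ((hc (S.deg ρ) ⟨ρ, hs ρ hρ, rfl⟩
      (by linarith) x hx y hy).trans ?_)
    -- The first bracket is the surplus exponent. Both parts being nonnegative, the power splits
    -- even when the distance is 0.
    have e2 : S.deg σ - S.deg ρ = (S.deg σ - t + (γ - S.deg ρ)) + (t - γ) := by ring
    have h3 : n ^ (S.deg σ - S.deg ρ) ≤ (1 + D) ^ |S.deg σ - S.deg ρ| * n ^ (t - γ) := by
      rw [abs_of_nonneg (by linarith)]
      nth_rewrite 1 [e2]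
      rw [Real.rpow_add_of_nonneg hn0 (by linarith) (by linarith)]
      refine mul_le_mul_of_nonneg_right ?_ (Real.rpow_nonneg hn0 _)
      exact (Real.rpow_le_rpow hn0 hn1 (by linarith)).trans
        (Real.rpow_le_rpow_of_exponent_le (by linarith) (by linarith))
    exact mul_le_mul (le_abs_self c) h3 (Real.rpow_nonneg hn0 _) (abs_nonneg c)
  calc _ ≤ |c| * ((1 + D) ^ |S.deg σ - S.deg ρ| * n ^ (t - γ)) * b ρ :=
        mul_le_mul h1 (hb' ρ γ x hx) (TreeAlg.normDeg_nonneg _ _) ((abs_nonneg _).trans h1)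
    _ = _ := by ring

theorem bound_Gam_of_mem_contFam (hR : R.IsNormal) {r : ℕ} (hP : IsPreModel S K P r)
    {w : Tree d → Space d → TreeAlg d}
    (hw : ∀ ρ, w ρ ∈ contFam (Space d) {σ | S.deg ρ ≤ S.deg σ}) {t : ℝ}
    {v : Space d → TreeAlg d}
    (hv : v ∈ contFam (Space d) ({σ | t ≤ S.deg σ} ∩ {σ | R.Conforms σ}))
    {C : Set (Space d)} (hC : IsCompact C) : ∃ c : ℝ, ∀ γ ≤ t, ∀ x ∈ C, ∀ y ∈ C,
      TreeAlg.normDeg S γ (TreeAlg.linExt (fun ρ => w ρ x) (GamXY S K P x y (v y))) ≤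
        c * S.norm (x - y) ^ (t - γ) := by
  induction hv using Submodule.span_induction with
  | mem v hv =>
    obtain ⟨a, ha, σ, ⟨hσ, hσ'⟩, rfl⟩ := hv
    obtain ⟨A, hA, hA'⟩ := exists_bound_of_isCompact hC ha
    obtain ⟨c, -, hc'⟩ := bound_Gam_of_conforms hR hP hw hσ' hσ hC
    refine ⟨A * c, fun γ hγ x hx y hy => ?_⟩
    rw [map_smul, map_smul, TreeAlg.normDeg_smul, mul_assoc]
    exact mul_le_mul (hA' y hy) (hc' γ hγ x hx y hy) (TreeAlg.normDeg_nonneg _ _) hA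
  | zero => exact ⟨0, fun γ _ x _ y _ => by simp [TreeAlg.normDeg_zero]⟩
  | add u v _ _ hu hv =>
    obtain ⟨c, hc⟩ := hu
    obtain ⟨c', hc'⟩ := hv
    refine ⟨c + c', fun γ hγ x hx y hy => ?_⟩
    rw [Pi.add_apply, map_add, map_add, add_mul]
    exact (TreeAlg.normDeg_add_le _ _ _).trans
      (add_le_add (hc γ hγ x hx y hy) (hc' γ hγ x hx y hy))
  | smul a u _ hu =>
    obtain ⟨c, hc⟩ := hu
    refine ⟨|a| * c, fun γ hγ x hx y hy => ?_⟩
    rw [Pi.smul_apply, map_smul, map_smul, TreeAlg.normDeg_smul, mul_assoc]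
    exact mul_le_mul_of_nonneg_left (hc γ hγ x hx y hy) (abs_nonneg a)

theorem isPreModel_renormalise (hR : R.IsNormal) (hc : Rule.IsComplete S R) {r : ℕ}
    (hP : IsPreModel S K P r) : IsPreModel S K (renormalise P g) r where
  admissible := isAdmissible_renormalise g hc hP.admissible
  bound_Pi τ hτ C hC := by
    obtain ⟨c, h⟩ := bound_Pi_of_mem_contFam hP (transfer_mem_contFam K P g hR hc hτ) hC
    refine ⟨c, fun x hx lam h0 h1 φ hφ => ?_⟩
    rw [recentredMap_renormalise K P g hR x (of_mem_modelSpace hτ)]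
    exact h x hx lam h0 h1 φ hφ
  bound_Gam τ hτ C hC := by
    -- `w ρ x` is N_x⁻¹ρ; it need not lie in 𝓣, as only its degrees and the size of its coefficients
    -- matter.
    choose w hw hw' using exists_transfer_eq K P g
    obtain ⟨c, h⟩ := bound_Gam_of_mem_contFam hR hP hw (transfer_mem_contFam K P g hR hc hτ) hC
    refine ⟨c, fun γ _ hγ x hx y hy => ?_⟩
    have hinv : ∀ v : TreeAlg d,
        transfer K P g x (TreeAlg.linExt (fun ρ => w ρ x) v) = v := fun v => by
      have e : transfer K P g x ∘ₗ TreeAlg.linExt (fun ρ => w ρ x) = LinearMap.id :=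
        TreeAlg.lin_ext fun ρ => by
          rw [LinearMap.comp_apply, TreeAlg.linExt_of, hw', LinearMap.id_apply]
      exact LinearMap.congr_fun e v
    -- This is Γ_{xy}^g = N_x⁻¹ Γ_{xy} N_y, checked after applying the injective N_x.
    have e : GamXY S K (renormalise P g) x y (TreeAlg.of τ) = TreeAlg.linExt (fun ρ => w ρ x)
        (GamXY S K P x y (transfer K P g y (TreeAlg.of τ))) := by
      apply transfer_injective K P g x
      rw [hinv, transfer_GamXY K P g hR x y (of_mem_modelSpace hτ)]
    rw [e]
    exact h γ hγ x hx y hy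

end PreModel

end

end RegStruct

end

theorem mainTheorem2 {d : ℕ} (S : RegStruct.Scaling d) (R : RegStruct.Rule d)
    (hnormal : R.IsNormal) (hsub : R.IsSubcritical S) (hcomplete : RegStruct.Rule.IsComplete S R)
    (K : RegStruct.Kernel d)
    (r : ℕ) (hr : ∀ τ, R.Conforms τ → 1 - S.deg τ < (r : ℝ))
    (g : RegStruct.NegChar S R)
    (P : RegStruct.modelSpace R →ₗ[ℝ] RegStruct.SmoothFun d)
    (hP : RegStruct.IsPreModel S K P r) :
    RegStruct.IsPreModel S K (RegStruct.renormalise P g) r :=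
  RegStruct.isPreModel_renormalise g hnormal hcomplete hP
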